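/- Let $1\le n\le h$ and let $\mathcal{C}\ell$ be the complexified Clifford algebra with generators $e_1,\dots,e_h$, $e_je_k+e_ke_j=-2\delta_{jk}$. Write its elements as $c=\sum_I c_Ie_I$ with $c_I\in\mathbb{C}$, $e_\emptyset=1$, and put $|c|^2=\sum_I|c_I|^2$, $\mathcal P c=c_\emptyset e_\emptyset$, $\mathcal Q=I-\mathcal P$. Let $a=a_0+\sum_{j=1}^n a_je_j$ with $a_0,\dots,a_n\in\mathbb{R}$, and let $$D_{ia}u=\sum_{j=1}^n e_j\,\partial_j u+i\,a\,u$$ be the disturbed Dirac operator, taken in the sense of distributions. Let $K_{a_0}$ be the fundamental solution of $-\Delta+a_0^2$ on $\mathbb{R}^n$, that is $$K_{a_0}(x)=(2\pi)^{-n/2}\left(\frac{|a_0|}{|x|}\right)^{\frac n2-1}K_{\frac n2-1}(|a_0||x|)$$ with the Macdonald function $K_p$ if $a_0\ne0$, and the Newtonian kernel (logarithmic for $n=2$) if $a_0=0$. Put $e_{ia}(x)=e^{-i\langle a,x\rangle}\left(\sum_{j=1}^n\partial_jK_{a_0}(x)\,e_j-ia_0K_{a_0}(x)\right)$, where $\langle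 a,x\rangle=\sum_{j=1}^n a_jx_j$. Let $G\subset\mathbb{R}^n$ be a bounded domain with Lipschitz boundary and $$(T_{ia}v)(x)=\int_G e_{ia}(x-y)v(y)\,dy,\qquad x\in\mathbb{R}^n .$$ Let $L_2(G)$ be the space of square integrable $\mathcal{C}\ell$-valued functions on $G$, with the real scalar product $(u,v)_G=\mathrm{Re}\int_G\sum_I\overline{u_I}v_I\,dx$ and its norm $\|\cdot\|_G$; norms over $\mathbb{R}^n\setminus\overline G$ are defined likewise. Then for every $v\in L_2(G)$ the integral $T_{ia}v$ converges almost everywhere in $\mathbb{R}^n$, and $B=D_{ia}\mathcal P T_{ia}$ is a well-defined bounded linear operator on $L_2(G)$. It is monotone, $(Bu-Bv,u-v)_G\ge0$ for all $u,v\in L_2(G)$, and its operator norm is at most $1$. For every $v\in L_2(G)$ the functions $D_{ia}\mathcal P T_{ia}v$ and $D_{ia}\mathcal Q T_{ia}v$ are square integrable on $\mathbb{R}^n\setminus\overline G$ and $$(Bv,v)_G=\|Bv\|_G^2+\tfrac12\left\{\|D_{ia}\mathcal P T_{ia}v\|^2_{\mathbb{R}^n\setminus\overline G}+\|D_{ia}\mathcal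 Q T_{ia}v\|^2_{\mathbb{R}^n\setminus\overline G}\right\}.$$ Moreover, $B$ maps the subspace $\mathrm{PVec}\,L_2(G)$ of functions with values $c_0+\sum_{j=1}^n c_je_j$ ($c_j\in\mathbb{C}$) into itself, and for every operator $F:\mathrm{PVec}\,L_2(G)\to\mathrm{PVec}\,L_2(G)$ each of the hypotheses of the Browder–Minty theorem (monotone or strictly monotone, coercive, hemicontinuous) that holds for $F$ also holds for $u\mapsto F(u)+Bu$. -/

import Mathlib

noncomputable section

/-- Points of `ℝⁿ` with the Euclidean norm. -/
abbrev Pt (n : ℕ) : Type := EuclideanSpace ℝ (Fin n)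

/-! The complexified Clifford algebra with `h` generators. An element `∑_I c_I e_I` is the family
of its complex coordinates `c_I`, where `I` runs through the subsets of `{1, …, h}`; the norm is
`(∑_I |c_I|²)^{1/2}`. -/

/-- The complexified Clifford algebra of Euclidean `h`-space. -/
abbrev Cl (h : ℕ) : Type := EuclideanSpace ℂ (Finset (Fin h))

/-- The sign in `e_I e_J = ± e_{I ∆ J}`: one factor `-1` for each pair `i ∈ I`, `j ∈ J` with
`j < i` (a transposition) or `j = i` (as `e_i² = -1`). -/
def clSign {h : ℕ} (I J : Finset (Fin h)) : ℤ :=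
  ∏ i ∈ I, ∏ j ∈ J, if j ≤ i then -1 else 1

theorem prod_symmDiff_of_sq_eq_one {α : Type*} [DecidableEq α] (f : α → ℤ)
    (hf : ∀ i, f i * f i = 1) (I J : Finset α) :
    ∏ i ∈ symmDiff I J, f i = (∏ i ∈ I, f i) * ∏ i ∈ J, f i := by
  have h1 : ∏ i ∈ I, f i = (∏ i ∈ I \ J, f i) * ∏ i ∈ I ∩ J, f i := by
    rw [mul_comm]; exact (Finset.prod_inter_mul_prod_sdiff I J f).symm
  have h2 : ∏ i ∈ J, f i = (∏ i ∈ J \ I, f i) * ∏ i ∈ I ∩ J, f i := by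
    rw [mul_comm, Finset.inter_comm]; exact (Finset.prod_inter_mul_prod_sdiff J I f).symm
  have h3 : (∏ i ∈ I ∩ J, f i) * ∏ i ∈ I ∩ J, f i = 1 := by
    rw [← Finset.prod_mul_distrib]; exact Finset.prod_eq_one (fun i _ => hf i)
  have h4 : ∏ i ∈ symmDiff I J, f i = (∏ i ∈ I \ J, f i) * ∏ i ∈ J \ I, f i := by
    rw [symmDiff_def]
    exact Finset.prod_union disjoint_sdiff_sdiff
  rw [h1, h2, h4]
  linear_combination (-(∏ i ∈ I \ J, f i) * ∏ i ∈ J \ I, f i) * h3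

theorem clSign_symmDiff_left {h : ℕ} (I J K : Finset (Fin h)) :
    clSign (symmDiff I J) K = clSign I K * clSign J K := by
  refine prod_symmDiff_of_sq_eq_one _ (fun i => ?_) I J
  rw [← Finset.prod_mul_distrib]
  exact Finset.prod_eq_one (fun j _ => by split_ifs <;> norm_num)

theorem clSign_symmDiff_right {h : ℕ} (I J K : Finset (Fin h)) :
    clSign I (symmDiff J K) = clSign I J * clSign I K := by
  unfold clSign
  rw [← Finset.prod_mul_distrib]
  exact Finset.prod_congr rfl (fun i _ =>
    prod_symmDiff_of_sq_eq_one _ (fun j => by split_ifs <;> norm_num) J K)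

/-- The bilinear product with `e_I e_J = clSign I J • e_{I ∆ J}`: the coordinate of `u v` at `K`
collects the pairs `(I, J)` with `I ∆ J = K`, that is `J = I ∆ K`. -/
instance instMulCl (h : ℕ) : Mul (Cl h) :=
  ⟨fun u v => WithLp.toLp 2 fun K =>
    ∑ I, (clSign I (symmDiff I K) : ℂ) * u I * v (symmDiff I K)⟩

theorem cl_mul_apply {h : ℕ} (u v : Cl h) (K : Finset (Fin h)) :
    (u * v) K = ∑ I, (clSign I (symmDiff I K) : ℂ) * u I * v (symmDiff I K) := rfl

/-- The unit `e_∅`. -/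
instance instOneCl (h : ℕ) : One (Cl h) := ⟨EuclideanSpace.single ∅ 1⟩

theorem cl_one_apply {h : ℕ} (K : Finset (Fin h)) :
    (1 : Cl h) K = if K = ∅ then 1 else 0 :=
  PiLp.single_apply 2 ℂ ∅ 1 K

theorem cl_one_mul {h : ℕ} (u : Cl h) : 1 * u = u := by
  ext K
  have h0 : symmDiff ∅ K = K := bot_symmDiff K
  rw [cl_mul_apply, Finset.sum_eq_single ∅]
  · simp [cl_one_apply, clSign, h0]
  · intro I _ hI
    simp [cl_one_apply, hI]
  · simp

theorem cl_mul_one {h : ℕ} (u : Cl h) : u * 1 = u := by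
  ext K
  rw [cl_mul_apply, Finset.sum_eq_single K]
  · simp [cl_one_apply, clSign]
  · intro I _ hI
    have : symmDiff I K ≠ ∅ := by
      rw [← Finset.bot_eq_empty, Ne, symmDiff_eq_bot]; exact hI
    simp [cl_one_apply, this]
  · simp

theorem cl_mul_assoc {h : ℕ} (u v w : Cl h) : u * v * w = u * (v * w) := by
  ext K
  simp only [cl_mul_apply, Finset.sum_mul, Finset.mul_sum]
  rw [Finset.sum_comm]
  refine Finset.sum_congr rfl (fun I _ => ?_)
  have hinv : Function.Involutive (fun L : Finset (Fin h) => symmDiff I L) :=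
    fun L => symmDiff_symmDiff_cancel_left I L
  refine Fintype.sum_equiv hinv.toPerm _ _ (fun L => ?_)
  have e1 : symmDiff (symmDiff I L) (symmDiff I K) = symmDiff L K := by
    rw [symmDiff_symmDiff_symmDiff_comm]; simp
  have e2 : clSign L (symmDiff L K) * clSign I (symmDiff I L)
      = clSign I (symmDiff I K) * clSign (symmDiff I L) (symmDiff L K) := by
    have hsq : clSign I K * clSign I K = 1 := by
      rw [← clSign_symmDiff_right]; simp [clSign]
    simp only [clSign_symmDiff_left, clSign_symmDiff_right]
    linear_combination (-clSign L L * clSign L K * clSign I I * clSign I L) * hsq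
  have e3 : (clSign L (symmDiff L K) : ℂ) * clSign I (symmDiff I L)
      = clSign I (symmDiff I K) * clSign (symmDiff I L) (symmDiff L K) := by
    exact_mod_cast e2
  simp only [Function.Involutive.coe_toPerm, e1]
  linear_combination (u I * v (symmDiff I L) * w (symmDiff L K)) * e3

instance instRingCl (h : ℕ) : Ring (Cl h) where
  __ := (inferInstance : AddCommGroup (Cl h))
  __ := instMulCl h
  __ := instOneCl h
  mul_assoc := cl_mul_assoc
  one_mul := cl_one_mul
  mul_one := cl_mul_one
  zero_mul u := by ext K; simp [cl_mul_apply]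
  mul_zero u := by ext K; simp [cl_mul_apply]
  left_distrib u v w := by
    ext K; simp [cl_mul_apply, mul_add, Finset.sum_add_distrib]
  right_distrib u v w := by
    ext K; simp [cl_mul_apply, mul_add, add_mul, Finset.sum_add_distrib]

instance instAlgebraCl (h : ℕ) : Algebra ℂ (Cl h) :=
  Algebra.ofModule
    (fun c u v => by
      ext K
      simp only [cl_mul_apply, PiLp.smul_apply, smul_eq_mul, Finset.mul_sum]
      exact Finset.sum_congr rfl (fun I _ => by ring))
    (fun c u v => by
      ext K
      simp only [cl_mul_apply, PiLp.smul_apply, smul_eq_mul, Finset.mul_sum]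
      exact Finset.sum_congr rfl (fun I _ => by ring))

/-- The basis element `e_I`. -/
def clBasis {h : ℕ} (I : Finset (Fin h)) : Cl h := EuclideanSpace.single I 1

/-- The generator `e_j`. -/
def clGen {h : ℕ} (j : Fin h) : Cl h := clBasis {j}

theorem clBasis_mul {h : ℕ} (I J : Finset (Fin h)) :
    clBasis I * clBasis J = (clSign I J : ℂ) • clBasis (symmDiff I J) := by
  ext K
  rw [cl_mul_apply, Finset.sum_eq_single I]
  · by_cases hK : symmDiff I K = J
    · have hK' : K = symmDiff I J := by rw [← hK]; simp
      subst hK'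
      simp [clBasis]
    · have hK' : K ≠ symmDiff I J := by
        rintro rfl; exact hK (symmDiff_symmDiff_cancel_left I J)
      simp [clBasis, hK, hK']
  · intro L _ hL
    simp [clBasis, hL]
  · simp

/-- The defining relations `e_j e_k + e_k e_j = -2 δ_{jk}`. -/
theorem clGen_mul_add {h : ℕ} (j k : Fin h) :
    clGen j * clGen k + clGen k * clGen j = if j = k then (-2 : Cl h) else 0 := by
  have h1 : (clBasis ∅ : Cl h) = 1 := rfl
  unfold clGen
  rw [clBasis_mul, clBasis_mul]
  split_ifs with hjk
  · subst hjk
    have h2 : clSign {j} {j} = -1 := by simp [clSign]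
    rw [symmDiff_self, Finset.bot_eq_empty, h1, h2, ← add_smul]
    have h3 : (((-1 : ℤ) : ℂ) + ((-1 : ℤ) : ℂ)) = -2 := by norm_num
    rw [h3, neg_smul, Algebra.smul_def, mul_one, map_ofNat]
  · have h2 : clSign {j} {k} + clSign {k} {j} = 0 := by
      rcases lt_or_gt_of_ne hjk with h3 | h3 <;> simp [clSign, h3.le, not_le.mpr h3]
    rw [symmDiff_comm ({k} : Finset (Fin h)) {j}, ← add_smul]
    have h4 : (clSign {j} {k} : ℂ) + clSign {k} {j} = 0 := by exact_mod_cast h2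
    rw [h4, zero_smul]

/-- `e_I` is the product of its generators in increasing order. -/
theorem clGen_mul_clBasis {h : ℕ} (j : Fin h) (I : Finset (Fin h)) (hj : ∀ i ∈ I, j < i) :
    clGen j * clBasis I = clBasis (insert j I) := by
  have h1 : clSign {j} I = 1 := by
    unfold clSign
    rw [Finset.prod_singleton]
    exact Finset.prod_eq_one (fun i hi => if_neg (not_le.mpr (hj i hi)))
  have h2 : symmDiff {j} I = insert j I := by
    have hd : Disjoint ({j} : Finset (Fin h)) I := by
      rw [Finset.disjoint_singleton_left]; exact fun hi => lt_irrefl _ (hj j hi)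
    rw [hd.symmDiff_eq_sup]; rfl
  rw [clGen, clBasis_mul, h1, h2]; simp

/-- The scalar part `c_0 = c_∅` of `c`. -/
def scalarPart {h : ℕ} (c : Cl h) : ℂ := c ∅

/-- The projection `𝒫` onto the scalar part (the scalars are `ℂ e_0`). -/
def projP {h : ℕ} (c : Cl h) : Cl h := scalarPart c • (1 : Cl h)

/-- The complementary projection `𝒬 = I - 𝒫`. -/
def projQ {h : ℕ} (c : Cl h) : Cl h := c - projP c

/-- The involution `c̃ = ∑_I conj(c_I) ē_I` with `ē_I = (-1)^{|I|(|I|+1)/2} e_I`. -/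
def clTilde {h : ℕ} (c : Cl h) : Cl h :=
  WithLp.toLp 2 fun I => (-1 : ℂ) ^ (I.card * (I.card + 1) / 2) * (starRingEnd ℂ) (c I)

theorem clSign_self {h : ℕ} (I : Finset (Fin h)) :
    clSign I I = (-1) ^ (I.card * (I.card + 1) / 2) := by
  induction I using Finset.induction_on_max with
  | empty => simp [clSign]
  | insert m I hm ih =>
    have hmI : m ∉ I := fun hi => lt_irrefl _ (hm m hi)
    have hd : Disjoint ({m} : Finset (Fin h)) I := by
      rwa [Finset.disjoint_singleton_left]
    have h2 : insert m I = symmDiff {m} I := by rw [hd.symmDiff_eq_sup]; rfl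
    have h3 : clSign {m} I = (-1) ^ I.card := by
      unfold clSign
      rw [Finset.prod_singleton, Finset.prod_congr rfl (fun i hi => if_pos (hm i hi).le)]
      simp
    have h4 : clSign I {m} = 1 := by
      unfold clSign
      refine Finset.prod_eq_one (fun i hi => ?_)
      rw [Finset.prod_singleton]
      exact if_neg (not_le.mpr (hm i hi))
    have h5 : clSign {m} {m} = -1 := by simp [clSign]
    rw [Finset.card_insert_of_notMem hmI, h2, clSign_symmDiff_left, clSign_symmDiff_right,
      clSign_symmDiff_right, h3, h4, h5, ih]
    have h6 : (I.card + 1) * (I.card + 1 + 1) / 2 = I.card * (I.card + 1) / 2 + I.card + 1 := by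
      have : (I.card + 1) * (I.card + 1 + 1) = I.card * (I.card + 1) + 2 * (I.card + 1) := by ring
      rw [this, Nat.add_mul_div_left _ _ (by norm_num)]; ring
    rw [h6]; ring

/-- The Hermitian product of `Cl h` is the scalar part of `ũ v`; its real part is the real scalar
product `[u, v]`. -/
theorem inner_eq_scalarPart {h : ℕ} (u v : Cl h) :
    inner ℂ u v = scalarPart (clTilde u * v) := by
  rw [scalarPart, cl_mul_apply, PiLp.inner_apply]
  refine Finset.sum_congr rfl (fun I _ => ?_)
  have h1 : symmDiff I ∅ = I := by simp
  have h2 : (-1 : ℂ) ^ (I.card * (I.card + 1) / 2) * (-1) ^ (I.card * (I.card + 1) / 2) = 1 := by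
    rw [← mul_pow]; norm_num
  rw [h1, clSign_self]
  simp only [clTilde, RCLike.inner_apply, Int.cast_pow, Int.cast_neg, Int.cast_one]
  linear_combination (-(starRingEnd ℂ) (u I) * v I) * h2

/-! Geometry. -/

/-- A bounded domain with Lipschitz boundary: the boundary is covered by finitely many open sets
`W` in each of which, in suitable orthonormal coordinates with last axis `ν`, the domain is
`x_n > g (x_1, …, x_{n-1})` with `g` Lipschitz. Here `(x_1, …, x_{n-1})` is the orthogonal
projection of `x` onto the hyperplane `ν^⊥` and `x_n = ⟨ν, x⟩`. -/
structure IsBoundedLipschitzDomain {n : ℕ} (G : Set (Pt n)) : Prop where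
  isOpen : IsOpen G
  isConnected : IsConnected G
  isBounded : Bornology.IsBounded G
  exists_charts : ∃ (N : ℕ) (W : Fin N → Set (Pt n)),
    (∀ k, IsOpen (W k)) ∧ frontier G ⊆ ⋃ k, W k ∧
    ∀ k, ∃ (ν : Pt n) (g : (Submodule.span ℝ {ν})ᗮ → ℝ) (C : NNReal),
      ‖ν‖ = 1 ∧ LipschitzWith C g ∧
      G ∩ W k = {x ∈ W k | g ((Submodule.span ℝ {ν})ᗮ.orthogonalProjectionOnto x) < inner ℝ ν x}

/-! The fundamental solution. -/

/-- The Macdonald function (modified Bessel function of the second kind) of real order `p` at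
`t > 0`, by `K_p(t) = ∫_0^∞ exp(-t cosh s) cosh(p s) ds`. -/
def macdonald (p t : ℝ) : ℝ :=
  ∫ s in Set.Ioi (0 : ℝ), Real.exp (-t * Real.cosh s) * Real.cosh (p * s)

/-- The area `σ_n` of the unit sphere in `ℝⁿ`. -/
def sphereArea (n : ℕ) : ℝ := 2 * Real.pi ^ ((n : ℝ) / 2) / Real.Gamma ((n : ℝ) / 2)

/-- The fundamental solution `K_{a₀}` of `-Δ + a₀²` on `ℝⁿ`: the Macdonald kernel for `a₀ ≠ 0`, and
the Newtonian (logarithmic, if `n = 2`) kernel for `a₀ = 0`. The value at the origin is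
immaterial. -/
def fundK (n : ℕ) (a₀ : ℝ) (x : Pt n) : ℝ :=
  if a₀ = 0 then
    if n = 2 then -Real.log ‖x‖ / (2 * Real.pi)
    else ‖x‖ ^ (2 - (n : ℝ)) / (((n : ℝ) - 2) * sphereArea n)
  else
    1 / (2 * Real.pi) ^ ((n : ℝ) / 2) * (|a₀| / ‖x‖) ^ ((n : ℝ) / 2 - 1)
      * macdonald ((n : ℝ) / 2 - 1) (|a₀| * ‖x‖)

/-- The generator `e_j`, `1 ≤ j ≤ n`, of the Clifford algebra with `h ≥ n` generators. -/
def clE {n h : ℕ} (hnh : n ≤ h) (j : Fin n) : Cl h := clGen (Fin.castLE hnh j)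

/-- The partial derivative `∂φ/∂x_j` of a real function. -/
def partialD {n : ℕ} (φ : Pt n → ℝ) (j : Fin n) (x : Pt n) : ℝ :=
  fderiv ℝ φ x (EuclideanSpace.single j 1)

/-- The fundamental solution `e_{ia}(x) = e^{-i⟨a,x⟩} ((D - i a₀) K_{a₀})(x)` of the disturbed
Dirac operator `D_{ia}`, where `D K = ∑_j (∂K/∂x_j) e_j`. The paravector is `a₀ + ∑_j a_j e_j`. -/
def eKernel {n h : ℕ} (hnh : n ≤ h) (a₀ : ℝ) (a : Pt n) (x : Pt n) : Cl h :=
  Complex.exp (-Complex.I * ((inner ℝ a x : ℝ) : ℂ)) •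
    ((∑ j, ((partialD (fundK n a₀) j x : ℝ) : ℂ) • clE hnh j)
      - (Complex.I * (a₀ : ℂ) * ((fundK n a₀ x : ℝ) : ℂ)) • (1 : Cl h))

/-- The Teodorescu operator `(T_{ia} u)(x) = ∫_G e_{ia}(x - y) u(y) dy`, `x ∈ ℝⁿ`. -/
def teodorescu {n h : ℕ} (hnh : n ≤ h) (G : Set (Pt n)) (a₀ : ℝ) (a : Pt n)
    (u : Pt n → Cl h) (x : Pt n) : Cl h :=
  ∫ y in G, eKernel hnh a₀ a (x - y) * u y

/-! The disturbed Dirac operator, in the sense of distributions. -/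

/-- The element `i a = i (a₀ + ∑_j a_j e_j)`. -/
def iParavector {n h : ℕ} (hnh : n ≤ h) (a₀ : ℝ) (a : Pt n) : Cl h :=
  Complex.I • ((a₀ : ℂ) • (1 : Cl h) + ∑ j, ((a j : ℝ) : ℂ) • clE hnh j)

/-- `w = D_{ia} u` on the open set `Ω` in the sense of distributions, where
`D_{ia} u = ∑_j e_j ∂u/∂x_j + i a u`. -/
structure IsWeakDirac {n h : ℕ} (hnh : n ≤ h) (Ω : Set (Pt n)) (a₀ : ℝ) (a : Pt n)
    (u w : Pt n → Cl h) : Prop where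
  locallyIntegrable_left : MeasureTheory.LocallyIntegrableOn u Ω
  locallyIntegrable_right : MeasureTheory.LocallyIntegrableOn w Ω
  integral_eq : ∀ φ : Pt n → ℝ, ContDiff ℝ (⊤ : ℕ∞) φ → HasCompactSupport φ → tsupport φ ⊆ Ω →
    ∫ x in Ω, (φ x : ℂ) • w x =
      ∫ x in Ω, (-(∑ j, ((partialD φ j x : ℝ) : ℂ) • (clE hnh j * u x))
        + (φ x : ℂ) • (iParavector hnh a₀ a * u x))

/-! The operator `D_{ia} 𝒫 T_{ia}` on `L_2(G)`. -/

/-- The Hilbert space of square integrable functions on `G` with values in the Clifford algebra.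
The real scalar product is the real part of the Hermitian one. -/
abbrev L2Cl {n : ℕ} (G : Set (Pt n)) (h : ℕ) : Type :=
  MeasureTheory.Lp (Cl h) 2 ((MeasureTheory.volume : MeasureTheory.Measure (Pt n)).restrict G)

/-- `B` is the operator `D_{ia} 𝒫 T_{ia}` on `L_2(G)`. -/
def IsDPT {n h : ℕ} (hnh : n ≤ h) (G : Set (Pt n)) (a₀ : ℝ) (a : Pt n)
    (B : L2Cl G h → L2Cl G h) : Prop :=
  ∀ v : L2Cl G h,
    IsWeakDirac hnh G a₀ a (fun x => projP (teodorescu hnh G a₀ a v x)) (B v)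

/-- `c` is a paravector `c_0 + ∑_{j=1}^n c_j e_j`. -/
def IsParavector {h : ℕ} (n : ℕ) (hnh : n ≤ h) (c : Cl h) : Prop :=
  ∃ (c₀ : ℂ) (b : Fin n → ℂ), c = c₀ • (1 : Cl h) + ∑ j, b j • clE hnh j

/-- The subspace of `L_2(G)` of paravector-valued functions. -/
def pvecL2 {n h : ℕ} (hnh : n ≤ h) (G : Set (Pt n)) : Submodule ℂ (L2Cl G h) where
  carrier := {u | ∀ᵐ x ∂((MeasureTheory.volume : MeasureTheory.Measure (Pt n)).restrict G),
    IsParavector n hnh (u x)}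
  zero_mem' := by
    filter_upwards [MeasureTheory.Lp.coeFn_zero (Cl h) 2
      ((MeasureTheory.volume : MeasureTheory.Measure (Pt n)).restrict G)] with x hx
    refine ⟨0, 0, ?_⟩
    rw [hx]; simp
  add_mem' := by
    intro u v hu hv
    filter_upwards [hu, hv, MeasureTheory.Lp.coeFn_add u v] with x ⟨c, b, h1⟩ ⟨c', b', h2⟩ hx
    refine ⟨c + c', b + b', ?_⟩
    rw [hx, Pi.add_apply, h1, h2]
    simp only [Pi.add_apply, add_smul, Finset.sum_add_distrib]
    abel
  smul_mem' := by
    intro r u hu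
    filter_upwards [hu, MeasureTheory.Lp.coeFn_smul r u] with x ⟨c, b, h1⟩ hx
    refine ⟨r * c, fun j => r * b j, ?_⟩
    rw [hx, Pi.smul_apply, h1]
    simp only [smul_add, smul_smul, Finset.smul_sum]

/-! Properties of (nonlinear) operators on a Hilbert space `H`, with respect to the real scalar
product `Re ⟨u, v⟩`, which identifies `H` with its dual. -/

section Operators

variable {H : Type*} [NormedAddCommGroup H] [InnerProductSpace ℂ H]

/-- `(A u - A v, u - v) ≥ 0`. -/
def IsMonotoneOp (A : H → H) : Prop :=
  ∀ u v : H, 0 ≤ (inner ℂ (A u - A v) (u - v)).re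

/-- `(A u - A v, u - v) > 0` for `u ≠ v`. -/
def IsStrictlyMonotoneOp (A : H → H) : Prop :=
  ∀ u v : H, u ≠ v → 0 < (inner ℂ (A u - A v) (u - v)).re

/-- `(A u, u) / ‖u‖ → ∞` as `‖u‖ → ∞`. -/
def IsCoerciveOp (A : H → H) : Prop :=
  Filter.Tendsto (fun u : H => (inner ℂ (A u) u).re / ‖u‖) (Bornology.cobounded H) Filter.atTop

/-- `t ↦ (A (u + t v), w)` is continuous on `[0, 1]`. -/
def IsHemicontinuousOp (A : H → H) : Prop :=
  ∀ u v w : H, ContinuousOn (fun t : ℝ => (inner ℂ (A (u + (t : ℂ) • v)) w).re) (Set.Icc 0 1)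

end Operators

end

/-! Let R be the restriction from L²(ℝⁿ) to L²(G), so that R* is extension by zero. Everything
follows from the formula B = R Π R*, where Π is the orthogonal projection of L²(ℝⁿ) onto
`diracSpace`, the closed span of the fields D_{ia}(e^{-i⟨a,x⟩}φ) = e^{-i⟨a,x⟩}(∑_j ∂_jφ e_j + i a₀
φ) of test functions φ. It gives (Bv, v) = ‖ΠR*v‖², hence monotonicity. Splitting this norm over G
and the exterior (the frontier is null, `IsBoundedLipschitzDomain.volume_frontier`) gives ‖Bv‖² ≤
(Bv, v), hence ‖B‖ ≤ 1. Outside the closure of G one has D_{ia}T_{ia}v = 0, so D_{ia}𝒬T_{ia}v =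
-D_{ia}𝒫T_{ia}v, and the exterior energy is half the sum of the two equal norms. The fields are
paravector valued, and this survives passage to the closed span.

The content is the identity ΠR*v = D_{ia}𝒫T_{ia}v on ℝⁿ
(`IsRadialProfile.integral_smul_starProjection`). Let θ = K_{a₀} * f. By Green's identity the field
of θ pairs with the field of φ to ∫ f̄φ. If ξ in L² has the same pairings, then formally Πξ is the
field of θ, and ⟨ξ, Πu⟩ = ⟨field of θ, u⟩. This is `inner_starProjection_diracSpace`; since θ is not
compactly supported, it is truncated, and the decay θ = O(|x|^{1-n}) keeps the truncated energies
bounded, which suffices for weak convergence. On the other side, transposing the kernel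
(`IsRadialProfile.scalarPart_integral_eKernel`) and Fubini (`integral_mul_kernel_mul`) turn ⟨field
of θ, u⟩ into an integral of f̄ against the scalar part of the convolution of e_{ia} with u.

The choices ξ = φ e_j with f of the form ∂_j g, and ξ = φ with f = a₀ g, give the weak identity
coordinate by coordinate. The form of f matters: ∂_jK and a₀K are O(|x|^{1-n}) in every dimension,
while K itself need not decay for n = 1, 2.

About K_{a₀} only `IsRadialProfile` is used: a first order system for the profile k and its flux q,
the limit of q at the origin, and growth bounds. For a₀ ≠ 0 these come from a gamma type integral
for the Macdonald function. -/

noncomputable section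
open MeasureTheory Set Filter Topology

/-! ### The Macdonald function as a gamma type integral. -/

/-- The integral `∫_0^∞ exp(-u - c/u) u^{s-1} du`. -/
def gammaExp (s c : ℝ) : ℝ := ∫ u in Ioi (0 : ℝ), Real.exp (-u - c / u) * u ^ (s - 1)

theorem continuousOn_gammaExp_integrand (s c : ℝ) :
    ContinuousOn (fun u : ℝ => Real.exp (-u - c / u) * u ^ (s - 1)) (Ioi 0) := by
  intro u hu
  have hu' : u ≠ 0 := (mem_Ioi.1 hu).ne'
  apply ContinuousAt.continuousWithinAt
  have h1 : ContinuousAt (fun u : ℝ => u ^ (s - 1)) u := Real.continuousAt_rpow_const _ _ (Or.inl hu')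
  have h2 : ContinuousAt (fun u : ℝ => -u - c / u) u := by
    exact (continuousAt_id.neg).sub (continuousAt_const.div continuousAt_id hu')
  exact (Real.continuous_exp.continuousAt.comp h2).mul h1

/-- No sign of s is needed: near the origin e^{-c/u} ≤ N! (u/c)^N, which raises the exponent from s
to s + N > 0, where the gamma integral converges. -/
theorem integrableOn_gammaExp {s c : ℝ} (hc : 0 < c) :
    IntegrableOn (fun u : ℝ => Real.exp (-u - c / u) * u ^ (s - 1)) (Ioi 0) := by
  obtain ⟨N, hN⟩ := exists_nat_gt (-s)
  have h1 : IntegrableOn (fun u : ℝ => (N.factorial / c ^ N) * (Real.exp (-u) * u ^ ((s + N) - 1)))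
      (Ioi 0) :=
    (Real.GammaIntegral_convergent (by linarith)).const_mul _
  refine Integrable.mono' h1
    ((continuousOn_gammaExp_integrand s c).aestronglyMeasurable measurableSet_Ioi) ?_
  filter_upwards [ae_restrict_mem measurableSet_Ioi] with u hu
  have hu : 0 < u := hu
  rw [Real.norm_of_nonneg (by positivity)]
  have h2 : (c / u) ^ N / N.factorial ≤ Real.exp (c / u) :=
    Real.pow_div_factorial_le_exp _ (by positivity) N
  have h3 : Real.exp (-(c / u)) ≤ N.factorial / c ^ N * u ^ N := by
    rw [Real.exp_neg, inv_le_comm₀ (Real.exp_pos _) (by positivity)]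
    refine le_trans (le_of_eq ?_) h2
    rw [div_pow]; field_simp
  have h4 : u ^ ((s + N) - 1) = u ^ N * u ^ (s - 1) := by
    rw [← Real.rpow_natCast, ← Real.rpow_add hu]; ring_nf
  rw [sub_eq_add_neg, Real.exp_add, h4]
  calc Real.exp (-u) * Real.exp (-(c / u)) * u ^ (s - 1)
      ≤ Real.exp (-u) * (N.factorial / c ^ N * u ^ N) * u ^ (s - 1) := by gcongr
    _ = _ := by ring

theorem gammaExp_nonneg (s c : ℝ) : 0 ≤ gammaExp s c := by
  refine setIntegral_nonneg measurableSet_Ioi (fun u hu => ?_)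
  have hu : 0 < u := hu
  positivity

theorem gammaExp_le_Gamma {s c : ℝ} (hs : 0 < s) (hc : 0 < c) :
    gammaExp s c ≤ Real.Gamma s := by
  rw [Real.Gamma_eq_integral hs]
  refine setIntegral_mono_on (integrableOn_gammaExp hc) (Real.GammaIntegral_convergent hs)
    measurableSet_Ioi (fun u hu => ?_)
  have hu : 0 < u := hu
  have : 0 < c / u := by positivity
  gcongr
  linarith

theorem tendsto_gammaExp {s : ℝ} (hs : 0 < s) :
    Tendsto (gammaExp s) (𝓝[>] 0) (𝓝 (Real.Gamma s)) := by
  rw [Real.Gamma_eq_integral hs]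
  refine tendsto_integral_filter_of_dominated_convergence
    (fun u => Real.exp (-u) * u ^ (s - 1)) ?_ ?_ (Real.GammaIntegral_convergent hs) ?_
  · exact Eventually.of_forall fun c =>
      (continuousOn_gammaExp_integrand s c).aestronglyMeasurable measurableSet_Ioi
  · filter_upwards [self_mem_nhdsWithin] with c hc
    filter_upwards [ae_restrict_mem measurableSet_Ioi] with u hu
    have hu : 0 < u := hu
    have hc : 0 < c := hc
    have : 0 < c / u := by positivity
    rw [Real.norm_of_nonneg (by positivity)]
    gcongr
    linarith
  · filter_upwards [ae_restrict_mem measurableSet_Ioi] with u hu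
    have h : Continuous (fun c : ℝ => Real.exp (-u - c / u) * u ^ (s - 1)) := by fun_prop
    have := (h.tendsto 0).mono_left (nhdsWithin_le_nhds (s := Ioi 0))
    simpa using this

/-- Differentiating under the integral brings down -1/u and so lowers s by one. The integrand at c/2
dominates on the neighbourhood (c/2, ∞) of c. -/
theorem hasDerivAt_gammaExp {s c : ℝ} (hc : 0 < c) :
    HasDerivAt (gammaExp s) (-gammaExp (s - 1) c) c := by
  have hb : IntegrableOn (fun u : ℝ => Real.exp (-u - (c / 2) / u) * u ^ (s - 1 - 1)) (Ioi 0) :=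
    integrableOn_gammaExp (by positivity)
  have key := hasDerivAt_integral_of_dominated_loc_of_deriv_le (μ := volume.restrict (Ioi (0 : ℝ)))
    (F := fun c u => Real.exp (-u - c / u) * u ^ (s - 1))
    (F' := fun c u => -(Real.exp (-u - c / u) * u ^ (s - 1 - 1)))
    (bound := fun u : ℝ => Real.exp (-u - (c / 2) / u) * u ^ (s - 1 - 1))
    (x₀ := c) (Ioi_mem_nhds (show c / 2 < c by linarith))
    (Eventually.of_forall fun c =>
      (continuousOn_gammaExp_integrand s c).aestronglyMeasurable measurableSet_Ioi)
    (integrableOn_gammaExp hc)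
    ((continuousOn_gammaExp_integrand (s - 1) c).aestronglyMeasurable measurableSet_Ioi).neg
    ?_ hb ?_
  · rw [gammaExp, ← integral_neg]; exact key.2
  · filter_upwards [ae_restrict_mem measurableSet_Ioi] with u hu x hx
    have hu : 0 < u := hu
    have hx : c / 2 < x := hx
    rw [norm_neg, Real.norm_of_nonneg (by positivity)]
    gcongr
  · filter_upwards [ae_restrict_mem measurableSet_Ioi] with u hu x hx
    have hu : 0 < u := hu
    have h1 : HasDerivAt (fun x : ℝ => -u - x / u) (-(1 / u)) x :=
      ((hasDerivAt_id x).div_const u).const_sub _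
    refine (h1.exp.mul_const (u ^ (s - 1))).congr_deriv ?_
    rw [Real.rpow_sub_one hu.ne' (s - 1)]
    ring

/-- The substitution u = (t/2)e^s turns -u - t²/(4u) into -t cosh s. -/
theorem integrable_exp_cosh {p t : ℝ} (ht : 0 < t) :
    Integrable (fun s : ℝ => Real.exp (-t * Real.cosh s + p * s)) ∧
    ∫ s : ℝ, Real.exp (-t * Real.cosh s + p * s) = (2 / t) ^ p * gammaExp p (t ^ 2 / 4) := by
  have himg : (fun s : ℝ => t / 2 * Real.exp s) '' univ = Ioi 0 := by
    ext u
    simp only [image_univ, mem_range, mem_Ioi]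
    constructor
    · rintro ⟨s, rfl⟩; positivity
    · intro hu
      refine ⟨Real.log (u / (t / 2)), ?_⟩
      rw [Real.exp_log (by positivity)]; field_simp
  have hinj : InjOn (fun s : ℝ => t / 2 * Real.exp s) univ := by
    intro x _ y _ hxy
    have : t / 2 ≠ 0 := by positivity
    exact Real.exp_injective (mul_left_cancel₀ this hxy)
  have hder : ∀ s ∈ (univ : Set ℝ), HasDerivWithinAt (fun s : ℝ => t / 2 * Real.exp s)
      (t / 2 * Real.exp s) univ s := fun s _ =>
    ((Real.hasDerivAt_exp s).const_mul _).hasDerivWithinAt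
  have hpt : ∀ s : ℝ, |t / 2 * Real.exp s| • (Real.exp (-(t / 2 * Real.exp s)
      - (t ^ 2 / 4) / (t / 2 * Real.exp s)) * (t / 2 * Real.exp s) ^ (p - 1))
      = (t / 2) ^ p * Real.exp (-t * Real.cosh s + p * s) := by
    intro s
    have hpos : 0 < t / 2 * Real.exp s := by positivity
    rw [abs_of_pos hpos, smul_eq_mul, Real.rpow_sub_one hpos.ne',
      Real.mul_rpow (by positivity) (Real.exp_pos _).le, ← Real.exp_mul, Real.exp_add,
      mul_comm p s]
    have : -(t / 2 * Real.exp s) - (t ^ 2 / 4) / (t / 2 * Real.exp s) = -t * Real.cosh s := by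
      rw [Real.cosh_eq, Real.exp_neg]; field_simp; ring
    rw [this]; field_simp
  have hc : 0 < t ^ 2 / 4 := by positivity
  have hmul : (2 / t) ^ p * (t / 2) ^ p = 1 := by
    rw [← Real.mul_rpow (by positivity) (by positivity)]
    have : 2 / t * (t / 2) = 1 := by field_simp
    rw [this, Real.one_rpow]
  constructor
  · have h1 := integrableOn_gammaExp (s := p) hc
    rw [← himg, integrableOn_image_iff_integrableOn_abs_deriv_smul MeasurableSet.univ hder hinj] at h1
    simp only [hpt, integrableOn_univ] at h1
    have h2 := h1.const_mul ((2 / t) ^ p)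
    simpa only [← mul_assoc, hmul, one_mul] using h2
  · rw [gammaExp, ← himg, integral_image_eq_integral_abs_deriv_smul MeasurableSet.univ hder hinj]
    simp only [hpt, setIntegral_univ, integral_const_mul]
    rw [← mul_assoc, hmul, one_mul]

theorem integrableOn_macdonald {p t : ℝ} (ht : 0 < t) :
    IntegrableOn (fun s => Real.exp (-t * Real.cosh s) * Real.cosh (p * s)) (Ioi 0) := by
  have h1 := (integrable_exp_cosh (p := p) ht).1
  have h2 := (integrable_exp_cosh (p := -p) ht).1
  have h3 := (h1.add h2).div_const 2
  refine (h3.congr (Eventually.of_forall fun s => ?_)).integrableOn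
  simp only [Pi.add_apply, Real.cosh_eq (p * s), Real.exp_add]
  rw [neg_mul p s]; ring

/-- Folding the integral over ℝ at the origin pairs e^{ps} with e^{-ps}, and their sum is 2
cosh(ps). -/
theorem macdonald_eq_gammaExp {p t : ℝ} (ht : 0 < t) :
    macdonald p t = 1 / 2 * (2 / t) ^ p * gammaExp p (t ^ 2 / 4) := by
  have hI := (integrable_exp_cosh (p := p) ht).1
  rw [mul_assoc, ← (integrable_exp_cosh (p := p) ht).2,
    ← intervalIntegral.integral_Iic_add_Ioi (b := (0 : ℝ)) hI.integrableOn hI.integrableOn]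
  have h1 : ∫ s in Iic (0 : ℝ), Real.exp (-t * Real.cosh s + p * s)
      = ∫ s in Ioi (0 : ℝ), Real.exp (-t * Real.cosh s + -p * s) := by
    have := integral_comp_neg_Ioi (0 : ℝ) (fun s => Real.exp (-t * Real.cosh s + p * s))
    rw [neg_zero] at this
    rw [← this]
    simp
  have h2 := (integrable_exp_cosh (p := -p) ht).1
  rw [h1, ← integral_add h2.integrableOn hI.integrableOn, ← integral_const_mul, macdonald]
  refine setIntegral_congr_fun measurableSet_Ioi (fun s _ => ?_)
  simp only [Real.cosh_eq (p * s), Real.exp_add]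
  rw [neg_mul p s]; ring

theorem macdonald_neg (p t : ℝ) : macdonald (-p) t = macdonald p t := by
  simp [macdonald]

theorem macdonald_le_macdonald {p p' t : ℝ} (ht : 0 < t) (h : |p| ≤ |p'|) :
    macdonald p t ≤ macdonald p' t := by
  refine setIntegral_mono_on (integrableOn_macdonald ht) (integrableOn_macdonald ht)
    measurableSet_Ioi (fun s _ => ?_)
  gcongr
  rw [Real.cosh_le_cosh, abs_mul, abs_mul]
  gcongr

theorem macdonald_nonneg (p t : ℝ) : 0 ≤ macdonald p t := by
  refine setIntegral_nonneg measurableSet_Ioi (fun u _ => ?_)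
  have := Real.cosh_pos (p * u)
  positivity

/-! ### The radial profile of the fundamental solution. -/

/-- `K_{a₀}(x) = k(|x|)`, where `k' = -q r^{1-n}` and `q' = -a₀² r^{n-1} k`, with the limit of `q` at the
origin and the growth bounds that make `K_{a₀}` a fundamental solution. -/
structure IsRadialProfile (n : ℕ) (a₀ : ℝ) (k q : ℝ → ℝ) (C : ℝ) : Prop where
  fundK_eq : ∀ x : Pt n, x ≠ 0 → fundK n a₀ x = k ‖x‖
  hasDerivAt_k : ∀ r, 0 < r → HasDerivAt k (-(q r / r ^ (n - 1))) r
  hasDerivAt_q : ∀ r, 0 < r → HasDerivAt q (-(a₀ ^ 2 * r ^ (n - 1) * k r)) r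
  tendsto_q : Tendsto q (𝓝[>] 0) (𝓝 (1 / sphereArea n))
  nonneg : 0 ≤ C
  abs_q_le : ∀ r, 0 < r → |q r| ≤ C
  abs_k_le : ∀ r, 0 < r → |k r| ≤ C * (1 + r) ^ 2 / r ^ (n - 1)
  abs_mul_k_le : ∀ r, 0 < r → |a₀ * k r| ≤ C / r ^ (n - 1)

theorem sphereArea_pos {n : ℕ} (hn : 1 ≤ n) : 0 < sphereArea n := by
  have : (0 : ℝ) < n := by exact_mod_cast hn
  unfold sphereArea
  have := Real.Gamma_pos_of_pos (half_pos this)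
  positivity

/-- For a₀ = 0 the flux q is the constant 1/σ_n. The factor (1 + r)² in the bound for k absorbs the
logarithm (n = 2) and the linear growth (n = 1). -/
theorem exists_isRadialProfile_zero {n : ℕ} (hn : 1 ≤ n) :
    ∃ k q C, IsRadialProfile n 0 k q C := by
  have hσ := sphereArea_pos hn
  by_cases h2 : n = 2
  · subst h2
    have hs : sphereArea 2 = 2 * Real.pi := by simp [sphereArea]
    refine ⟨fun r => -Real.log r / (2 * Real.pi), fun _ => 1 / sphereArea 2, 1, ?_, ?_, ?_, ?_, ?_,
      ?_, ?_, ?_⟩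
    · intro x _; simp [fundK]
    · intro r hr
      refine ((Real.hasDerivAt_log hr.ne').neg.div_const (2 * Real.pi)).congr_deriv ?_
      rw [hs]; simp; field_simp
    · intro r hr; simpa using hasDerivAt_const r _
    · exact tendsto_const_nhds
    · norm_num
    · intro r _
      rw [hs, abs_of_pos (by positivity), div_le_one (by positivity)]
      nlinarith [Real.pi_gt_three]
    · intro r hr
      -- Both signs follow from log x ≤ x - 1, applied at r and at 1/r.
      have h1 : |Real.log r| ≤ (1 + r) ^ 2 / r := by
        rw [abs_le]
        constructor
        · have := Real.log_le_sub_one_of_pos (inv_pos.2 hr)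
          rw [Real.log_inv] at this
          have h3 : r⁻¹ ≤ (1 + r) ^ 2 / r := by
            rw [inv_eq_one_div]; gcongr; nlinarith
          linarith
        · have := Real.log_le_sub_one_of_pos hr
          have h3 : r ≤ (1 + r) ^ 2 / r := by
            rw [le_div_iff₀ hr]; nlinarith
          linarith
      have h3 := Real.pi_gt_three
      rw [abs_div, abs_neg, abs_of_pos (show 0 < 2 * Real.pi by positivity)]
      calc |Real.log r| / (2 * Real.pi) ≤ |Real.log r| / 1 := by gcongr; linarith
        _ ≤ _ := by simpa using h1
    · intro r hr; simp; positivity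
  · have hn2 : (n : ℝ) - 2 ≠ 0 := by
      intro h; apply h2; exact_mod_cast (show (n : ℝ) = 2 by linarith)
    have hpow : ∀ r : ℝ, 0 < r → r ^ (1 - (n : ℝ)) = 1 / r ^ (n - 1) := by
      intro r hr
      rw [← Real.rpow_natCast, Nat.cast_sub hn, one_div, ← Real.rpow_neg hr.le]; congr 1; simp
    have hpow2 : ∀ r : ℝ, 0 < r → r ^ (2 - (n : ℝ)) = r / r ^ (n - 1) := by
      intro r hr
      have : (2 - (n : ℝ)) = 1 + (1 - n) := by ring
      rw [this, Real.rpow_add hr, Real.rpow_one, hpow r hr]; ring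
    set C := 1 / sphereArea n + 1 / |((n : ℝ) - 2) * sphereArea n| with hC
    have hC0 : 0 < 1 / sphereArea n := by positivity
    have hC1 : 0 ≤ 1 / |((n : ℝ) - 2) * sphereArea n| := by positivity
    refine ⟨fun r => r ^ (2 - (n : ℝ)) / ((n - 2) * sphereArea n), fun _ => 1 / sphereArea n, C,
      ?_, ?_, ?_, ?_, ?_, ?_, ?_, ?_⟩
    · intro x _; simp [fundK, h2]
    · intro r hr
      refine ((Real.hasDerivAt_rpow_const (p := 2 - (n : ℝ)) (Or.inl hr.ne')).div_const
        ((n - 2) * sphereArea n)).congr_deriv ?_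
      have : (2 : ℝ) - n - 1 = 1 - n := by ring
      rw [this, hpow r hr]; field_simp; ring
    · intro r hr; simpa using hasDerivAt_const r _
    · exact tendsto_const_nhds
    · positivity
    · intro r _
      rw [abs_of_pos hC0, hC]; linarith
    · intro r hr
      have hr' : r ≤ (1 + r) ^ 2 := by nlinarith
      rw [hpow2 r hr, abs_div, abs_of_pos (show 0 < r / r ^ (n - 1) by positivity)]
      calc r / r ^ (n - 1) / |((n : ℝ) - 2) * sphereArea n|
          = (1 / |((n : ℝ) - 2) * sphereArea n|) * r / r ^ (n - 1) := by ring
        _ ≤ C * (1 + r) ^ 2 / r ^ (n - 1) := by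
          gcongr
          rw [hC]; linarith
    · intro r hr; simp; positivity

/-- With p = n/2 - 1, b = |a₀| and c = (br)²/4, the profile is k = A·`gammaExp` (-p) c. Its
derivative involves the order -p - 1 = -n/2, which the symmetry s ↔ -s turns into a power of r times
the order n/2; so q = Q·`gammaExp` (n/2) c. The derivative of q has the order n/2 - 1 = p, and the
symmetry leads back to k. -/
theorem exists_isRadialProfile_of_ne_zero {n : ℕ} (hn : 1 ≤ n) {a₀ : ℝ} (ha : a₀ ≠ 0) :
    ∃ k q C, IsRadialProfile n a₀ k q C := by
  have hn0 : (0 : ℝ) < n := by exact_mod_cast hn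
  have hn1 : (1 : ℝ) ≤ n := by exact_mod_cast hn
  obtain ⟨b, hb⟩ : ∃ b, b = |a₀| := ⟨_, rfl⟩
  have hb0 : 0 < b := hb ▸ abs_pos.2 ha
  have hb2 : a₀ ^ 2 = b ^ 2 := by rw [hb, sq_abs]
  obtain ⟨p, hp⟩ : ∃ p, p = (n : ℝ) / 2 - 1 := ⟨_, rfl⟩
  set A : ℝ := 1 / 2 * (1 / (2 * Real.pi) ^ ((n : ℝ) / 2)) * (b ^ 2 / 2) ^ p with hA
  have hA0 : 0 < A := by have := Real.pi_pos; positivity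
  set Q : ℝ := 1 / 2 * (1 / Real.pi ^ ((n : ℝ) / 2)) with hQ
  have hQ0 : 0 < Q := by have := Real.pi_pos; positivity
  set k : ℝ → ℝ := fun r => 1 / (2 * Real.pi) ^ ((n : ℝ) / 2) * (b / r) ^ p * macdonald p (b * r)
    with hk
  have hrc : ∀ r : ℝ, 0 < r → 0 < (b * r) ^ 2 / 4 := fun r hr => by positivity
  -- two expressions for the kernel and one for its flux
  have hk1 : ∀ r, 0 < r → k r = A * gammaExp (-p) ((b * r) ^ 2 / 4) := by
    intro r hr
    have hbr : 0 < b * r := by positivity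
    have h1 : (b / r) ^ p * (2 / (b * r)) ^ (-p) = (b ^ 2 / 2) ^ p := by
      rw [Real.rpow_neg (by positivity), ← Real.inv_rpow (by positivity),
        ← Real.mul_rpow (by positivity) (by positivity)]
      congr 1; field_simp
    simp only [hk]
    rw [← macdonald_neg p, macdonald_eq_gammaExp hbr, hA, ← h1]; ring
  -- This is the symmetry of the Macdonald function in its order, read off from the integral
  -- representation.
  have hsym : ∀ s r : ℝ, 0 < r →
      gammaExp (-s) ((b * r) ^ 2 / 4) = (2 / (b * r)) ^ (2 * s) * gammaExp s ((b * r) ^ 2 / 4) := by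
    intro s r hr
    have hbr : 0 < b * r := by positivity
    have h1 := macdonald_eq_gammaExp (p := s) hbr
    rw [← macdonald_neg s, macdonald_eq_gammaExp hbr] at h1
    have h2 : (2 / (b * r)) ^ (-s) * (2 / (b * r)) ^ s = 1 := by
      rw [← Real.rpow_add (by positivity)]; simp
    have h3 : (2 / (b * r)) ^ (2 * s) = (2 / (b * r)) ^ s * (2 / (b * r)) ^ s := by
      rw [← Real.rpow_add (by positivity)]; ring_nf
    rw [h3]
    linear_combination 2 * (2 / (b * r)) ^ s * h1
      - gammaExp (-s) ((b * r) ^ 2 / 4) * h2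
  -- The normalisations of k and q match: all powers of b and of 2 cancel.
  have hscale : ∀ r, 0 < r → A * (b ^ 2 / 2) * (2 / (b * r)) ^ (n : ℝ) = Q / r ^ n := by
    intro r hr
    have hpi := Real.pi_pos
    have e1 : (b ^ 2 / 2) ^ p * (b ^ 2 / 2) = (b ^ 2 / 2) ^ ((n : ℝ) / 2) := by
      nth_rewrite 2 [← Real.rpow_one (b ^ 2 / 2)]
      rw [← Real.rpow_add (by positivity), hp]; ring_nf
    have e2 : (2 / (b * r)) ^ (n : ℝ) = ((2 / b) ^ 2) ^ ((n : ℝ) / 2) * (1 / r ^ n) := by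
      rw [← Real.rpow_natCast (2 / b) 2, ← Real.rpow_mul (by positivity)]
      have : ((2 : ℕ) : ℝ) * ((n : ℝ) / 2) = n := by push_cast; ring
      rw [this, Real.rpow_natCast, Real.rpow_natCast, ← one_div_pow, ← mul_pow]; congr 1; field_simp
    have e3 : (b ^ 2 / 2) ^ ((n : ℝ) / 2) * ((2 / b) ^ 2) ^ ((n : ℝ) / 2) = 2 ^ ((n : ℝ) / 2) := by
      rw [← Real.mul_rpow (by positivity) (by positivity)]; congr 1; field_simp
    have e4 : (2 * Real.pi) ^ ((n : ℝ) / 2) = 2 ^ ((n : ℝ) / 2) * Real.pi ^ ((n : ℝ) / 2) :=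
      Real.mul_rpow (by norm_num) hpi.le
    calc A * (b ^ 2 / 2) * (2 / (b * r)) ^ (n : ℝ)
        = 1 / 2 * (1 / (2 * Real.pi) ^ ((n : ℝ) / 2)) * ((b ^ 2 / 2) ^ p * (b ^ 2 / 2))
          * (2 / (b * r)) ^ (n : ℝ) := by rw [hA]; ring
      _ = 1 / 2 * (1 / (2 * Real.pi) ^ ((n : ℝ) / 2)) * ((b ^ 2 / 2) ^ ((n : ℝ) / 2)
          * ((2 / b) ^ 2) ^ ((n : ℝ) / 2)) * (1 / r ^ n) := by rw [e1, e2]; ring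
      _ = Q / r ^ n := by rw [e3, e4, hQ]; field_simp
  have hrn : ∀ r : ℝ, r ^ n = r ^ (n - 1) * r := fun r => by
    rw [← pow_succ, Nat.sub_add_cancel hn]
  set q : ℝ → ℝ := fun r => Q * gammaExp ((n : ℝ) / 2) ((b * r) ^ 2 / 4) with hq
  have harg : ∀ r, HasDerivAt (fun r : ℝ => (b * r) ^ 2 / 4) (b ^ 2 * r / 2) r := by
    intro r
    refine ((((hasDerivAt_id r).const_mul b).pow 2).div_const 4).congr_deriv ?_
    simp; ring
  have hGpos : 0 < Real.Gamma ((n : ℝ) / 2) := Real.Gamma_pos_of_pos (by positivity)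
  have hG : ∀ r, 0 < r → gammaExp ((n : ℝ) / 2) ((b * r) ^ 2 / 4) ≤ Real.Gamma ((n : ℝ) / 2) :=
    fun r hr => gammaExp_le_Gamma (by positivity) (hrc r hr)
  have hpp : p + 1 = (n : ℝ) / 2 := by rw [hp]; ring
  have hkb : ∀ r, 0 < r → |k r| ≤ (Q * Real.Gamma ((n : ℝ) / 2) / b) / r ^ (n - 1) := by
    intro r hr
    have hbr : 0 < b * r := by positivity
    have hk0 : 0 ≤ k r := by
      have := macdonald_nonneg p (b * r)
      have := Real.pi_pos
      simp only [hk]; positivity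
    rw [abs_of_nonneg hk0]
    -- Raising the order from p to n/2 is allowed since |p| ≤ n/2 for n ≥ 1 (for n = 1 the order p
    -- is -1/2). The new order gives exactly the power r^{1-n} times a bounded factor.
    have h1 : k r ≤ 1 / (2 * Real.pi) ^ ((n : ℝ) / 2) * (b / r) ^ p
        * macdonald ((n : ℝ) / 2) (b * r) := by
      have := Real.pi_pos
      simp only [hk]
      gcongr
      refine macdonald_le_macdonald hbr ?_
      rw [abs_of_pos (show (0 : ℝ) < n / 2 by positivity), abs_le]
      constructor <;> linarith
    refine h1.trans (le_of_eq_of_le (b := (Q / b) * gammaExp ((n : ℝ) / 2) ((b * r) ^ 2 / 4)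
      / r ^ (n - 1)) ?_ ?_)
    · rw [macdonald_eq_gammaExp hbr]
      have h2 : (b / r) ^ p * (2 / (b * r)) ^ ((n : ℝ) / 2)
          = (b ^ 2 / 2) ^ p * (2 / (b * r)) ^ (n : ℝ) * (b * r / 2) := by
        have e1 : (b / r) ^ p = (b ^ 2 / 2) ^ p * (2 / (b * r)) ^ p := by
          rw [← Real.mul_rpow (by positivity) (by positivity)]; congr 1; field_simp
        have e2 : (2 / (b * r)) ^ (n : ℝ) = (2 / (b * r)) ^ p * (2 / (b * r)) ^ ((n : ℝ) / 2)
            * (2 / (b * r)) := by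
          nth_rewrite 4 [← Real.rpow_one (2 / (b * r))]
          rw [← Real.rpow_add (by positivity), ← Real.rpow_add (by positivity), hp]; ring_nf
        rw [e1, e2]; field_simp
      have h3 := hscale r hr
      rw [hrn] at h3
      calc _ = 1 / 2 * (1 / (2 * Real.pi) ^ ((n : ℝ) / 2))
              * ((b / r) ^ p * (2 / (b * r)) ^ ((n : ℝ) / 2))
              * gammaExp ((n : ℝ) / 2) ((b * r) ^ 2 / 4) := by ring
        _ = (A * (b ^ 2 / 2) * (2 / (b * r)) ^ (n : ℝ)) * (r / b)
              * gammaExp ((n : ℝ) / 2) ((b * r) ^ 2 / 4) := by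
            rw [h2, hA]; field_simp
        _ = _ := by rw [h3]; field_simp
    · rw [show Q * Real.Gamma ((n : ℝ) / 2) / b = Q / b * Real.Gamma ((n : ℝ) / 2) by ring]
      gcongr
      exact hG r hr
  -- The first summand bounds q and a₀k, the second bounds k.
  set C := Q * Real.Gamma ((n : ℝ) / 2) + Q * Real.Gamma ((n : ℝ) / 2) / b with hC
  have hC1 : 0 < Q * Real.Gamma ((n : ℝ) / 2) := by positivity
  have hC2 : 0 < Q * Real.Gamma ((n : ℝ) / 2) / b := by positivity
  refine ⟨k, q, C, ?_, ?_, ?_, ?_, ?_, ?_, ?_, ?_⟩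
  · intro x _; simp only [fundK, ha, if_false, hk, hp, hb]
  · intro r hr
    have h1 : HasDerivAt (fun r => A * gammaExp (-p) ((b * r) ^ 2 / 4))
        (A * (-gammaExp (-p - 1) ((b * r) ^ 2 / 4) * (b ^ 2 * r / 2))) r :=
      (HasDerivAt.comp (h₂ := gammaExp (-p)) r (hasDerivAt_gammaExp (hrc r hr)) (harg r)).const_mul A
    have h2 := h1.congr_of_eventuallyEq
      (Filter.eventuallyEq_of_mem (Ioi_mem_nhds hr) (fun x hx => hk1 x hx))
    refine h2.congr_deriv ?_
    have h3 : -p - 1 = -((n : ℝ) / 2) := by rw [hp]; ring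
    rw [h3, hsym _ r hr, mul_div_cancel₀ _ (two_ne_zero' ℝ)]
    have h4 := hscale r hr
    rw [hrn] at h4
    simp only [hq]
    calc _ = -((A * (b ^ 2 / 2) * (2 / (b * r)) ^ (n : ℝ))
          * gammaExp ((n : ℝ) / 2) ((b * r) ^ 2 / 4) * r) := by ring
      _ = _ := by rw [h4]; field_simp
  · intro r hr
    have h1 : HasDerivAt q
        (Q * (-gammaExp ((n : ℝ) / 2 - 1) ((b * r) ^ 2 / 4) * (b ^ 2 * r / 2))) r :=
      (HasDerivAt.comp (h₂ := gammaExp ((n : ℝ) / 2)) r (hasDerivAt_gammaExp (hrc r hr)) (harg r)).const_mul Q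
    refine h1.congr_deriv ?_
    rw [hk1 r hr, hsym _ r hr, ← hp, hb2]
    have h4 := hscale r hr
    have h5 : (2 / (b * r)) ^ (n : ℝ) = (2 / (b * r)) ^ (2 * p) * (2 / (b * r)) ^ (2 : ℕ) := by
      rw [← Real.rpow_natCast, ← Real.rpow_add (by positivity), hp]; congr 1; push_cast; ring
    rw [h5, hrn, eq_div_iff (by positivity)] at h4
    rw [← h4]; field_simp
  · have h1 : Tendsto (fun r : ℝ => (b * r) ^ 2 / 4) (𝓝[>] 0) (𝓝[>] 0) := by
      refine tendsto_nhdsWithin_of_tendsto_nhds_of_eventually_within _ ?_ ?_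
      · have h : Continuous (fun r : ℝ => (b * r) ^ 2 / 4) := by fun_prop
        simpa using (h.tendsto 0).mono_left (nhdsWithin_le_nhds (s := Ioi 0))
      · filter_upwards [self_mem_nhdsWithin] with r hr using hrc r hr
    have h2 := ((tendsto_gammaExp (s := (n : ℝ) / 2) (by positivity)).comp h1).const_mul Q
    -- The normalisation of K makes the flux through small spheres tend to one.
    have h3 : Q * Real.Gamma ((n : ℝ) / 2) = 1 / sphereArea n := by
      rw [hQ, sphereArea]; field_simp
    rwa [h3] at h2
  · positivity
  · intro r hr
    have h0 := gammaExp_nonneg ((n : ℝ) / 2) ((b * r) ^ 2 / 4)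
    rw [abs_of_nonneg (by simp only [hq]; positivity)]
    simp only [hq]
    have := mul_le_mul_of_nonneg_left (hG r hr) hQ0.le
    linarith
  · intro r hr
    refine (hkb r hr).trans ?_
    gcongr
    nlinarith [sq_nonneg r, mul_pos (add_pos hC1 hC2) hr, mul_nonneg (add_pos hC1 hC2).le (sq_nonneg r)]
  · intro r hr
    rw [abs_mul, ← hb]
    calc b * |k r| ≤ b * ((Q * Real.Gamma ((n : ℝ) / 2) / b) / r ^ (n - 1)) := by
          gcongr; exact hkb r hr
      _ = (Q * Real.Gamma ((n : ℝ) / 2)) / r ^ (n - 1) := by field_simp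
      _ ≤ _ := by gcongr; linarith

theorem exists_isRadialProfile {n : ℕ} (hn : 1 ≤ n) (a₀ : ℝ) :
    ∃ k q C, IsRadialProfile n a₀ k q C := by
  rcases eq_or_ne a₀ 0 with rfl | ha
  · exact exists_isRadialProfile_zero hn
  · exact exists_isRadialProfile_of_ne_zero hn ha

/-! ### Derivatives of the fundamental solution, pointwise and weak. -/

/-- The partial derivative in the direction of the `j`-th coordinate. -/
def pderiv {n : ℕ} {F : Type*} [NormedAddCommGroup F] [NormedSpace ℝ F] (j : Fin n) (f : Pt n → F)
    (x : Pt n) : F :=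
  fderiv ℝ f x (EuclideanSpace.single j 1)

theorem partialD_eq_pderiv {n : ℕ} (φ : Pt n → ℝ) (j : Fin n) : partialD φ j = pderiv j φ := rfl

section Kernel

variable {n : ℕ} {a₀ : ℝ} {k q : ℝ → ℝ} {C : ℝ}

/-- For ε > 0 the function k(√(|y|² + ε²)) is a regularisation of K without singularity; for ε = 0
it is K off the origin. -/
theorem IsRadialProfile.hasFDerivAt (h : IsRadialProfile n a₀ k q C) (ε : ℝ) (x : Pt n)
    (hx : 0 < ‖x‖ ^ 2 + ε ^ 2) :
    HasFDerivAt (fun y : Pt n => k (√(‖y‖ ^ 2 + ε ^ 2)))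
      ((-(q (√(‖x‖ ^ 2 + ε ^ 2)) / √(‖x‖ ^ 2 + ε ^ 2) ^ (n - 1)) / √(‖x‖ ^ 2 + ε ^ 2)) •
        innerSL ℝ x) x := by
  have h1 : HasFDerivAt (fun y : Pt n => ‖y‖ ^ 2 + ε ^ 2) (2 • innerSL ℝ x) x :=
    (hasStrictFDerivAt_norm_sq x).hasFDerivAt.add_const _
  have h2 := h1.sqrt hx.ne'
  have h3 := (h.hasDerivAt_k _ (Real.sqrt_pos.2 hx)).comp_hasFDerivAt x h2
  refine h3.congr_fderiv ?_
  ext v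
  simp
  ring

theorem IsRadialProfile.hasFDerivAt_fundK (h : IsRadialProfile n a₀ k q C) {x : Pt n} (hx : x ≠ 0) :
    HasFDerivAt (fundK n a₀) ((-(q ‖x‖ / ‖x‖ ^ (n - 1)) / ‖x‖) • innerSL ℝ x) x := by
  have h0 : 0 < ‖x‖ := norm_pos_iff.2 hx
  have h1 := h.hasFDerivAt 0 x (by positivity)
  simp only [ne_eq, OfNat.ofNat_ne_zero, not_false_eq_true, zero_pow, add_zero,
    Real.sqrt_sq (norm_nonneg _)] at h1
  refine h1.congr_of_eventuallyEq ?_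
  filter_upwards [isOpen_ne.mem_nhds hx] with y hy using h.fundK_eq y hy

theorem IsRadialProfile.partialD_fundK (h : IsRadialProfile n a₀ k q C) (j : Fin n) {x : Pt n}
    (hx : x ≠ 0) :
    partialD (fundK n a₀) j x = -(q ‖x‖ / ‖x‖ ^ (n - 1)) / ‖x‖ * x j := by
  rw [partialD, (h.hasFDerivAt_fundK hx).fderiv]
  simp [EuclideanSpace.inner_single_right]

theorem abs_apply_div_norm_le {x : Pt n} (j : Fin n) : |x j| / ‖x‖ ≤ 1 := by
  rcases eq_or_ne x 0 with rfl | hx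
  · simp
  · rw [div_le_one (norm_pos_iff.2 hx)]
    simpa using PiLp.norm_apply_le x j

theorem IsRadialProfile.abs_partialD_le (h : IsRadialProfile n a₀ k q C) (j : Fin n) {x : Pt n}
    (hx : x ≠ 0) : |partialD (fundK n a₀) j x| ≤ C / ‖x‖ ^ (n - 1) := by
  have h0 : 0 < ‖x‖ := norm_pos_iff.2 hx
  rw [h.partialD_fundK j hx]
  have e : -(q ‖x‖ / ‖x‖ ^ (n - 1)) / ‖x‖ * x j = -(q ‖x‖) / ‖x‖ ^ (n - 1) * (x j / ‖x‖) := by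
    field_simp
  rw [e, abs_mul, abs_div, abs_div, abs_neg, abs_norm, abs_of_pos (pow_pos h0 _)]
  calc |q ‖x‖| / ‖x‖ ^ (n - 1) * (|x j| / ‖x‖) ≤ C / ‖x‖ ^ (n - 1) * 1 := by
        gcongr
        · have := h.nonneg
          positivity
        · exact h.abs_q_le _ h0
        · exact abs_apply_div_norm_le j
    _ = _ := mul_one _

theorem IsRadialProfile.abs_fundK_le (h : IsRadialProfile n a₀ k q C) {x : Pt n}
    (hx : x ≠ 0) : |fundK n a₀ x| ≤ C * (1 + ‖x‖) ^ 2 / ‖x‖ ^ (n - 1) := by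
  rw [h.fundK_eq x hx]; exact h.abs_k_le _ (norm_pos_iff.2 hx)

theorem IsRadialProfile.abs_mul_fundK_le (h : IsRadialProfile n a₀ k q C) {x : Pt n}
    (hx : x ≠ 0) : |a₀ * fundK n a₀ x| ≤ C / ‖x‖ ^ (n - 1) := by
  rw [h.fundK_eq x hx]; exact h.abs_mul_k_le _ (norm_pos_iff.2 hx)

theorem IsRadialProfile.continuousOn_k (h : IsRadialProfile n a₀ k q C) :
    ContinuousOn k (Ioi 0) := fun r hr =>
  (h.hasDerivAt_k r hr).continuousAt.continuousWithinAt

theorem IsRadialProfile.continuousOn_q (h : IsRadialProfile n a₀ k q C) :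
    ContinuousOn q (Ioi 0) := fun r hr =>
  (h.hasDerivAt_q r hr).continuousAt.continuousWithinAt

theorem nontrivial_pt (hn : 1 ≤ n) : Nontrivial (Pt n) := by
  have : Nonempty (Fin n) := ⟨⟨0, hn⟩⟩
  exact inferInstanceAs (Nontrivial (EuclideanSpace ℝ (Fin n)))

theorem ae_ne_zero (hn : 1 ≤ n) : ∀ᵐ x : Pt n, x ≠ 0 := by
  have := nontrivial_pt hn
  exact Measure.ae_ne volume 0

theorem aestronglyMeasurable_of_continuousOn_ne_zero (hn : 1 ≤ n) {E : Type*} [TopologicalSpace E]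
    [TopologicalSpace.PseudoMetrizableSpace E] {f : Pt n → E}
    (hf : ContinuousOn f {0}ᶜ) : AEStronglyMeasurable f volume := by
  have := nontrivial_pt hn
  borelize E
  rw [← restrict_compl_singleton (μ := volume) (0 : Pt n)]
  exact hf.aestronglyMeasurable (measurableSet_singleton _).compl

theorem IsRadialProfile.continuousOn_fundK (h : IsRadialProfile n a₀ k q C) :
    ContinuousOn (fundK n a₀) {0}ᶜ := fun _ hx =>
  (h.hasFDerivAt_fundK hx).continuousAt.continuousWithinAt

theorem IsRadialProfile.continuousOn_partialD (h : IsRadialProfile n a₀ k q C) (j : Fin n) :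
    ContinuousOn (partialD (fundK n a₀) j) {0}ᶜ := by
  have hm : MapsTo (fun x : Pt n => ‖x‖) {0}ᶜ (Ioi 0) := fun x hx => norm_pos_iff.2 hx
  have h1 : ContinuousOn (fun x : Pt n => q ‖x‖) {0}ᶜ :=
    h.continuousOn_q.comp continuous_norm.continuousOn hm
  have h2 : ContinuousOn (fun x : Pt n => -(q ‖x‖ / ‖x‖ ^ (n - 1)) / ‖x‖ * x j) {0}ᶜ := by
    refine ContinuousOn.mul (ContinuousOn.div (ContinuousOn.div h1 (by fun_prop) ?_).neg
      (by fun_prop) ?_) (by fun_prop)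
    · intro x hx; exact pow_ne_zero _ (norm_ne_zero_iff.2 hx)
    · intro x hx; exact norm_ne_zero_iff.2 hx
  exact h2.congr fun x hx => h.partialD_fundK j hx

/-- In polar coordinates the Jacobian r^{n-1} cancels the denominator. This weight dominates both K
and its first derivatives. -/
theorem locallyIntegrable_weight (hn : 1 ≤ n) (C : ℝ) :
    LocallyIntegrable (fun x : Pt n => C * (1 + ‖x‖) ^ 2 / ‖x‖ ^ (n - 1)) := by
  have := nontrivial_pt hn
  rw [locallyIntegrable_iff]
  intro s hs
  obtain ⟨r, hr⟩ := hs.isBounded.subset_ball (0 : Pt n)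
  refine IntegrableOn.mono_set ?_ hr
  rw [integrableOn_fun_norm_addHaar volume (f := fun t => C * (1 + t) ^ 2 / t ^ (n - 1))]
  have h1 : IntegrableOn (fun t : ℝ => C * (1 + t) ^ 2) (Ioo 0 r) :=
    (ContinuousOn.integrableOn_Icc (by fun_prop)).mono_set Ioo_subset_Icc_self
  refine h1.congr_fun (fun t ht => ?_) measurableSet_Ioo
  have : 0 < t := ht.1
  simp only [finrank_euclideanSpace, Fintype.card_fin, smul_eq_mul]
  field_simp

theorem IsRadialProfile.locallyIntegrable_fundK (h : IsRadialProfile n a₀ k q C) (hn : 1 ≤ n) :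
    LocallyIntegrable (fundK n a₀) := by
  refine (locallyIntegrable_weight hn C).mono
    (aestronglyMeasurable_of_continuousOn_ne_zero hn h.continuousOn_fundK) ?_
  filter_upwards [ae_ne_zero hn] with x hx
  exact (h.abs_fundK_le hx).trans (le_abs_self _)

theorem IsRadialProfile.locallyIntegrable_partialD (h : IsRadialProfile n a₀ k q C) (hn : 1 ≤ n)
    (j : Fin n) : LocallyIntegrable (partialD (fundK n a₀) j) := by
  refine (locallyIntegrable_weight hn C).mono
    (aestronglyMeasurable_of_continuousOn_ne_zero hn (h.continuousOn_partialD j)) ?_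
  filter_upwards [ae_ne_zero hn] with x hx
  refine (h.abs_partialD_le j hx).trans (le_trans ?_ (le_abs_self _))
  have := h.nonneg
  have h1 : 1 ≤ (1 + ‖x‖) ^ 2 := by nlinarith [norm_nonneg x]
  gcongr
  nlinarith

variable {F : Type*} [NormedAddCommGroup F] [NormedSpace ℝ F]

theorem continuous_pderiv {m : Pt n → F} (hm : ContDiff ℝ 1 m) (j : Fin n) :
    Continuous (pderiv j m) :=
  (hm.continuous_fderiv one_ne_zero).clm_apply continuous_const

theorem hasCompactSupport_pderiv {m : Pt n → F} (hm : HasCompactSupport m) (j : Fin n) :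
    HasCompactSupport (pderiv j m) :=
  hm.fderiv_apply ℝ _

/-- The pointwise partial derivatives of the fundamental solution are its weak derivatives. -/
theorem IsRadialProfile.integral_fundK_smul_pderiv (h : IsRadialProfile n a₀ k q C) (hn : 1 ≤ n)
    {m : Pt n → F} (hm : ContDiff ℝ 1 m) (hms : HasCompactSupport m) (j : Fin n) :
    ∫ x, fundK n a₀ x • pderiv j m x = -∫ x, partialD (fundK n a₀) j x • m x := by
  have hC := h.nonneg
  have hpc := continuous_pderiv hm j
  have hps := hasCompactSupport_pderiv hms j
  -- The singularity is removed by replacing |x| with ρ = √(|x|² + ε²). Integration by parts is then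
  -- classical, and ε tends to 0 by dominated convergence.
  set ρ : ℝ → Pt n → ℝ := fun ε x => √(‖x‖ ^ 2 + ε ^ 2) with hρ
  set D : ℝ → Pt n → ℝ := fun ε x => -(q (ρ ε x) / ρ ε x ^ (n - 1)) / ρ ε x * x j with hD
  have hpos : ∀ ε : ℝ, 0 < ε → ∀ x : Pt n, 0 < ‖x‖ ^ 2 + ε ^ 2 := fun ε hε x => by positivity
  have hρpos : ∀ ε : ℝ, 0 < ε → ∀ x : Pt n, 0 < ρ ε x := fun ε hε x => Real.sqrt_pos.2 (hpos ε hε x)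
  have hρge : ∀ (ε : ℝ) (x : Pt n), ‖x‖ ≤ ρ ε x := fun ε x =>
    Real.le_sqrt_of_sq_le (by nlinarith [sq_nonneg ε])
  have hρle : ∀ ε : ℝ, 0 < ε → ε < 1 → ∀ x : Pt n, ρ ε x ≤ 1 + ‖x‖ := fun ε h0 h1 x => by
    refine Real.sqrt_le_iff.2 ⟨by positivity, ?_⟩
    nlinarith [norm_nonneg x]
  have hρcont : ∀ ε : ℝ, Continuous (ρ ε) := fun ε => by simp only [hρ]; fun_prop
  have hρlim : ∀ x : Pt n, Tendsto (fun ε => ρ ε x) (𝓝[>] 0) (𝓝 ‖x‖) := fun x => by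
    have : Continuous (fun ε => ρ ε x) := by simp only [hρ]; fun_prop
    have := (this.tendsto 0).mono_left (nhdsWithin_le_nhds (s := Ioi 0))
    simpa [hρ, Real.sqrt_sq (norm_nonneg x)] using this
  have hkc : ∀ ε : ℝ, 0 < ε → Continuous (fun x => k (ρ ε x)) := fun ε hε =>
    h.continuousOn_k.comp_continuous (hρcont ε) (hρpos ε hε)
  have hDc : ∀ ε : ℝ, 0 < ε → Continuous (D ε) := fun ε hε => by
    have h1 : Continuous (fun x => q (ρ ε x)) :=
      h.continuousOn_q.comp_continuous (hρcont ε) (hρpos ε hε)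
    have h2 := hρcont ε
    refine Continuous.mul (Continuous.div (Continuous.div h1 (by fun_prop) ?_).neg h2 ?_)
      (by fun_prop)
    · intro x; exact pow_ne_zero _ (hρpos ε hε x).ne'
    · intro x; exact (hρpos ε hε x).ne'
  have hfd : ∀ ε : ℝ, 0 < ε → ∀ x : Pt n,
      fderiv ℝ (fun x => k (ρ ε x)) x (EuclideanSpace.single j 1) = D ε x := fun ε hε x => by
    rw [(h.hasFDerivAt ε x (hpos ε hε x)).fderiv]
    simp [EuclideanSpace.inner_single_right, hD, hρ]
  have hibp : ∀ ε : ℝ, 0 < ε →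
      ∫ x, k (ρ ε x) • pderiv j m x = -∫ x, D ε x • m x := fun ε hε => by
    have := integral_smul_fderiv_eq_neg_fderiv_smul_of_integrable (μ := volume)
      (f := fun x => k (ρ ε x)) (g := m) (v := EuclideanSpace.single j 1)
      (by simp only [hfd ε hε]
          exact ((hDc ε hε).smul hm.continuous).integrable_of_hasCompactSupport hms.smul_left)
      (((hkc ε hε).smul hpc).integrable_of_hasCompactSupport hps.smul_left)
      (((hkc ε hε).smul hm.continuous).integrable_of_hasCompactSupport hms.smul_left)
      (fun x _ => (h.hasFDerivAt ε x (hpos ε hε x)).differentiableAt)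
      (fun x _ => (hm.differentiable one_ne_zero) x)
    simp only [hfd ε hε] at this
    exact this
  have hev : ∀ᶠ ε : ℝ in 𝓝[>] 0, 0 < ε ∧ ε < 1 := Ioo_mem_nhdsGT one_pos
  have hW := locallyIntegrable_weight hn (4 * C)
  have hlim1 : Tendsto (fun ε => ∫ x, k (ρ ε x) • pderiv j m x) (𝓝[>] 0)
      (𝓝 (∫ x, fundK n a₀ x • pderiv j m x)) := by
    refine tendsto_integral_filter_of_dominated_convergence
      (fun x => (4 * C * (1 + ‖x‖) ^ 2 / ‖x‖ ^ (n - 1)) • ‖pderiv j m x‖) ?_ ?_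
      (hW.integrable_smul_right_of_hasCompactSupport hpc.norm hps.norm) ?_
    · filter_upwards [hev] with ε hε using ((hkc ε hε.1).smul hpc).aestronglyMeasurable
    · filter_upwards [hev] with ε hε
      filter_upwards [ae_ne_zero hn] with x hx
      have hx0 : 0 < ‖x‖ := norm_pos_iff.2 hx
      rw [norm_smul, smul_eq_mul]
      gcongr
      refine (h.abs_k_le _ (hρpos ε hε.1 x)).trans ?_
      have h1 := hρle ε hε.1 hε.2 x
      have h2 := hρge ε x
      -- For ε < 1 one has 1 + ρ ≤ 2(1 + |x|), which is where the factor 4 in the dominating weight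
      -- comes from.
      have h3 : (1 + ρ ε x) ^ 2 ≤ 4 * (1 + ‖x‖) ^ 2 := by
        nlinarith [hρpos ε hε.1 x]
      calc C * (1 + ρ ε x) ^ 2 / ρ ε x ^ (n - 1) ≤ C * (4 * (1 + ‖x‖) ^ 2) / ‖x‖ ^ (n - 1) := by
            gcongr
        _ = _ := by ring
    · filter_upwards [ae_ne_zero hn] with x hx
      have hx0 : 0 < ‖x‖ := norm_pos_iff.2 hx
      rw [h.fundK_eq x hx]
      exact (((h.hasDerivAt_k _ hx0).continuousAt.tendsto.comp (hρlim x))).smul_const _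
  have hlim2 : Tendsto (fun ε => ∫ x, D ε x • m x) (𝓝[>] 0)
      (𝓝 (∫ x, partialD (fundK n a₀) j x • m x)) := by
    refine tendsto_integral_filter_of_dominated_convergence
      (fun x => (4 * C * (1 + ‖x‖) ^ 2 / ‖x‖ ^ (n - 1)) • ‖m x‖) ?_ ?_
      (hW.integrable_smul_right_of_hasCompactSupport hm.continuous.norm hms.norm) ?_
    · filter_upwards [hev] with ε hε using ((hDc ε hε.1).smul hm.continuous).aestronglyMeasurable
    · filter_upwards [hev] with ε hε
      filter_upwards [ae_ne_zero hn] with x hx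
      have hx0 : 0 < ‖x‖ := norm_pos_iff.2 hx
      rw [norm_smul, smul_eq_mul]
      gcongr
      have h0 := hρpos ε hε.1 x
      have h2 := hρge ε x
      have e : D ε x = -q (ρ ε x) / ρ ε x ^ (n - 1) * (x j / ρ ε x) := by
        simp only [hD]; ring
      rw [e, Real.norm_eq_abs, abs_mul, abs_div, abs_div, abs_neg, abs_of_pos h0,
        abs_of_pos (pow_pos h0 _)]
      have h4 : |x j| / ρ ε x ≤ 1 := by
        rw [div_le_one h0]
        exact le_trans (by simpa using PiLp.norm_apply_le x j) h2
      calc |q (ρ ε x)| / ρ ε x ^ (n - 1) * (|x j| / ρ ε x) ≤ C / ‖x‖ ^ (n - 1) * 1 := by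
            gcongr
            exact h.abs_q_le _ h0
        _ ≤ _ := by
            rw [mul_one]
            gcongr
            nlinarith [mul_nonneg hC hx0.le, mul_nonneg hC (sq_nonneg ‖x‖)]
    · filter_upwards [ae_ne_zero hn] with x hx
      have hx0 : 0 < ‖x‖ := norm_pos_iff.2 hx
      rw [h.partialD_fundK j hx]
      have h1 := (h.hasDerivAt_q _ hx0).continuousAt.tendsto.comp (hρlim x)
      exact ((((h1.div ((hρlim x).pow _) (pow_ne_zero _ hx0.ne')).neg.div (hρlim x)
        hx0.ne')).mul_const (x j)).smul_const _
  refine tendsto_nhds_unique (hlim1.congr' ?_) hlim2.neg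
  filter_upwards [hev] with ε hε using hibp ε hε.1

/-- Integration in polar coordinates. -/
theorem integral_eq_integral_toSphere (hn : 1 ≤ n) [CompleteSpace F] {f : Pt n → F}
    (hf : Integrable f) :
    ∫ x, f x = ∫ ω, (∫ r in Ioi (0 : ℝ), r ^ (n - 1) • f (r • (ω : Pt n)))
      ∂(volume : Measure (Pt n)).toSphere := by
  have := nontrivial_pt hn
  set μ : Measure (Pt n) := volume
  have hd : Module.finrank ℝ (Pt n) = n := by simp
  have hmp := μ.measurePreserving_homeomorphUnitSphereProd
  rw [hd] at hmp
  have hme := (homeomorphUnitSphereProd (Pt n)).measurableEmbedding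
  set g : Metric.sphere (0 : Pt n) 1 × Ioi (0 : ℝ) → F := fun p => f ((p.2 : ℝ) • (p.1 : Pt n))
  have hg : ∀ x : ({(0 : Pt n)}ᶜ : Set (Pt n)), g (homeomorphUnitSphereProd (Pt n) x) = f x := by
    intro x
    have : (homeomorphUnitSphereProd (Pt n)).symm (homeomorphUnitSphereProd (Pt n) x) = x :=
      Homeomorph.symm_apply_apply _ x
    have h2 := congrArg Subtype.val this
    rw [homeomorphUnitSphereProd_symm_apply_coe] at h2
    simp only [g]; rw [h2]
  have hgi : Integrable g (μ.toSphere.prod (.volumeIoiPow (n - 1))) := by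
    rw [← hmp.integrable_comp_emb hme]
    have : g ∘ homeomorphUnitSphereProd (Pt n) = f ∘ Subtype.val := funext hg
    rw [this, ← integrableOn_iff_comap_subtypeVal (measurableSet_singleton _).compl]
    exact hf.integrableOn
  calc ∫ x, f x ∂μ = ∫ x : ({(0)}ᶜ : Set (Pt n)), f x.1 ∂(μ.comap (↑)) := by
        rw [integral_subtype_comap (measurableSet_singleton _).compl fun x ↦ f x,
          restrict_compl_singleton]
    _ = ∫ p, g p ∂μ.toSphere.prod (.volumeIoiPow (n - 1)) := by
        rw [← hmp.integral_comp hme g]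
        exact integral_congr_ae (Eventually.of_forall fun x => (hg x).symm)
    _ = ∫ ω, (∫ r, g (ω, r) ∂(.volumeIoiPow (n - 1))) ∂μ.toSphere := integral_prod _ hgi
    _ = _ := by
        refine integral_congr_ae (Eventually.of_forall fun ω => ?_)
        simp only [Measure.volumeIoiPow, ENNReal.ofReal, g]
        rw [integral_withDensity_eq_integral_smul,
          integral_subtype_comap measurableSet_Ioi
            fun a ↦ Real.toNNReal (a ^ (n - 1)) • f (a • (ω : Pt n)),
          setIntegral_congr_fun measurableSet_Ioi fun x hx ↦ ?_]
        · rw [NNReal.smul_def, Real.coe_toNNReal _ (pow_nonneg (le_of_lt hx) _)]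
        · exact (measurable_subtype_coe.pow_const _).real_toNNReal

theorem toSphere_real_univ (hn : 1 ≤ n) :
    (volume : Measure (Pt n)).toSphere.real univ = sphereArea n := by
  have : Nonempty (Fin n) := ⟨⟨0, hn⟩⟩
  have hn0 : (0 : ℝ) < n := by exact_mod_cast hn
  have hG := Real.Gamma_pos_of_pos (half_pos hn0)
  rw [Measure.toSphere_real_apply_univ, Measure.real, EuclideanSpace.volume_ball,
    finrank_euclideanSpace, Fintype.card_fin, Real.Gamma_add_one (half_pos hn0).ne', sphereArea]
  simp only [ENNReal.ofReal_one, one_pow, one_mul]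
  rw [ENNReal.toReal_ofReal (by positivity), Real.sqrt_eq_rpow, ← Real.rpow_natCast,
    ← Real.rpow_mul Real.pi_pos.le]
  field_simp

theorem sum_apply_smul_pderiv (m : Pt n → F) (x ω : Pt n) :
    ∑ j, ω j • pderiv j m x = fderiv ℝ m x ω := by
  have h1 : ω = ∑ j, ω j • EuclideanSpace.single j (1 : ℝ) := by
    ext i
    simp [Pi.single_apply]
  conv_rhs => rw [h1]
  simp [pderiv]

/-- `K_{a₀}` is a fundamental solution of `-Δ + a₀²`. -/
theorem IsRadialProfile.integral_fundamental (h : IsRadialProfile n a₀ k q C) (hn : 1 ≤ n)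
    [CompleteSpace F] {m : Pt n → F} (hm : ContDiff ℝ 1 m) (hms : HasCompactSupport m) :
    ∫ x, (∑ j, partialD (fundK n a₀) j x • pderiv j m x + (a₀ ^ 2 * fundK n a₀ x) • m x) = m 0 := by
  have hC := h.nonneg
  have hσ := sphereArea_pos hn
  have hint : Integrable (fun x => ∑ j, partialD (fundK n a₀) j x • pderiv j m x
      + (a₀ ^ 2 * fundK n a₀ x) • m x) := by
    refine Integrable.add (integrable_finsetSum _ fun j _ =>
      (h.locallyIntegrable_partialD hn j).integrable_smul_right_of_hasCompactSupport
        (continuous_pderiv hm j) (hasCompactSupport_pderiv hms j)) ?_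
    simp only [mul_smul]
    exact ((h.locallyIntegrable_fundK hn).integrable_smul_right_of_hasCompactSupport
      hm.continuous hms).smul (a₀ ^ 2)
  rw [integral_eq_integral_toSphere hn hint]
  -- On each ray the integrand times r^{n-1} is the derivative of -q(r) m(rω). Giving q its limit
  -- 1/σ_n at the origin makes this primitive continuous on [0, ∞), so every ray contributes
  -- m(0)/σ_n.
  set q₀ : ℝ → ℝ := Function.update q 0 (1 / sphereArea n) with hq₀
  have hq₀eq : ∀ r, 0 < r → q₀ r = q r := fun r hr => Function.update_of_ne hr.ne' _ _
  have hq₀c : ContinuousWithinAt q₀ (Ici 0) 0 := by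
    rw [hq₀, continuousWithinAt_update_same]
    rw [Ici_sdiff_left]
    exact h.tendsto_q
  have hray : ∀ ω : Metric.sphere (0 : Pt n) 1,
      ∫ r in Ioi (0 : ℝ), r ^ (n - 1) • (∑ j, partialD (fundK n a₀) j (r • (ω : Pt n))
        • pderiv j m (r • (ω : Pt n)) + (a₀ ^ 2 * fundK n a₀ (r • (ω : Pt n))) • m (r • (ω : Pt n)))
      = (1 / sphereArea n) • m 0 := by
    intro ω
    have hω : ‖(ω : Pt n)‖ = 1 := by simp
    have hω0 : (ω : Pt n) ≠ 0 := by intro h0; rw [h0] at hω; simp at hω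
    have hmd : ∀ r : ℝ, HasDerivAt (fun r : ℝ => m (r • (ω : Pt n)))
        (fderiv ℝ m (r • (ω : Pt n)) ω) r := fun r => by
      have h1 : HasDerivAt (fun r : ℝ => r • (ω : Pt n)) (ω : Pt n) r := by
        simpa using (hasDerivAt_id r).smul_const (ω : Pt n)
      exact ((hm.differentiable one_ne_zero) (r • (ω : Pt n))).hasFDerivAt.comp_hasDerivAt r h1
    set f' : ℝ → F := fun r => -(q r • fderiv ℝ m (r • (ω : Pt n)) ω
      + (-(a₀ ^ 2 * r ^ (n - 1) * k r)) • m (r • (ω : Pt n))) with hf'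
    have hcongr : ∀ r ∈ Ioi (0 : ℝ), r ^ (n - 1) • (∑ j, partialD (fundK n a₀) j (r • (ω : Pt n))
        • pderiv j m (r • (ω : Pt n)) + (a₀ ^ 2 * fundK n a₀ (r • (ω : Pt n))) • m (r • (ω : Pt n)))
        = f' r := by
      intro r hr
      have hr : 0 < r := hr
      have hne : r • (ω : Pt n) ≠ 0 := smul_ne_zero hr.ne' hω0
      have hnorm : ‖r • (ω : Pt n)‖ = r := by rw [norm_smul, hω, mul_one, Real.norm_of_nonneg hr.le]
      have hpd : ∀ j, partialD (fundK n a₀) j (r • (ω : Pt n))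
          = -(q r / r ^ (n - 1)) * (ω : Pt n) j := by
        intro j
        rw [h.partialD_fundK j hne, hnorm]
        simp only [PiLp.smul_apply, smul_eq_mul]
        field_simp
      have hsum : ∑ j, partialD (fundK n a₀) j (r • (ω : Pt n)) • pderiv j m (r • (ω : Pt n))
          = -(q r / r ^ (n - 1)) • fderiv ℝ m (r • (ω : Pt n)) ω := by
        rw [← sum_apply_smul_pderiv, Finset.smul_sum]
        exact Finset.sum_congr rfl fun j _ => by rw [hpd, mul_smul]
      simp only [hf']
      rw [hsum, h.fundK_eq _ hne, hnorm, smul_add, smul_smul, smul_smul, neg_add, ← neg_smul,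
        ← neg_smul]
      congr 2
      · field_simp
      · ring
    rw [setIntegral_congr_fun measurableSet_Ioi hcongr]
    have hraycont : Continuous (fun r : ℝ => r • (ω : Pt n)) := by fun_prop
    have hderiv : ∀ r ∈ Ioi (0 : ℝ), HasDerivAt (fun r => -(q₀ r • m (r • (ω : Pt n)))) (f' r) r := by
      intro r hr
      have h1 : HasDerivAt q₀ (-(a₀ ^ 2 * r ^ (n - 1) * k r)) r :=
        (h.hasDerivAt_q r hr).congr_of_eventuallyEq
          (Filter.eventuallyEq_of_mem (Ioi_mem_nhds hr) fun x hx => hq₀eq x hx)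
      refine ((h1.smul (hmd r)).neg).congr_deriv ?_
      rw [hq₀eq r hr]
    obtain ⟨R, hR⟩ := hms.isCompact.isBounded.subset_closedBall (0 : Pt n)
    have hout : ∀ r : ℝ, max R 0 < r → r • (ω : Pt n) ∉ tsupport m := by
      intro r hr hmem
      have h1 := hR hmem
      have hr0 : 0 < r := lt_of_le_of_lt (le_max_right _ _) hr
      rw [mem_closedBall_zero_iff, norm_smul, hω, mul_one, Real.norm_of_nonneg hr0.le] at h1
      exact absurd (lt_of_le_of_lt (le_max_left R 0) hr) (not_lt.2 h1)
    have hlim : Tendsto (fun r => -(q₀ r • m (r • (ω : Pt n)))) atTop (𝓝 0) := by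
      refine tendsto_const_nhds.congr' ?_
      filter_upwards [Ioi_mem_atTop (max R 0)] with r hr
      rw [image_eq_zero_of_notMem_tsupport (hout r hr)]; simp
    obtain ⟨M₁, hM₁⟩ := hms.exists_bound_of_continuous hm.continuous
    obtain ⟨M₂, hM₂⟩ := (hms.fderiv ℝ).exists_bound_of_continuous
      (hm.continuous_fderiv one_ne_zero)
    have hM₁0 : 0 ≤ M₁ := (norm_nonneg _).trans (hM₁ 0)
    have hM₂0 : 0 ≤ M₂ := (norm_nonneg _).trans (hM₂ 0)
    have hf'c : ContinuousOn f' (Ioi 0) := by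
      have c1 := h.continuousOn_q
      have c2 := h.continuousOn_k
      have c3 : Continuous (fun r : ℝ => m (r • (ω : Pt n))) := hm.continuous.comp hraycont
      have c4 : Continuous (fun r : ℝ => fderiv ℝ m (r • (ω : Pt n)) ω) :=
        ((hm.continuous_fderiv one_ne_zero).comp hraycont).clm_apply continuous_const
      refine ((c1.smul c4.continuousOn).add (ContinuousOn.smul (ContinuousOn.neg
        (ContinuousOn.mul (by fun_prop) c2)) c3.continuousOn)).neg
    -- The zero order term is bounded near the origin because a₀² r^{n-1} k = a₀ · (a₀ k r^{n-1}),
    -- and the last factor is at most C.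
    have hf'int : IntegrableOn f' (Ioi 0) := by
      have hbi : Integrable ((Icc 0 (max R 0)).indicator
          (fun _ : ℝ => C * M₂ + |a₀| * C * M₁)) :=
        (integrable_indicator_iff measurableSet_Icc).2 (integrableOn_const (by simp))
      refine Integrable.mono' hbi.integrableOn (hf'c.aestronglyMeasurable measurableSet_Ioi) ?_
      filter_upwards [ae_restrict_mem measurableSet_Ioi] with r hr
      have hr : 0 < r := hr
      by_cases hrR : r ≤ max R 0
      · have hmem : r ∈ Icc 0 (max R 0) := ⟨hr.le, hrR⟩
        rw [indicator_of_mem hmem]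
        rw [hf', norm_neg]
        refine (norm_add_le _ _).trans (add_le_add ?_ ?_)
        · rw [norm_smul]
          have h1 : ‖fderiv ℝ m (r • (ω : Pt n)) ω‖ ≤ M₂ := by
            refine (ContinuousLinearMap.le_opNorm _ _).trans ?_
            rw [hω, mul_one]; exact hM₂ _
          have h2 := h.abs_q_le r hr
          gcongr
          exact h2
        · rw [norm_smul]
          gcongr
          · have h2 := h.abs_mul_k_le r hr
            rw [le_div_iff₀ (pow_pos hr _)] at h2
            rw [norm_neg, Real.norm_eq_abs]
            have e : a₀ ^ 2 * r ^ (n - 1) * k r = a₀ * (a₀ * k r * r ^ (n - 1)) := by ring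
            rw [e, abs_mul, abs_mul (a₀ * k r), abs_of_pos (pow_pos hr (n - 1))]
            gcongr
          · exact hM₁ _
      · have h1 := hout r (not_le.1 hrR)
        have h2 : fderiv ℝ m (r • (ω : Pt n)) = 0 :=
          image_eq_zero_of_notMem_tsupport fun hmem => h1 (tsupport_fderiv_subset ℝ hmem)
        rw [hf']
        simp only [h2, image_eq_zero_of_notMem_tsupport h1]
        simp only [zero_apply, smul_zero, add_zero, neg_zero, norm_zero]
        exact indicator_nonneg (fun _ _ => by positivity) _
    rw [integral_Ioi_of_hasDerivAt_of_tendsto ?_ hderiv hf'int hlim]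
    · simp [hq₀]
    · have c3 : Continuous (fun r : ℝ => m (r • (ω : Pt n))) := hm.continuous.comp hraycont
      exact (hq₀c.smul c3.continuousWithinAt).neg
  simp only [hray]
  rw [integral_const, toSphere_real_univ hn, smul_smul, mul_one_div_cancel hσ.ne', one_smul]

end Kernel

/-! ### Convolution with the fundamental solution. -/

section Convolution

open scoped Convolution

variable {n : ℕ} {a₀ : ℝ} {k q : ℝ → ℝ} {C : ℝ}
variable {F : Type*} [NormedAddCommGroup F] [NormedSpace ℝ F]

/-- The convolution `κ * f` of a real kernel with a vector valued function. -/
def smulConv (κ : Pt n → ℝ) (f : Pt n → F) : Pt n → F :=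
  κ ⋆[ContinuousLinearMap.lsmul ℝ ℝ, volume] f

theorem smulConv_apply (κ : Pt n → ℝ) (f : Pt n → F) (x : Pt n) :
    smulConv κ f x = ∫ z, κ z • f (x - z) := rfl

theorem smulConv_apply' (κ : Pt n → ℝ) (f : Pt n → F) (x : Pt n) :
    smulConv κ f x = ∫ z, κ (x - z) • f z := by
  rw [smulConv_apply, ← integral_sub_left_eq_self _ volume x]
  simp

theorem contDiff_smulConv {κ : Pt n → ℝ} (hκ : LocallyIntegrable κ) {f : Pt n → F}
    (hf : ContDiff ℝ (⊤ : ℕ∞) f) (hfs : HasCompactSupport f) :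
    ContDiff ℝ (⊤ : ℕ∞) (smulConv κ f) :=
  hfs.contDiff_convolution_right _ hκ hf

theorem integrable_kernel_smul {κ : Pt n → ℝ} (hκ : LocallyIntegrable κ) {f : Pt n → F}
    (hf : Continuous f) (hfs : HasCompactSupport f) (x : Pt n) :
    Integrable (fun z => κ z • f (x - z)) :=
  hκ.integrable_smul_right_of_hasCompactSupport (by fun_prop)
    (hfs.comp_homeomorph (Homeomorph.subLeft x))

theorem pderiv_smulConv [CompleteSpace F] {κ : Pt n → ℝ} (hκ : LocallyIntegrable κ) {f : Pt n → F}
    (hf : ContDiff ℝ 1 f) (hfs : HasCompactSupport f) (j : Fin n) :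
    pderiv j (smulConv κ f) = smulConv κ (pderiv j f) := by
  funext x
  have h1 := hfs.hasFDerivAt_convolution_right (ContinuousLinearMap.lsmul ℝ ℝ) hκ hf x
  have h2 : fderiv ℝ (smulConv κ f) x = ((κ ⋆[(ContinuousLinearMap.lsmul ℝ ℝ).precompR (Pt n),
    volume] fderiv ℝ f) x) := h1.fderiv
  rw [pderiv, h2, convolution, ContinuousLinearMap.integral_apply]
  · rfl
  · exact integrable_kernel_smul hκ (hf.continuous_fderiv one_ne_zero) (hfs.fderiv ℝ) x

theorem pderiv_comp_sub_left (f : Pt n → F) (x z : Pt n) (j : Fin n) :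
    pderiv j (fun z => f (x - z)) z = -pderiv j f (x - z) := by
  have h1 : (fun z => f (x - z)) = fun z => (fun w => f (x + w)) ((-1 : ℝ) • z) := by
    funext z; simp [sub_eq_add_neg]
  rw [pderiv, pderiv, h1, fderiv_comp_smul (f := fun w => f (x + w)), fderiv_comp_add_left]
  simp [sub_eq_add_neg]

theorem contDiff_pderiv {f : Pt n → F} (hf : ContDiff ℝ (⊤ : ℕ∞) f) (j : Fin n) :
    ContDiff ℝ (⊤ : ℕ∞) (pderiv j f) :=
  (hf.fderiv_right (m := (⊤ : ℕ∞)) (by simp)).clm_apply contDiff_const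

/-- The weak derivative formula is applied to z ↦ f(x - z); the reflection supplies the sign that
cancels the one from integration by parts. -/
theorem IsRadialProfile.smulConv_pderiv (h : IsRadialProfile n a₀ k q C) (hn : 1 ≤ n)
    {f : Pt n → F} (hf : ContDiff ℝ 1 f) (hfs : HasCompactSupport f) (j : Fin n) :
    smulConv (fundK n a₀) (pderiv j f) = smulConv (partialD (fundK n a₀) j) f := by
  funext x
  have h1 := h.integral_fundK_smul_pderiv hn (m := fun z => f (x - z))
    (hf.comp (contDiff_const.sub contDiff_id)) (hfs.comp_homeomorph (Homeomorph.subLeft x)) j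
  simp only [pderiv_comp_sub_left, smul_neg, integral_neg, neg_inj] at h1
  exact h1

/-- `K_{a₀} * f` solves `-Δθ + a₀²θ = f`. -/
theorem IsRadialProfile.helmholtz_smulConv (h : IsRadialProfile n a₀ k q C) (hn : 1 ≤ n)
    [CompleteSpace F] {f : Pt n → F} (hf : ContDiff ℝ (⊤ : ℕ∞) f) (hfs : HasCompactSupport f)
    (x : Pt n) :
    -∑ j, pderiv j (pderiv j (smulConv (fundK n a₀) f)) x
      + a₀ ^ 2 • smulConv (fundK n a₀) f x = f x := by
  have hf1 : ContDiff ℝ 1 f := hf.of_le (by simp)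
  have h1 := h.integral_fundamental hn (m := fun z => f (x - z))
    (hf1.comp (contDiff_const.sub contDiff_id)) (hfs.comp_homeomorph (Homeomorph.subLeft x))
  simp only [pderiv_comp_sub_left, smul_neg, Finset.sum_neg_distrib, sub_zero, mul_smul] at h1
  have hi : ∀ j, Integrable (fun z => partialD (fundK n a₀) j z • pderiv j f (x - z)) := fun j =>
    integrable_kernel_smul (h.locallyIntegrable_partialD hn j) (continuous_pderiv hf1 j)
      (hasCompactSupport_pderiv hfs j) x
  have hi1 : Integrable (fun z => ∑ j, partialD (fundK n a₀) j z • pderiv j f (x - z)) :=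
    integrable_finsetSum _ fun j _ => hi j
  have hi2 : Integrable (fun z => a₀ ^ 2 • fundK n a₀ z • f (x - z)) :=
    (integrable_kernel_smul (h.locallyIntegrable_fundK hn) hf.continuous hfs x).smul (a₀ ^ 2)
  rw [integral_add (f := fun z => -∑ j, partialD (fundK n a₀) j z • pderiv j f (x - z)) hi1.neg hi2,
    integral_neg, integral_finsetSum _ fun j _ => hi j, integral_smul] at h1
  rw [← h1, ← smulConv_apply]
  congr 2
  refine Finset.sum_congr rfl fun j _ => ?_
  rw [pderiv_smulConv (h.locallyIntegrable_fundK hn) hf1 hfs, h.smulConv_pderiv hn hf1 hfs,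
    pderiv_smulConv (h.locallyIntegrable_partialD hn j) hf1 hfs]
  rfl

/-- If supp f lies in the ball of radius R and |x| ≥ 2R, then |x - z| ≥ |x|/2 on supp f, which costs
a factor 2^{n-1}. The kernel is left general so that both ∂_jK and a₀K can be inserted. -/
theorem exists_decay_smulConv {κ : Pt n → ℝ} (hC : 0 ≤ C)
    (hκ : ∀ x : Pt n, x ≠ 0 → |κ x| ≤ C / ‖x‖ ^ (n - 1)) {f : Pt n → F} (hf : Continuous f)
    (hfs : HasCompactSupport f) :
    ∃ C' R : ℝ, 0 ≤ C' ∧ 0 < R ∧ ∀ x : Pt n, R ≤ ‖x‖ → ‖smulConv κ f x‖ ≤ C' / ‖x‖ ^ (n - 1) := by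
  obtain ⟨R, hR⟩ := hfs.isCompact.isBounded.subset_closedBall (0 : Pt n)
  have hfi : Integrable f := hf.integrable_of_hasCompactSupport hfs
  refine ⟨C * 2 ^ (n - 1) * ∫ z, ‖f z‖, 2 * max R 1, by positivity, by positivity, fun x hx => ?_⟩
  have hx0 : 0 < ‖x‖ := lt_of_lt_of_le (by positivity) hx
  rw [smulConv_apply']
  calc ‖∫ z, κ (x - z) • f z‖ ≤ ∫ z, C * 2 ^ (n - 1) / ‖x‖ ^ (n - 1) * ‖f z‖ := by
        refine norm_integral_le_of_norm_le (hfi.norm.const_mul _) (Eventually.of_forall fun z => ?_)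
        by_cases hz : z ∈ tsupport f
        · have hz' : ‖z‖ ≤ R := mem_closedBall_zero_iff.1 (hR hz)
          have h1 : ‖x‖ / 2 ≤ ‖x - z‖ := by
            have := norm_sub_norm_le x z
            have := le_max_left R 1
            linarith
          have hne : x - z ≠ 0 := by
            rw [← norm_pos_iff]; linarith
          rw [norm_smul]
          gcongr
          refine (hκ _ hne).trans ?_
          calc C / ‖x - z‖ ^ (n - 1) ≤ C / (‖x‖ / 2) ^ (n - 1) := by gcongr
            _ = _ := by rw [div_pow]; field_simp
        · rw [image_eq_zero_of_notMem_tsupport hz]; simp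
    _ = _ := by rw [integral_const_mul]; ring

end Convolution

/-! ### Cutoff functions at scale N. -/

section Cutoff

variable {n : ℕ}

/-- A smooth function equal to `1` on the unit ball and supported in the ball of radius `2`. -/
def unitBump (n : ℕ) : ContDiffBump (0 : Pt n) := ⟨1, 2, one_pos, one_lt_two⟩

/-- The cutoff `χ(x/N)`. -/
def cutoff (n N : ℕ) (x : Pt n) : ℝ := unitBump n ((N : ℝ)⁻¹ • x)

theorem contDiff_cutoff (N : ℕ) : ContDiff ℝ (⊤ : ℕ∞) (cutoff n N) :=
  (unitBump n).contDiff.comp (contDiff_const_smul _)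

theorem cutoff_nonneg (N : ℕ) (x : Pt n) : 0 ≤ cutoff n N x := (unitBump n).nonneg

theorem cutoff_le_one (N : ℕ) (x : Pt n) : cutoff n N x ≤ 1 := (unitBump n).le_one

theorem cutoff_eq_one {N : ℕ} (hN : 1 ≤ N) {x : Pt n} (hx : ‖x‖ ≤ N) : cutoff n N x = 1 := by
  have hN' : (0 : ℝ) < N := by exact_mod_cast hN
  apply (unitBump n).one_of_mem_closedBall
  rw [mem_closedBall_zero_iff, norm_smul, norm_inv, Real.norm_of_nonneg hN'.le]
  change (N : ℝ)⁻¹ * ‖x‖ ≤ 1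
  rw [inv_mul_le_iff₀ hN']; simpa using hx

theorem cutoff_eq_zero {N : ℕ} (hN : 1 ≤ N) {x : Pt n} (hx : 2 * N ≤ ‖x‖) : cutoff n N x = 0 := by
  have hN' : (0 : ℝ) < N := by exact_mod_cast hN
  apply (unitBump n).zero_of_le_dist
  rw [dist_zero_right, norm_smul, norm_inv, Real.norm_of_nonneg hN'.le]
  change (2 : ℝ) ≤ (N : ℝ)⁻¹ * ‖x‖
  rw [le_inv_mul_iff₀ hN']; linarith

theorem hasCompactSupport_cutoff {N : ℕ} (hN : 1 ≤ N) : HasCompactSupport (cutoff n N) := by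
  refine HasCompactSupport.of_support_subset_isCompact (isCompact_closedBall (0 : Pt n) (2 * N)) ?_
  intro x hx
  rw [mem_closedBall_zero_iff]
  by_contra hlt
  exact hx (cutoff_eq_zero hN (not_le.1 hlt).le)

theorem pderiv_cutoff_eq_zero_of_lt {N : ℕ} (hN : 1 ≤ N) {x : Pt n} (hx : ‖x‖ < N) (j : Fin n) :
    pderiv j (cutoff n N) x = 0 := by
  have h1 : cutoff n N =ᶠ[𝓝 x] fun _ => 1 := by
    filter_upwards [Metric.isOpen_ball.mem_nhds (mem_ball_zero_iff.2 hx)] with y hy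
    exact cutoff_eq_one hN (mem_ball_zero_iff.1 hy).le
  rw [pderiv, h1.fderiv_eq]; simp

theorem pderiv_cutoff_eq_zero_of_gt {N : ℕ} (hN : 1 ≤ N) {x : Pt n} (hx : 2 * N < ‖x‖)
    (j : Fin n) : pderiv j (cutoff n N) x = 0 := by
  have h1 : cutoff n N =ᶠ[𝓝 x] fun _ => 0 := by
    filter_upwards [(isOpen_lt continuous_const continuous_norm).mem_nhds hx] with y hy
    exact cutoff_eq_zero hN (le_of_lt hy)
  rw [pderiv, h1.fderiv_eq]; simp

theorem exists_abs_pderiv_cutoff_le (n : ℕ) :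
    ∃ M : ℝ, 0 ≤ M ∧ ∀ (N : ℕ) (j : Fin n) (x : Pt n), |pderiv j (cutoff n N) x| ≤ M / N := by
  have hc : ContDiff ℝ 1 (unitBump n) := (unitBump n).contDiff
  obtain ⟨M, hM⟩ := ((unitBump n).hasCompactSupport.fderiv ℝ).exists_bound_of_continuous
    (hc.continuous_fderiv one_ne_zero)
  refine ⟨M, (norm_nonneg _).trans (hM 0), fun N j x => ?_⟩
  have h1 : fderiv ℝ (cutoff n N) x = (N : ℝ)⁻¹ • fderiv ℝ (unitBump n) ((N : ℝ)⁻¹ • x) :=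
    fderiv_comp_smul _
  rw [pderiv, h1, smul_apply, smul_eq_mul, abs_mul,
    abs_of_nonneg (by positivity : (0 : ℝ) ≤ (N : ℝ)⁻¹), inv_mul_eq_div]
  gcongr
  have h2 := ContinuousLinearMap.le_opNorm (fderiv ℝ (unitBump n) ((N : ℝ)⁻¹ • x))
    (EuclideanSpace.single j 1)
  rw [show ‖(EuclideanSpace.single j 1 : Pt n)‖ = 1 by simp, mul_one] at h2
  exact h2.trans (hM _)

end Cutoff

/-! ### Energy of truncated potentials. -/

section Energy

variable {n : ℕ} {a₀ : ℝ} {F : Type*} [NormedAddCommGroup F] [InnerProductSpace ℝ F]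

theorem pderiv_smul {χ : Pt n → ℝ} {θ : Pt n → F} {x : Pt n} (hχ : DifferentiableAt ℝ χ x)
    (hθ : DifferentiableAt ℝ θ x) (j : Fin n) :
    pderiv j (fun y => χ y • θ y) x = χ x • pderiv j θ x + pderiv j χ x • θ x := by
  rw [pderiv, fderiv_fun_smul hχ hθ]; rfl

/-- The energy of a truncated solution of `-Δθ + a₀²θ = f`. -/
theorem integral_energy_cutoff {θ f : Pt n → F} (hθ : ContDiff ℝ (⊤ : ℕ∞) θ)
    (hf : ∀ x, -∑ j, pderiv j (pderiv j θ) x + a₀ ^ 2 • θ x = f x) {χ : Pt n → ℝ}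
    (hχ : ContDiff ℝ (⊤ : ℕ∞) χ) (hχs : HasCompactSupport χ) :
    ∫ x, (∑ j, ‖pderiv j (fun y => χ y • θ y) x‖ ^ 2 + a₀ ^ 2 * ‖χ x • θ x‖ ^ 2)
      = ∫ x, (inner ℝ (f x) (χ x ^ 2 • θ x) + ∑ j, pderiv j χ x ^ 2 * ‖θ x‖ ^ 2) := by
  have hθd := hθ.differentiable (by simp)
  have hχd := hχ.differentiable (by simp)
  have hθ1 : ContDiff ℝ 1 θ := hθ.of_le (by simp)
  have hχ1 : ContDiff ℝ 1 χ := hχ.of_le (by simp)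
  have hχ2 : ContDiff ℝ 1 (fun y => χ y ^ 2 • θ y) := (hχ1.pow 2).smul hθ1
  have hχ2s : HasCompactSupport (fun y => χ y ^ 2 • θ y) := by
    have : HasCompactSupport (fun y => χ y ^ 2) := hχs.comp_left (g := fun t : ℝ => t ^ 2) (by simp)
    exact this.smul_right
  have hcθ : ∀ j, Continuous (pderiv j θ) := continuous_pderiv hθ1
  have hcθ2 : ∀ j, Continuous (pderiv j (pderiv j θ)) := fun j =>
    continuous_pderiv ((contDiff_pderiv hθ j).of_le (by simp)) j
  have hcχ : ∀ j, Continuous (pderiv j χ) := continuous_pderiv hχ1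
  have hpd2 : ∀ j x, pderiv j (fun y => χ y ^ 2 • θ y) x
      = χ x ^ 2 • pderiv j θ x + (2 * χ x * pderiv j χ x) • θ x := by
    intro j x
    rw [pderiv_smul (χ := fun y => χ y ^ 2) ((hχd x).pow 2) (hθd x)]
    congr 2
    rw [pderiv, fderiv_fun_pow 2 (hχd x)]
    simp [pderiv]
  have hi1 : ∀ j, Integrable (fun x => inner ℝ (pderiv j θ x) (pderiv j (fun y => χ y ^ 2 • θ y) x)) :=
    fun j => ((hcθ j).inner (continuous_pderiv hχ2 j)).integrable_of_hasCompactSupport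
      (HasCompactSupport.mono (hasCompactSupport_pderiv hχ2s j) fun x hx => by
        contrapose! hx; simp [Function.notMem_support.1 hx])
  have hi2 : ∀ j, Integrable (fun x => inner ℝ (pderiv j (pderiv j θ) x) (χ x ^ 2 • θ x)) :=
    fun j => ((hcθ2 j).inner hχ2.continuous).integrable_of_hasCompactSupport
      (HasCompactSupport.mono hχ2s fun x hx => by
        contrapose! hx; simp only [Function.notMem_support] at *; rw [hx, inner_zero_right])
  have hi3 : ∀ j, Integrable (fun x => inner ℝ (pderiv j θ x) (χ x ^ 2 • θ x)) :=
    fun j => ((hcθ j).inner hχ2.continuous).integrable_of_hasCompactSupport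
      (HasCompactSupport.mono hχ2s fun x hx => by
        contrapose! hx; simp only [Function.notMem_support] at *; rw [hx, inner_zero_right])
  have hi4 : Integrable (fun x => inner ℝ (a₀ ^ 2 • θ x) (χ x ^ 2 • θ x)) :=
    ((continuous_const.smul hθ.continuous).inner hχ2.continuous).integrable_of_hasCompactSupport
      (HasCompactSupport.mono hχ2s fun x hx => by
        contrapose! hx; simp only [Function.notMem_support] at *; rw [hx, inner_zero_right])
  have hi5 : Integrable (fun x => ∑ j, pderiv j χ x ^ 2 * ‖θ x‖ ^ 2) := by
    refine integrable_finsetSum _ fun j _ => ?_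
    refine (((hcχ j).pow 2).mul (hθ.continuous.norm.pow 2)).integrable_of_hasCompactSupport ?_
    exact HasCompactSupport.mono (hasCompactSupport_pderiv hχs j) fun x hx => by
      contrapose! hx; simp [Function.notMem_support.1 hx]
  have hibp : ∀ j, ∫ x, inner ℝ (pderiv j θ x) (pderiv j (fun y => χ y ^ 2 • θ y) x)
      = -∫ x, inner ℝ (pderiv j (pderiv j θ) x) (χ x ^ 2 • θ x) := fun j =>
    integral_bilinear_fderiv_right_eq_neg_left_of_integrable (μ := volume)
      (f := pderiv j θ) (g := fun y => χ y ^ 2 • θ y) (v := EuclideanSpace.single j 1)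
      (B := innerSL ℝ) (hi2 j) (hi1 j) (hi3 j)
      (fun x _ => ((contDiff_pderiv hθ j).differentiable (by simp)) x)
      (fun x _ => (hχ2.differentiable one_ne_zero) x)
  -- The mixed terms agree: ‖∂_j(χθ)‖² = ⟨∂_jθ, ∂_j(χ²θ)⟩ + (∂_jχ)²‖θ‖². Hence testing the equation
  -- with χ²θ leaves only the derivative of the cutoff as an error.
  have hpt : ∀ x, ∑ j, ‖pderiv j (fun y => χ y • θ y) x‖ ^ 2 + a₀ ^ 2 * ‖χ x • θ x‖ ^ 2
      = (∑ j, inner ℝ (pderiv j θ x) (pderiv j (fun y => χ y ^ 2 • θ y) x)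
          + inner ℝ (a₀ ^ 2 • θ x) (χ x ^ 2 • θ x)) + ∑ j, pderiv j χ x ^ 2 * ‖θ x‖ ^ 2 := by
    intro x
    have e1 : ∀ j, ‖pderiv j (fun y => χ y • θ y) x‖ ^ 2
        = inner ℝ (pderiv j θ x) (pderiv j (fun y => χ y ^ 2 • θ y) x)
          + pderiv j χ x ^ 2 * ‖θ x‖ ^ 2 := by
      intro j
      rw [pderiv_smul (hχd x) (hθd x), hpd2, ← real_inner_self_eq_norm_sq,
        ← real_inner_self_eq_norm_sq]
      simp only [inner_add_left, inner_add_right, real_inner_smul_left, real_inner_smul_right,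
        real_inner_comm (pderiv j θ x) (θ x)]
      ring
    have e2 : a₀ ^ 2 * ‖χ x • θ x‖ ^ 2 = inner ℝ (a₀ ^ 2 • θ x) (χ x ^ 2 • θ x) := by
      rw [← real_inner_self_eq_norm_sq]
      simp only [real_inner_smul_left, real_inner_smul_right]
      ring
    rw [Finset.sum_congr rfl fun j _ => e1 j, Finset.sum_add_distrib, e2]; ring
  have hpt2 : ∀ x, inner ℝ (f x) (χ x ^ 2 • θ x)
      = -∑ j, inner ℝ (pderiv j (pderiv j θ) x) (χ x ^ 2 • θ x)
        + inner ℝ (a₀ ^ 2 • θ x) (χ x ^ 2 • θ x) := by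
    intro x
    rw [← hf x, inner_add_left, inner_neg_left, sum_inner]
  simp only [hpt, hpt2]
  have hs1 : Integrable (fun x => ∑ j, inner ℝ (pderiv j θ x)
      (pderiv j (fun y => χ y ^ 2 • θ y) x)) := integrable_finsetSum _ fun j _ => hi1 j
  have hs2 : Integrable (fun x => -∑ j, inner ℝ (pderiv j (pderiv j θ) x) (χ x ^ 2 • θ x)) :=
    (integrable_finsetSum _ fun j _ => hi2 j).neg
  have hs3 : Integrable (fun x => ∑ j, inner ℝ (pderiv j θ x)
      (pderiv j (fun y => χ y ^ 2 • θ y) x) + inner ℝ (a₀ ^ 2 • θ x) (χ x ^ 2 • θ x)) := hs1.add hi4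
  have hs4 : Integrable (fun x => -∑ j, inner ℝ (pderiv j (pderiv j θ) x) (χ x ^ 2 • θ x)
      + inner ℝ (a₀ ^ 2 • θ x) (χ x ^ 2 • θ x)) := hs2.add hi4
  rw [integral_add hs3 hi5, integral_add hs4 hi5, integral_add hs1 hi4, integral_add hs2 hi4,
    integral_neg, integral_finsetSum _ fun j _ => hi1 j, integral_finsetSum _ fun j _ => hi2 j,
    Finset.sum_congr rfl fun j _ => hibp j, Finset.sum_neg_distrib]

/-- The truncations of a decaying solution of `-Δθ + a₀²θ = f` have bounded energy. -/
theorem exists_energy_cutoff_le (hn : 1 ≤ n) {θ f : Pt n → F} (hθ : ContDiff ℝ (⊤ : ℕ∞) θ)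
    (hf : ∀ x, -∑ j, pderiv j (pderiv j θ) x + a₀ ^ 2 • θ x = f x)
    (hfc : Continuous f) (hfs : HasCompactSupport f) {C R : ℝ} (hC : 0 ≤ C)
    (hdecay : ∀ x : Pt n, R ≤ ‖x‖ → ‖θ x‖ ≤ C / ‖x‖ ^ (n - 1)) :
    ∃ A : ℝ, ∀ᶠ N : ℕ in atTop,
      ∫ x, (∑ j, ‖pderiv j (fun y => cutoff n N y • θ y) x‖ ^ 2
        + a₀ ^ 2 * ‖cutoff n N x • θ x‖ ^ 2) ≤ A := by
  obtain ⟨M, hM0, hM⟩ := exists_abs_pderiv_cutoff_le n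
  have := nontrivial_pt hn
  set V := (volume : Measure (Pt n)).real (Metric.ball 0 1)
  have hV : 0 ≤ V := measureReal_nonneg
  have hfθ : Integrable (fun x => ‖f x‖ * ‖θ x‖) :=
    (hfc.norm.mul hθ.continuous.norm).integrable_of_hasCompactSupport hfs.norm.mul_right
  refine ⟨(∫ x, ‖f x‖ * ‖θ x‖) + n * (M ^ 2 * C ^ 2) * (2 ^ n * V), ?_⟩
  filter_upwards [eventually_ge_atTop (max 1 ⌈R⌉₊)] with N hN
  have hN1 : 1 ≤ N := (le_max_left _ _).trans hN
  have hNR : R ≤ N := (Nat.le_ceil R).trans (by exact_mod_cast (le_max_right _ _).trans hN)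
  have hN0 : (0 : ℝ) < N := by exact_mod_cast hN1
  have hN1' : (1 : ℝ) ≤ N := by exact_mod_cast hN1
  rw [integral_energy_cutoff hθ hf (contDiff_cutoff N) (hasCompactSupport_cutoff hN1)]
  -- This bounds the error term on the annulus N ≤ |x| ≤ 2N, outside of which the gradient of the
  -- cutoff vanishes.
  set b : ℝ := n * ((M / N) ^ 2 * (C / N ^ (n - 1)) ^ 2) with hb
  have hb0 : 0 ≤ b := by positivity
  have hbi : Integrable ((Metric.closedBall (0 : Pt n) (2 * N)).indicator (fun _ => b)) :=
    (integrable_indicator_iff Metric.isClosed_closedBall.measurableSet).2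
      (integrableOn_const measure_closedBall_lt_top.ne)
  have hle : ∀ x, inner ℝ (f x) (cutoff n N x ^ 2 • θ x)
      + ∑ j, pderiv j (cutoff n N) x ^ 2 * ‖θ x‖ ^ 2
      ≤ ‖f x‖ * ‖θ x‖ + (Metric.closedBall (0 : Pt n) (2 * N)).indicator (fun _ => b) x := by
    intro x
    refine add_le_add ?_ ?_
    · refine (real_inner_le_norm _ _).trans ?_
      gcongr
      rw [norm_smul, norm_pow, Real.norm_of_nonneg (cutoff_nonneg N x)]
      exact mul_le_of_le_one_left (norm_nonneg _)
        (pow_le_one₀ (cutoff_nonneg N x) (cutoff_le_one N x))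
    · by_cases h2 : ‖x‖ ≤ 2 * N
      · rw [indicator_of_mem (mem_closedBall_zero_iff.2 h2)]
        rcases lt_or_ge ‖x‖ N with h1 | h1
        · simp [pderiv_cutoff_eq_zero_of_lt hN1 h1, hb0]
        · have h3 : ‖θ x‖ ≤ C / N ^ (n - 1) := by
            refine (hdecay x (hNR.trans h1)).trans ?_
            gcongr
          calc ∑ j, pderiv j (cutoff n N) x ^ 2 * ‖θ x‖ ^ 2
              ≤ ∑ _j : Fin n, (M / N) ^ 2 * (C / N ^ (n - 1)) ^ 2 := by
                refine Finset.sum_le_sum fun j _ => ?_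
                have h4 : pderiv j (cutoff n N) x ^ 2 ≤ (M / N) ^ 2 :=
                  sq_le_sq' (abs_le.1 (hM N j x)).1 (abs_le.1 (hM N j x)).2
                gcongr
            _ = b := by simp [hb]
      · rw [indicator_of_notMem (fun hmem => h2 (mem_closedBall_zero_iff.1 hmem))]
        simp [pderiv_cutoff_eq_zero_of_gt hN1 (not_le.1 h2)]
  -- The ball has volume of order N^n and b is of order N^{-2} N^{-2(n-1)} = N^{-2n}, so the total
  -- error is O(N^{-n}).
  have hint : ∫ x, ((Metric.closedBall (0 : Pt n) (2 * N)).indicator (fun _ => b) x)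
      ≤ n * (M ^ 2 * C ^ 2) * (2 ^ n * V) := by
    rw [integral_indicator Metric.isClosed_closedBall.measurableSet, setIntegral_const,
      Measure.addHaar_real_closedBall _ _ (by positivity), finrank_euclideanSpace, Fintype.card_fin,
      smul_eq_mul, hb]
    have hNn : (N : ℝ) ^ n = N ^ (n - 1) * N := by rw [← pow_succ, Nat.sub_add_cancel hn]
    have e : (2 * (N : ℝ)) ^ n * V * (n * ((M / N) ^ 2 * (C / N ^ (n - 1)) ^ 2))
        = n * (M ^ 2 * C ^ 2) * (2 ^ n * V) / N ^ n := by
      rw [mul_pow, hNn]; field_simp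
    rw [e]
    exact div_le_self (by positivity) (one_le_pow₀ hN1')
  calc _ ≤ ∫ x, (‖f x‖ * ‖θ x‖
        + (Metric.closedBall (0 : Pt n) (2 * N)).indicator (fun _ => b) x) := by
        refine integral_mono ?_ (hfθ.add hbi) hle
        have hχ := contDiff_cutoff (n := n) N
        refine Integrable.add ?_ (integrable_finsetSum _ fun j _ => ?_)
        · refine (hfc.inner ((hχ.continuous.pow 2).smul
            hθ.continuous)).integrable_of_hasCompactSupport (HasCompactSupport.mono hfs fun x hx => ?_)
          contrapose! hx
          simp [Function.notMem_support.1 hx]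
        · refine (((continuous_pderiv (hχ.of_le (by simp)) j).pow 2).mul
            (hθ.continuous.norm.pow 2)).integrable_of_hasCompactSupport
            (HasCompactSupport.mono (hasCompactSupport_pderiv (hasCompactSupport_cutoff hN1) j)
              fun x hx => ?_)
          contrapose! hx
          simp [Function.notMem_support.1 hx]
    _ = (∫ x, ‖f x‖ * ‖θ x‖)
        + ∫ x, ((Metric.closedBall (0 : Pt n) (2 * N)).indicator (fun _ => b) x) :=
        integral_add hfθ hbi
    _ ≤ _ := by gcongr

end Energy

/-! ### Paravectors and their products. -/

section Paravector

variable {n h : ℕ} (hnh : n ≤ h)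

/-- The paravector `c₀ + ∑_j c_j e_j`. -/
def paravec (c₀ : ℂ) (c : Fin n → ℂ) : Cl h := c₀ • (1 : Cl h) + ∑ j, c j • clE hnh j

theorem inner_one_cl (v : Cl h) : inner ℂ (1 : Cl h) v = v ∅ := by
  have : (1 : Cl h) = EuclideanSpace.single ∅ 1 := rfl
  rw [this, EuclideanSpace.inner_single_left]; simp

theorem inner_clE (j : Fin n) (v : Cl h) : inner ℂ (clE hnh j) v = v {Fin.castLE hnh j} := by
  have : clE hnh j = EuclideanSpace.single {Fin.castLE hnh j} 1 := rfl
  rw [this, EuclideanSpace.inner_single_left]; simp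

theorem inner_paravec (c₀ : ℂ) (c : Fin n → ℂ) (v : Cl h) :
    inner ℂ (paravec hnh c₀ c) v = (starRingEnd ℂ) c₀ * v ∅
      + ∑ j, (starRingEnd ℂ) (c j) * v {Fin.castLE hnh j} := by
  rw [paravec, inner_add_left, sum_inner, inner_smul_left, inner_one_cl]
  simp only [inner_smul_left, inner_clE]

theorem one_apply_empty : (1 : Cl h) ∅ = 1 := by simp [cl_one_apply]

theorem one_apply_singleton (i : Fin h) : (1 : Cl h) {i} = 0 := by simp [cl_one_apply]

theorem clE_apply_empty (j : Fin n) : clE hnh j ∅ = 0 := by simp [clE, clGen, clBasis]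

theorem clE_apply_singleton (j l : Fin n) :
    clE hnh j {Fin.castLE hnh l} = if l = j then 1 else 0 := by
  simp [clE, clGen, clBasis]

theorem paravec_apply_empty (c₀ : ℂ) (c : Fin n → ℂ) : paravec hnh c₀ c ∅ = c₀ := by
  simp [paravec, one_apply_empty, clE_apply_empty]

theorem paravec_apply_singleton (c₀ : ℂ) (c : Fin n → ℂ) (l : Fin n) :
    paravec hnh c₀ c {Fin.castLE hnh l} = c l := by
  simp [paravec, one_apply_singleton, clE_apply_singleton]

theorem inner_paravec_paravec (c₀ d₀ : ℂ) (c d : Fin n → ℂ) :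
    inner ℂ (paravec hnh c₀ c) (paravec hnh d₀ d)
      = (starRingEnd ℂ) c₀ * d₀ + ∑ j, (starRingEnd ℂ) (c j) * d j := by
  simp only [inner_paravec, paravec_apply_empty, paravec_apply_singleton]

theorem norm_sq_paravec (c₀ : ℂ) (c : Fin n → ℂ) :
    ‖paravec hnh c₀ c‖ ^ 2 = ‖c₀‖ ^ 2 + ∑ j, ‖c j‖ ^ 2 := by
  have h1 : ((‖paravec hnh c₀ c‖ ^ 2 : ℝ) : ℂ) = ((‖c₀‖ ^ 2 + ∑ j, ‖c j‖ ^ 2 : ℝ) : ℂ) := by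
    have := inner_self_eq_norm_sq_to_K (𝕜 := ℂ) (paravec hnh c₀ c)
    push_cast
    rw [inner_paravec_paravec] at this
    simp only [Complex.conj_mul'] at this
    exact this.symm
  exact_mod_cast h1

/-- Only the e_j coordinate of v can be carried to a scalar by e_j, and e_j² = -1 gives the sign. -/
theorem scalarPart_clE_mul (j : Fin n) (v : Cl h) :
    scalarPart (clE hnh j * v) = -v {Fin.castLE hnh j} := by
  rw [scalarPart, cl_mul_apply, Finset.sum_eq_single {Fin.castLE hnh j}]
  · have h1 : clE hnh j {Fin.castLE hnh j} = 1 := by rw [clE_apply_singleton]; simp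
    have h2 : symmDiff {Fin.castLE hnh j} (∅ : Finset (Fin h)) = {Fin.castLE hnh j} :=
      symmDiff_bot _
    rw [h1, h2]; simp [clSign]
  · intro I _ hI
    simp [clE, clGen, clBasis, hI]
  · simp

theorem scalarPart_add (u v : Cl h) : scalarPart (u + v) = scalarPart u + scalarPart v := rfl

theorem scalarPart_smul (c : ℂ) (v : Cl h) : scalarPart (c • v) = c * scalarPart v := rfl

theorem cl_smul_mul (c : ℂ) (u v : Cl h) : (c • u) * v = c • (u * v) := by
  ext K
  simp only [cl_mul_apply, PiLp.smul_apply, smul_eq_mul, Finset.mul_sum]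
  exact Finset.sum_congr rfl (fun I _ => by ring)

theorem cl_mul_smul (c : ℂ) (u v : Cl h) : u * (c • v) = c • (u * v) := by
  ext K
  simp only [cl_mul_apply, PiLp.smul_apply, smul_eq_mul, Finset.mul_sum]
  exact Finset.sum_congr rfl (fun I _ => by ring)

theorem scalarPart_paravec_mul (c₀ : ℂ) (c : Fin n → ℂ) (v : Cl h) :
    scalarPart (paravec hnh c₀ c * v) = c₀ * v ∅ - ∑ j, c j * v {Fin.castLE hnh j} := by
  have hs : ∀ (s : Finset (Fin n)) (g : Fin n → Cl h),
      scalarPart (∑ j ∈ s, g j) = ∑ j ∈ s, scalarPart (g j) := fun s g => by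
    simp [scalarPart]
  rw [paravec, add_mul, Finset.sum_mul, scalarPart_add, hs, cl_smul_mul, one_mul, scalarPart_smul]
  simp only [cl_smul_mul, scalarPart_smul, scalarPart_clE_mul, mul_neg, Finset.sum_neg_distrib]
  rw [sub_eq_add_neg]; rfl

end Paravector

/-! ### The plane wave factor. -/

section Phase

variable {n : ℕ}

/-- The plane wave `e^{-i⟨a,x⟩}`. -/
def phase (a x : Pt n) : ℂ := Complex.exp (-Complex.I * ((inner ℝ a x : ℝ) : ℂ))

theorem phase_sub (a x y : Pt n) : phase a (x - y) = phase a x * (starRingEnd ℂ) (phase a y) := by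
  rw [phase, phase, phase, ← Complex.exp_conj, ← Complex.exp_add]
  congr 1
  simp [inner_sub_right]
  ring

theorem phase_mul_conj (a x : Pt n) : phase a x * (starRingEnd ℂ) (phase a x) = 1 := by
  rw [← phase_sub]; simp [phase]

theorem conj_mul_phase (a x : Pt n) : (starRingEnd ℂ) (phase a x) * phase a x = 1 := by
  rw [mul_comm, phase_mul_conj]

theorem norm_phase (a x : Pt n) : ‖phase a x‖ = 1 := by
  rw [phase, Complex.norm_exp]; simp

theorem contDiff_phase (a : Pt n) : ContDiff ℝ (⊤ : ℕ∞) (phase a) := by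
  have h1 : ContDiff ℝ (⊤ : ℕ∞) (fun x : Pt n => ((inner ℝ a x : ℝ) : ℂ)) :=
    Complex.ofRealCLM.contDiff.comp (contDiff_const.inner ℝ contDiff_id)
  exact (contDiff_const.mul h1).cexp

theorem pderiv_phase (a x : Pt n) (j : Fin n) :
    pderiv j (phase a) x = -Complex.I * (a j : ℂ) * phase a x := by
  have h1 : HasFDerivAt (fun x : Pt n => inner ℝ a x) (innerSL ℝ a) x := (innerSL ℝ a).hasFDerivAt
  have h2 : HasFDerivAt (fun x : Pt n => ((inner ℝ a x : ℝ) : ℂ))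
    (Complex.ofRealCLM.comp (innerSL ℝ a)) x := Complex.ofRealCLM.hasFDerivAt.comp x h1
  have h3 := (h2.const_mul (-Complex.I)).cexp
  rw [pderiv, show phase a = fun x => Complex.exp (-Complex.I * ((inner ℝ a x : ℝ) : ℂ)) from rfl,
    h3.fderiv]
  simp [EuclideanSpace.inner_single_right]
  ring

theorem pderiv_conj {g : Pt n → ℂ} (x : Pt n) (j : Fin n) :
    pderiv j (fun x => (starRingEnd ℂ) (g x)) x = (starRingEnd ℂ) (pderiv j g x) := by
  have : (fun x => (starRingEnd ℂ) (g x)) = Complex.conjCLE ∘ g := rfl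
  rw [pderiv, this, ContinuousLinearEquiv.comp_fderiv]; rfl

theorem contDiff_conj {g : Pt n → ℂ} {r : WithTop ℕ∞} (hg : ContDiff ℝ r g) :
    ContDiff ℝ r (fun x => (starRingEnd ℂ) (g x)) :=
  Complex.conjCLE.contDiff.comp hg

theorem hasCompactSupport_conj {g : Pt n → ℂ} (hg : HasCompactSupport g) :
    HasCompactSupport (fun x => (starRingEnd ℂ) (g x)) :=
  hg.comp_left (g := starRingEnd ℂ) (map_zero _)

theorem pderiv_mul {f g : Pt n → ℂ} {x : Pt n} (hf : DifferentiableAt ℝ f x)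
    (hg : DifferentiableAt ℝ g x) (j : Fin n) :
    pderiv j (fun y => f y * g y) x = f x * pderiv j g x + pderiv j f x * g x := by
  rw [pderiv, fderiv_fun_mul hf hg]
  simp [pderiv]
  ring

end Phase

/-! ### The fields of test functions and the projection onto their closed span. -/

section Field

variable {n h : ℕ} (hnh : n ≤ h) (a₀ : ℝ) (a : Pt n)

/-- The field `D_{ia} (e^{-i⟨a,x⟩} φ) = e^{-i⟨a,x⟩} (∑_j ∂_jφ e_j + i a₀ φ)`. -/
def diracField (φ : Pt n → ℂ) (x : Pt n) : Cl h :=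
  phase a x • paravec hnh (Complex.I * a₀ * φ x) (fun j => pderiv j φ x)

theorem continuous_paravec {X : Type*} [TopologicalSpace X] {c₀ : X → ℂ} {c : Fin n → X → ℂ}
    (h₀ : Continuous c₀) (hc : ∀ j, Continuous (c j)) :
    Continuous (fun x => paravec hnh (c₀ x) (fun j => c j x)) :=
  (h₀.smul continuous_const).add (continuous_finsetSum _ fun j _ => (hc j).smul continuous_const)

theorem continuous_diracField {φ : Pt n → ℂ} (hφ : ContDiff ℝ (⊤ : ℕ∞) φ) :
    Continuous (diracField hnh a₀ a φ) :=
  (contDiff_phase a).continuous.smul (continuous_paravec hnh (continuous_const.mul hφ.continuous)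
    fun j => continuous_pderiv (hφ.of_le (by simp)) j)

theorem diracField_eq_zero {φ : Pt n → ℂ} {x : Pt n} (hx : x ∉ tsupport φ) :
    diracField hnh a₀ a φ x = 0 := by
  have h2 : fderiv ℝ φ x = 0 :=
    image_eq_zero_of_notMem_tsupport fun hmem => hx (tsupport_fderiv_subset ℝ hmem)
  simp [diracField, paravec, pderiv, h2, image_eq_zero_of_notMem_tsupport hx]

theorem hasCompactSupport_diracField {φ : Pt n → ℂ} (hφ : HasCompactSupport φ) :
    HasCompactSupport (diracField hnh a₀ a φ) :=
  HasCompactSupport.intro hφ fun _ hx => diracField_eq_zero hnh a₀ a hx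

theorem memLp_diracField {φ : Pt n → ℂ} (hφ : ContDiff ℝ (⊤ : ℕ∞) φ) (hφs : HasCompactSupport φ) :
    MemLp (diracField hnh a₀ a φ) 2 volume :=
  (continuous_diracField hnh a₀ a hφ).memLp_of_hasCompactSupport
    (hasCompactSupport_diracField hnh a₀ a hφs)

/-- The plane wave is unimodular and the paravector units are orthonormal, so the L² norm of a field
is the energy of -Δ + a₀². This links the Dirac operator with the scalar equation. -/
theorem norm_sq_diracField (φ : Pt n → ℂ) (x : Pt n) :
    ‖diracField hnh a₀ a φ x‖ ^ 2 = ∑ j, ‖pderiv j φ x‖ ^ 2 + a₀ ^ 2 * ‖φ x‖ ^ 2 := by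
  rw [diracField, norm_smul, norm_phase, one_mul, norm_sq_paravec]
  simp [mul_pow]
  ring

theorem inner_diracField_left (θ : Pt n → ℂ) (x : Pt n) (v : Cl h) :
    inner ℂ (diracField hnh a₀ a θ x) v = (starRingEnd ℂ) (phase a x) *
      (-Complex.I * a₀ * (starRingEnd ℂ) (θ x) * v ∅
        + ∑ j, (starRingEnd ℂ) (pderiv j θ x) * v {Fin.castLE hnh j}) := by
  rw [diracField, inner_smul_left, inner_paravec]
  simp

theorem inner_diracField (θ φ : Pt n → ℂ) (x : Pt n) :
    inner ℂ (diracField hnh a₀ a θ x) (diracField hnh a₀ a φ x)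
      = ∑ j, (starRingEnd ℂ) (pderiv j θ x) * pderiv j φ x
        + a₀ ^ 2 * ((starRingEnd ℂ) (θ x) * φ x) := by
  rw [diracField, diracField, inner_smul_left, inner_smul_right, ← mul_assoc, conj_mul_phase, one_mul,
    inner_paravec_paravec]
  simp only [map_mul, Complex.conj_I, Complex.conj_ofReal]
  linear_combination (-a₀ ^ 2 * ((starRingEnd ℂ) (θ x) * φ x)) * Complex.I_sq

/-- The square integrable functions on `ℝⁿ` with values in the Clifford algebra. -/
abbrev L2Full (n h : ℕ) : Type := Lp (Cl h) 2 (volume : Measure (Pt n))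

/-- The element of `L²` given by the field of a test function. -/
def diracFieldLp {φ : Pt n → ℂ} (hφ : ContDiff ℝ (⊤ : ℕ∞) φ) (hφs : HasCompactSupport φ) :
    L2Full n h :=
  (memLp_diracField hnh a₀ a hφ hφs).toLp _

theorem diracFieldLp_ae_eq {φ : Pt n → ℂ} (hφ : ContDiff ℝ (⊤ : ℕ∞) φ) (hφs : HasCompactSupport φ) :
    diracFieldLp hnh a₀ a hφ hφs =ᵐ[volume] diracField hnh a₀ a φ :=
  MemLp.coeFn_toLp _

/-- The closure in `L²` of the fields of all test functions. -/
def diracSpace : Submodule ℂ (L2Full n h) :=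
  (Submodule.span ℂ {w | ∃ (φ : Pt n → ℂ) (hφ : ContDiff ℝ (⊤ : ℕ∞) φ) (hφs : HasCompactSupport φ),
    w = diracFieldLp hnh a₀ a hφ hφs}).topologicalClosure

instance : CompleteSpace (diracSpace hnh a₀ a) :=
  (Submodule.isClosed_topologicalClosure _).completeSpace_coe

theorem diracFieldLp_mem {φ : Pt n → ℂ} (hφ : ContDiff ℝ (⊤ : ℕ∞) φ) (hφs : HasCompactSupport φ) :
    diracFieldLp hnh a₀ a hφ hφs ∈ diracSpace hnh a₀ a :=
  Submodule.le_topologicalClosure _ (Submodule.subset_span ⟨φ, hφ, hφs, rfl⟩)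

theorem norm_sq_diracFieldLp {φ : Pt n → ℂ} (hφ : ContDiff ℝ (⊤ : ℕ∞) φ)
    (hφs : HasCompactSupport φ) :
    ‖diracFieldLp hnh a₀ a hφ hφs‖ ^ 2
      = ∫ x, (∑ j, ‖pderiv j φ x‖ ^ 2 + a₀ ^ 2 * ‖φ x‖ ^ 2) := by
  rw [← inner_self_eq_norm_sq (𝕜 := ℂ), L2.inner_def]
  have h1 : ∫ x, inner ℂ (diracFieldLp hnh a₀ a hφ hφs x) (diracFieldLp hnh a₀ a hφ hφs x)
      = ((∫ x, (∑ j, ‖pderiv j φ x‖ ^ 2 + a₀ ^ 2 * ‖φ x‖ ^ 2) : ℝ) : ℂ) := by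
    rw [← integral_complex_ofReal]
    refine integral_congr_ae ?_
    filter_upwards [diracFieldLp_ae_eq hnh a₀ a hφ hφs] with x hx
    rw [hx, inner_self_eq_norm_sq_to_K, ← norm_sq_diracField hnh a₀ a]
    norm_cast
  rw [h1]; simp

/-- A bounded sequence that converges weakly against a set converges against its closed span: the
limit passes to linear combinations, and boundedness makes the approximation error uniform in N. The
functional is represented by ξ, which need not lie in that span. -/
theorem tendsto_inner_of_mem_closure {H : Type*} [NormedAddCommGroup H] [InnerProductSpace ℂ H]
    {S : Set H} {u : ℕ → H} {ξ : H} {A : ℝ} (hA : ∀ᶠ N in atTop, ‖u N‖ ≤ A)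
    (hS : ∀ w ∈ S, Tendsto (fun N => inner ℂ (u N) w) atTop (𝓝 (inner ℂ ξ w))) {w : H}
    (hw : w ∈ (Submodule.span ℂ S).topologicalClosure) :
    Tendsto (fun N => inner ℂ (u N) w) atTop (𝓝 (inner ℂ ξ w)) := by
  have hspan : ∀ w ∈ Submodule.span ℂ S,
      Tendsto (fun N => inner ℂ (u N) w) atTop (𝓝 (inner ℂ ξ w)) := by
    intro w hw
    induction hw using Submodule.span_induction with
    | mem w hw => exact hS w hw
    | zero => simp
    | add x y _ _ hx hy => simpa only [inner_add_right] using hx.add hy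
    | smul c x _ hx => simpa only [inner_smul_right] using hx.const_mul c
  rw [Metric.tendsto_atTop']
  intro ε hε
  have hB : 0 < |A| + ‖ξ‖ + 1 := by positivity
  obtain ⟨w', hw', hd⟩ := Metric.mem_closure_iff.1 hw (ε / 2 / (|A| + ‖ξ‖ + 1)) (by positivity)
  have h1 := (Metric.tendsto_atTop'.1 (hspan w' hw')) (ε / 2) (by positivity)
  obtain ⟨N₁, h1⟩ := h1
  obtain ⟨N₂, h2⟩ := eventually_atTop.1 hA
  refine ⟨max N₁ N₂, fun N hN => ?_⟩
  have h3 := h1 N (lt_of_le_of_lt (le_max_left _ _) hN)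
  have h4 := h2 N ((le_max_right _ _).trans hN.le)
  rw [dist_eq_norm] at h3 hd ⊢
  have e : inner ℂ (u N) w - inner ℂ ξ w = (inner ℂ (u N) w' - inner ℂ ξ w')
      + inner ℂ (u N - ξ) (w - w') := by
    simp only [inner_sub_left, inner_sub_right]; ring
  rw [e]
  have h5 : ‖inner ℂ (u N - ξ) (w - w')‖ ≤ (|A| + ‖ξ‖ + 1) * ‖w - w'‖ := by
    refine (norm_inner_le_norm _ _).trans ?_
    gcongr
    have := norm_sub_le (u N) ξ
    have := le_abs_self A
    linarith
  have h6 : (|A| + ‖ξ‖ + 1) * ‖w - w'‖ < ε / 2 := by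
    rwa [lt_div_iff₀' hB] at hd
  linarith [norm_add_le (inner ℂ (u N) w' - inner ℂ ξ w') (inner ℂ (u N - ξ) (w - w'))]

/-- Green's identity for a solution of `-Δθ + a₀²θ = f` and a test function. -/
theorem integral_inner_diracField {θ f : Pt n → ℂ} (hθ : ContDiff ℝ (⊤ : ℕ∞) θ)
    (hf : ∀ x, -∑ j, pderiv j (pderiv j θ) x + a₀ ^ 2 • θ x = f x)
    {φ : Pt n → ℂ} (hφ : ContDiff ℝ (⊤ : ℕ∞) φ) (hφs : HasCompactSupport φ) :
    ∫ x, inner ℂ (diracField hnh a₀ a θ x) (diracField hnh a₀ a φ x)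
      = ∫ x, (starRingEnd ℂ) (f x) * φ x := by
  have hθj : ∀ j, ContDiff ℝ (⊤ : ℕ∞) (fun x => (starRingEnd ℂ) (pderiv j θ x)) := fun j =>
    contDiff_conj (contDiff_pderiv hθ j)
  have hθjj : ∀ j, Continuous (fun x => (starRingEnd ℂ) (pderiv j (pderiv j θ) x)) := fun j =>
    (contDiff_conj (contDiff_pderiv (contDiff_pderiv hθ j) j)).continuous
  have hφj : ∀ j, Continuous (pderiv j φ) := continuous_pderiv (hφ.of_le (by simp))
  have i1 : ∀ j, Integrable (fun x => (starRingEnd ℂ) (pderiv j θ x) * pderiv j φ x) := fun j =>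
    ((hθj j).continuous.mul (hφj j)).integrable_of_hasCompactSupport
      (hasCompactSupport_pderiv hφs j).mul_left
  have i2 : ∀ j, Integrable (fun x => (starRingEnd ℂ) (pderiv j (pderiv j θ) x) * φ x) := fun j =>
    ((hθjj j).mul hφ.continuous).integrable_of_hasCompactSupport hφs.mul_left
  have i3 : ∀ j, Integrable (fun x => (starRingEnd ℂ) (pderiv j θ x) * φ x) := fun j =>
    ((hθj j).continuous.mul hφ.continuous).integrable_of_hasCompactSupport hφs.mul_left
  have i4 : Integrable (fun x => (a₀ : ℂ) ^ 2 * ((starRingEnd ℂ) (θ x) * φ x)) :=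
    (continuous_const.mul ((contDiff_conj hθ).continuous.mul
      hφ.continuous)).integrable_of_hasCompactSupport hφs.mul_left.mul_left
  have hibp : ∀ j, ∫ x, (starRingEnd ℂ) (pderiv j θ x) * pderiv j φ x
      = -∫ x, (starRingEnd ℂ) (pderiv j (pderiv j θ) x) * φ x := fun j => by
    have e : ∀ x, fderiv ℝ (fun x => (starRingEnd ℂ) (pderiv j θ x)) x (EuclideanSpace.single j 1)
        = (starRingEnd ℂ) (pderiv j (pderiv j θ) x) := fun x => pderiv_conj x j
    have := integral_mul_fderiv_eq_neg_fderiv_mul_of_integrable (μ := volume)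
      (f := fun x => (starRingEnd ℂ) (pderiv j θ x)) (g := φ) (v := EuclideanSpace.single j 1)
      (by simp only [e]; exact i2 j) (i1 j) (i3 j)
      (fun x _ => (hθj j).differentiable (by simp) x) (fun x _ => hφ.differentiable (by simp) x)
    simp only [e] at this
    exact this
  have hpt : ∀ x, (starRingEnd ℂ) (f x) * φ x
      = -∑ j, (starRingEnd ℂ) (pderiv j (pderiv j θ) x) * φ x
        + a₀ ^ 2 * ((starRingEnd ℂ) (θ x) * φ x) := by
    intro x
    rw [← hf x, map_add, map_neg, map_sum, add_mul, neg_mul, Finset.sum_mul]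
    simp
    ring
  simp only [inner_diracField, hpt]
  have i5 : Integrable (fun x => -∑ j, (starRingEnd ℂ) (pderiv j (pderiv j θ) x) * φ x) :=
    (integrable_finsetSum _ fun j _ => i2 j).neg
  rw [integral_add (integrable_finsetSum _ fun j _ => i1 j) i4, integral_add i5 i4, integral_neg,
    integral_finsetSum _ fun j _ => i1 j, integral_finsetSum _ fun j _ => i2 j,
    Finset.sum_congr rfl fun j _ => hibp j, Finset.sum_neg_distrib]

theorem diracField_congr {φ ψ : Pt n → ℂ} {x : Pt n} (hφψ : φ =ᶠ[𝓝 x] ψ) :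
    diracField hnh a₀ a φ x = diracField hnh a₀ a ψ x := by
  simp only [diracField, pderiv, hφψ.fderiv_eq, hφψ.eq_of_nhds]

theorem diracField_cutoff {N : ℕ} (hN : 1 ≤ N) (θ : Pt n → ℂ) {x : Pt n} (hx : ‖x‖ < N) :
    diracField hnh a₀ a (fun y => cutoff n N y • θ y) x = diracField hnh a₀ a θ x := by
  refine diracField_congr hnh a₀ a ?_
  filter_upwards [Metric.isOpen_ball.mem_nhds (mem_ball_zero_iff.2 hx)] with y hy
  rw [cutoff_eq_one hN (mem_ball_zero_iff.1 hy).le, one_smul]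

/-- The projection onto the closure of the fields, tested against `ξ`, is computed by the field of a
decaying potential of `ξ`. -/
theorem inner_starProjection_diracSpace (hn : 1 ≤ n) {θ f : Pt n → ℂ}
    (hθ : ContDiff ℝ (⊤ : ℕ∞) θ)
    (hf : ∀ x, -∑ j, pderiv j (pderiv j θ) x + a₀ ^ 2 • θ x = f x)
    (hfc : Continuous f) (hfs : HasCompactSupport f) {C R : ℝ} (hC : 0 ≤ C)
    (hdecay : ∀ x : Pt n, R ≤ ‖x‖ → ‖θ x‖ ≤ C / ‖x‖ ^ (n - 1)) (ξ : L2Full n h)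
    (hξ : ∀ (φ : Pt n → ℂ) (hφ : ContDiff ℝ (⊤ : ℕ∞) φ) (hφs : HasCompactSupport φ),
      inner ℂ ξ (diracFieldLp hnh a₀ a hφ hφs) = ∫ x, (starRingEnd ℂ) (f x) * φ x)
    (v : L2Full n h) {r : ℝ} (hv : ∀ᵐ x : Pt n, r < ‖x‖ → v x = 0) :
    inner ℂ ξ ((diracSpace hnh a₀ a).starProjection v)
      = ∫ x, inner ℂ (diracField hnh a₀ a θ x) (v x) := by
  have hχθ : ∀ N, ContDiff ℝ (⊤ : ℕ∞) (fun y => cutoff n (N + 1) y • θ y) := fun N =>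
    (contDiff_cutoff _).smul hθ
  have hχθs : ∀ N, HasCompactSupport (fun y => cutoff n (N + 1) y • θ y) := fun N =>
    (hasCompactSupport_cutoff (Nat.le_add_left 1 N)).smul_right
  -- The truncations of θ are test functions, so their fields lie in the space; the energy bound
  -- keeps them bounded in L².
  set u : ℕ → L2Full n h := fun N => diracFieldLp hnh a₀ a (hχθ N) (hχθs N) with hu
  obtain ⟨A, hA⟩ := exists_energy_cutoff_le hn hθ hf hfc hfs hC hdecay
  have hbound : ∀ᶠ N in atTop, ‖u N‖ ≤ √A := by
    filter_upwards [(tendsto_add_atTop_nat 1).eventually hA] with N hN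
    refine Real.le_sqrt_of_sq_le ?_
    rw [hu, norm_sq_diracFieldLp]; exact hN
  -- As soon as the cutoff is 1 on the support of φ, the pairing is constant in N, with the value
  -- given by Green's identity.
  have hlim : ∀ w ∈ {w | ∃ (φ : Pt n → ℂ) (hφ : ContDiff ℝ (⊤ : ℕ∞) φ) (hφs : HasCompactSupport φ),
      w = diracFieldLp hnh a₀ a hφ hφs},
      Tendsto (fun N => inner ℂ (u N) w) atTop (𝓝 (inner ℂ ξ w)) := by
    rintro w ⟨φ, hφ, hφs, rfl⟩
    refine tendsto_const_nhds.congr' ?_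
    obtain ⟨ρ, hρ⟩ := hφs.isCompact.isBounded.subset_closedBall (0 : Pt n)
    filter_upwards [eventually_ge_atTop ⌈ρ⌉₊] with N hN
    have hNρ : ρ < (N + 1 : ℕ) := by
      have h1 := Nat.le_ceil ρ
      have h2 : (⌈ρ⌉₊ : ℝ) ≤ N := by exact_mod_cast hN
      push_cast; linarith
    rw [hξ φ hφ hφs, L2.inner_def, ← integral_inner_diracField hnh a₀ a hθ hf hφ hφs]
    refine integral_congr_ae ?_
    filter_upwards [diracFieldLp_ae_eq hnh a₀ a hφ hφs,
      diracFieldLp_ae_eq hnh a₀ a (hχθ N) (hχθs N)] with x hx1 hx2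
    rw [hx1, hu, hx2]
    by_cases hx : x ∈ tsupport φ
    · rw [diracField_cutoff hnh a₀ a (Nat.le_add_left 1 N)]
      exact lt_of_le_of_lt (mem_closedBall_zero_iff.1 (hρ hx)) hNρ
    · rw [diracField_eq_zero hnh a₀ a hx]; simp
  have h1 := tendsto_inner_of_mem_closure hbound hlim
    (w := (diracSpace hnh a₀ a).starProjection v) (Submodule.starProjection_apply_mem _ _)
  -- The same limit is now computed differently. The projection may be dropped because `u N` lies in
  -- the space, and then the pairing with v is constant once the cutoff is 1 where v lives.
  refine tendsto_nhds_unique h1 (tendsto_const_nhds.congr' ?_)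
  filter_upwards [eventually_ge_atTop ⌈r⌉₊] with N hN
  have hNr : r < (N + 1 : ℕ) := by
    have h1 := Nat.le_ceil r
    have h2 : (⌈r⌉₊ : ℝ) ≤ N := by exact_mod_cast hN
    push_cast; linarith
  have hproj : inner ℂ (u N) ((diracSpace hnh a₀ a).starProjection v) = inner ℂ (u N) v := by
    rw [← Submodule.inner_starProjection_left_eq_right,
      Submodule.starProjection_eq_self_iff.2 (diracFieldLp_mem hnh a₀ a (hχθ N) (hχθs N))]
  rw [hproj, L2.inner_def]
  refine integral_congr_ae ?_
  filter_upwards [hv, diracFieldLp_ae_eq hnh a₀ a (hχθ N) (hχθs N)] with x hx1 hx2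
  by_cases hx : r < ‖x‖
  · rw [hx1 hx]; simp
  · rw [hu, hx2, diracField_cutoff hnh a₀ a (Nat.le_add_left 1 N)]
    exact lt_of_le_of_lt (not_lt.1 hx) hNr

end Field

/-! ### Convolution with Clifford valued kernels. -/

section CliffordConvolution

open scoped Convolution

variable {n h : ℕ}

/-- The product of the Clifford algebra as a continuous bilinear map. -/
def clMulL (h : ℕ) : Cl h →L[ℂ] Cl h →L[ℂ] Cl h :=
  LinearMap.toContinuousLinearMap
    ((LinearMap.toContinuousLinearMap : (Cl h →ₗ[ℂ] Cl h) ≃ₗ[ℂ] (Cl h →L[ℂ] Cl h)).toLinearMap.comp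
      (LinearMap.mk₂ ℂ (fun u v : Cl h => u * v) add_mul cl_smul_mul mul_add cl_mul_smul))

theorem clMulL_apply (u v : Cl h) : clMulL h u v = u * v := rfl

theorem norm_cl_mul_le (u v : Cl h) : ‖u * v‖ ≤ ‖clMulL h‖ * ‖u‖ * ‖v‖ :=
  (clMulL h).le_opNorm₂ u v

theorem integrable_mul_of_locallyIntegrable {A w : Pt n → Cl h} (hA : Continuous A)
    (hAs : HasCompactSupport A) (hw : LocallyIntegrable w) : Integrable (fun x => A x * w x) := by
  have h1 : Integrable (fun x => ‖A x‖ • w x) :=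
    hw.integrable_smul_left_of_hasCompactSupport hA.norm hAs.norm
  refine Integrable.mono (h1.norm.const_mul ‖clMulL h‖)
    ((clMulL h).aestronglyMeasurable_comp₂ hA.aestronglyMeasurable hw.aestronglyMeasurable) ?_
  refine Eventually.of_forall fun x => ?_
  rw [Real.norm_of_nonneg (by positivity), norm_smul, norm_norm, ← mul_assoc]
  exact norm_cl_mul_le _ _

theorem locallyIntegrable_norm {E : Type*} [NormedAddCommGroup E] {f : Pt n → E}
    (hf : LocallyIntegrable f) : LocallyIntegrable (fun x => ‖f x‖) :=
  hf.mono hf.aestronglyMeasurable.norm (Eventually.of_forall fun x => by simp)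

theorem locallyIntegrable_comp_sub_right {E : Type*} [NormedAddCommGroup E] {f : Pt n → E}
    (hf : LocallyIntegrable f) (y : Pt n) : LocallyIntegrable (fun x => f (x - y)) := by
  rw [locallyIntegrable_iff] at hf ⊢
  intro s hs
  have hmp : MeasurePreserving (fun x : Pt n => x - y) volume volume :=
    measurePreserving_sub_right volume y
  have hme : MeasurableEmbedding (fun x : Pt n => x - y) := measurableEmbedding_subRight y
  have := (hmp.integrableOn_image hme (f := f) (s := s)).1 (hf _ (hs.image (f := fun x => x - y) (by fun_prop)))
  exact this

variable {E u : Pt n → Cl h} {r : ℝ}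

/-- For |x| ≤ ρ and |y| ≤ r only the values of E on the ball of radius ρ + r enter. This replaces a
locally integrable kernel by an integrable one, to which the standard convolution theorems apply. -/
theorem kernel_mul_eq_truncated (hur : ∀ y, r < ‖y‖ → u y = 0) {ρ : ℝ} {x : Pt n} (hx : ‖x‖ ≤ ρ)
    (y : Pt n) :
    (Metric.closedBall (0 : Pt n) (ρ + r)).indicator E (x - y) * u y = E (x - y) * u y := by
  by_cases hy : r < ‖y‖
  · rw [hur y hy, mul_zero, mul_zero]
  · rw [indicator_of_mem]
    rw [mem_closedBall_zero_iff]
    exact (norm_sub_le _ _).trans (add_le_add hx (not_lt.1 hy))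

theorem integrable_truncated (hE : LocallyIntegrable E) (ρ : ℝ) :
    Integrable ((Metric.closedBall (0 : Pt n) ρ).indicator E) :=
  (integrable_indicator_iff Metric.isClosed_closedBall.measurableSet).2
    (hE.integrableOn_isCompact (isCompact_closedBall _ _))

theorem ae_integrable_kernel_mul (hE : LocallyIntegrable E) (hu : Integrable u)
    (hur : ∀ y, r < ‖y‖ → u y = 0) : ∀ᵐ x : Pt n, Integrable (fun y => E (x - y) * u y) := by
  have h1 : ∀ N : ℕ, ∀ᵐ x : Pt n, ‖x‖ ≤ N → Integrable (fun y => E (x - y) * u y) := by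
    intro N
    filter_upwards [hu.ae_convolution_exists (clMulL h).flip (integrable_truncated hE (N + r))]
      with x hx hxN
    have h2 : Integrable (fun y => (Metric.closedBall (0 : Pt n) (N + r)).indicator E (x - y) * u y) :=
      hx
    simpa only [kernel_mul_eq_truncated hur hxN] using h2
  filter_upwards [ae_all_iff.2 h1] with x hx
  obtain ⟨N, hN⟩ := exists_nat_ge ‖x‖
  exact hx N hN

theorem locallyIntegrable_kernel_mul (hE : LocallyIntegrable E) (hu : Integrable u)
    (hur : ∀ y, r < ‖y‖ → u y = 0) : LocallyIntegrable (fun x => ∫ y, E (x - y) * u y) := by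
  rw [locallyIntegrable_iff]
  intro s hs
  obtain ⟨ρ, hρ⟩ := hs.isBounded.subset_closedBall (0 : Pt n)
  have h1 : Integrable (fun x => ∫ y, (Metric.closedBall (0 : Pt n) (ρ + r)).indicator E (x - y) * u y) :=
    hu.integrable_convolution (clMulL h).flip (integrable_truncated hE (ρ + r))
  refine h1.integrableOn.congr_fun (fun x hx => ?_) hs.measurableSet
  simp only [kernel_mul_eq_truncated hur (mem_closedBall_zero_iff.1 (hρ hx))]

/-- Fubini's theorem for the convolution with a Clifford algebra valued kernel. -/
theorem integral_mul_kernel_mul (hE : LocallyIntegrable E) (hu : Integrable u)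
    (hur : ∀ y, r < ‖y‖ → u y = 0) {A : Pt n → Cl h} (hA : Continuous A)
    (hAs : HasCompactSupport A) :
    Integrable (fun y => (∫ x, A x * E (x - y)) * u y) ∧
    ∫ x, A x * ∫ y, E (x - y) * u y = ∫ y, (∫ x, A x * E (x - y)) * u y := by
  obtain ⟨ρ, hρ⟩ := hAs.isCompact.isBounded.subset_closedBall (0 : Pt n)
  set E' := (Metric.closedBall (0 : Pt n) (ρ + r)).indicator E with hE'
  have hP : Integrable (fun p : Pt n × Pt n => E' (p.1 - p.2) * u p.2) (volume.prod volume) :=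
    hu.convolution_integrand (clMulL h).flip (integrable_truncated hE (ρ + r))
  obtain ⟨M, hM⟩ := hAs.exists_bound_of_continuous hA
  have hQ : Integrable (fun p : Pt n × Pt n => A p.1 * (E' (p.1 - p.2) * u p.2))
      (volume.prod volume) := by
    refine Integrable.mono' (hP.norm.const_mul (‖clMulL h‖ * M))
      ((clMulL h).aestronglyMeasurable_comp₂
        (hA.comp continuous_fst).aestronglyMeasurable hP.aestronglyMeasurable)
      (Eventually.of_forall fun p => ?_)
    refine (norm_cl_mul_le _ _).trans ?_
    gcongr
    exact hM _
  have htr : ∀ x y, A x * (E' (x - y) * u y) = A x * (E (x - y) * u y) := by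
    intro x y
    by_cases hx : x ∈ tsupport A
    · rw [hE', kernel_mul_eq_truncated hur (mem_closedBall_zero_iff.1 (hρ hx))]
    · rw [image_eq_zero_of_notMem_tsupport hx, zero_mul, zero_mul]
  have hinner : ∀ y, ∫ x, A x * (E' (x - y) * u y) = (∫ x, A x * E (x - y)) * u y := by
    intro y
    have h1 := ((clMulL h).flip (u y)).integral_comp_comm
      (integrable_mul_of_locallyIntegrable hA hAs (locallyIntegrable_comp_sub_right hE y))
    simp only [ContinuousLinearMap.flip_apply, clMulL_apply] at h1
    rw [← h1]
    refine integral_congr_ae (Eventually.of_forall fun x => ?_)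
    simp only [htr, mul_assoc]
  constructor
  · have := hQ.integral_prod_right
    simpa only [hinner] using this
  · calc ∫ x, A x * ∫ y, E (x - y) * u y = ∫ x, ∫ y, A x * (E' (x - y) * u y) := by
          refine integral_congr_ae ?_
          filter_upwards [ae_integrable_kernel_mul hE hu hur] with x hx
          simp only [htr]
          exact ((clMulL h (A x)).integral_comp_comm hx).symm
      _ = ∫ y, ∫ x, A x * (E' (x - y) * u y) := integral_integral_swap hQ
      _ = _ := by simp only [hinner]

end CliffordConvolution

/-! ### The kernel e_{ia}: its transpose and the fundamental solution property. -/

section KernelCalculus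

variable {n h : ℕ} (hnh : n ≤ h) {a₀ : ℝ} {k q : ℝ → ℝ} {C : ℝ} (a : Pt n)

theorem eKernel_eq (x : Pt n) :
    eKernel hnh a₀ a x = phase a x • paravec hnh (-(Complex.I * a₀ * (fundK n a₀ x : ℂ)))
      (fun j => (partialD (fundK n a₀) j x : ℂ)) := by
  rw [eKernel, paravec, phase, neg_smul, sub_eq_add_neg, add_comm]

theorem IsRadialProfile.locallyIntegrable_eKernel (hp : IsRadialProfile n a₀ k q C) (hn : 1 ≤ n) :
    LocallyIntegrable (eKernel (h := h) hnh a₀ a) := by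
  have h1 : LocallyIntegrable (fun x => ‖fundK n a₀ x‖) :=
    locallyIntegrable_norm (hp.locallyIntegrable_fundK hn)
  have h2 : LocallyIntegrable (fun x => ∑ j, ‖partialD (fundK n a₀) j x‖) :=
    locallyIntegrable_finsetSum _ fun j _ => locallyIntegrable_norm (hp.locallyIntegrable_partialD hn j)
  have mK := (hp.locallyIntegrable_fundK hn).aestronglyMeasurable
  have mD := fun j => (hp.locallyIntegrable_partialD hn j).aestronglyMeasurable
  have hmeas : AEStronglyMeasurable (eKernel (h := h) hnh a₀ a) volume := by
    have e : eKernel (h := h) hnh a₀ a = fun x => phase a x • ((-(Complex.I * a₀ * (fundK n a₀ x : ℂ)))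
        • (1 : Cl h) + ∑ j, (partialD (fundK n a₀) j x : ℂ) • clE hnh j) :=
      funext fun x => eKernel_eq hnh a x
    rw [e]
    refine (contDiff_phase a).continuous.aestronglyMeasurable.smul (AEStronglyMeasurable.add ?_ ?_)
    · exact (((Complex.continuous_ofReal.comp_aestronglyMeasurable mK).const_mul _).neg).smul_const _
    · exact Finset.aestronglyMeasurable_fun_sum _ fun j _ =>
        (Complex.continuous_ofReal.comp_aestronglyMeasurable (mD j)).smul_const _
  refine ((h1.smul |a₀|).add h2).mono hmeas (Eventually.of_forall fun x => ?_)
  have hone : ‖(1 : Cl h)‖ = 1 := by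
    have : (1 : Cl h) = EuclideanSpace.single ∅ 1 := rfl
    rw [this]; simp
  have hgen : ∀ j, ‖clE hnh j‖ = 1 := fun j => by
    have : clE hnh j = EuclideanSpace.single {Fin.castLE hnh j} 1 := rfl
    rw [this]; simp
  rw [eKernel_eq, norm_smul, norm_phase, one_mul, paravec]
  refine (norm_add_le _ _).trans (le_trans ?_ (le_abs_self _))
  refine add_le_add ?_ ((norm_sum_le _ _).trans (Finset.sum_le_sum fun j _ => ?_))
  · rw [norm_smul, hone]; simp
  · rw [norm_smul, hgen]; simp

theorem integral_paravec {c₀ : Pt n → ℂ} {c : Fin n → Pt n → ℂ} (h₀ : Integrable c₀)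
    (hc : ∀ j, Integrable (c j)) :
    ∫ x, paravec hnh (c₀ x) (fun j => c j x) = paravec hnh (∫ x, c₀ x) (fun j => ∫ x, c j x) := by
  simp only [paravec]
  rw [integral_add (h₀.smul_const _) (integrable_finsetSum _ fun j _ => (hc j).smul_const _),
    integral_smul_const, integral_finsetSum _ fun j _ => (hc j).smul_const _]
  simp only [integral_smul_const]

theorem fundK_neg (x : Pt n) : fundK n a₀ (-x) = fundK n a₀ x := by simp [fundK]

theorem partialD_fundK_neg (j : Fin n) (x : Pt n) :
    partialD (fundK n a₀) j (-x) = -partialD (fundK n a₀) j x := by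
  have h1 : (fun x => fundK n a₀ ((-1 : ℝ) • x)) = fundK n a₀ := by
    funext x; rw [neg_one_smul, fundK_neg]
  have h2 := fderiv_comp_smul (𝕜 := ℝ) (f := fundK n a₀) (x := x) (-1 : ℝ)
  rw [h1] at h2
  simp only [neg_smul, one_smul] at h2
  rw [partialD, partialD, h2]; simp

theorem paravec_smul (c c₀ : ℂ) (d : Fin n → ℂ) :
    c • paravec hnh c₀ d = paravec hnh (c * c₀) (fun j => c * d j) := by
  simp only [paravec, smul_add, Finset.smul_sum, smul_smul]

/-- The scalar part of the adjoint kernel applied to a test function is the field of a potential. -/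
theorem IsRadialProfile.scalarPart_integral_eKernel (hp : IsRadialProfile n a₀ k q C) (hn : 1 ≤ n)
    {f : Pt n → ℂ} (hf : ContDiff ℝ (⊤ : ℕ∞) f) (hfs : HasCompactSupport f) (y : Pt n) (v : Cl h) :
    scalarPart ((∫ x, (((starRingEnd ℂ) (f x) * (starRingEnd ℂ) (phase a x)) • (1 : Cl h))
      * eKernel hnh a₀ a (x - y)) * v)
      = inner ℂ (diracField hnh a₀ a (smulConv (fundK n a₀) f) y) v := by
  have hcf : Continuous (fun x => (starRingEnd ℂ) (f x)) := (contDiff_conj hf).continuous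
  have hcfs := hasCompactSupport_conj hfs
  have hint : ∀ κ : Pt n → ℝ, LocallyIntegrable κ →
      Integrable (fun x => (κ (x - y) : ℂ) * (starRingEnd ℂ) (f x)) := by
    intro κ hκ
    have := (locallyIntegrable_comp_sub_right hκ y).integrable_smul_right_of_hasCompactSupport hcf hcfs
    simpa only [Complex.real_smul] using this
  have hK := hint _ (hp.locallyIntegrable_fundK hn)
  have hD := fun j => hint _ (hp.locallyIntegrable_partialD hn j)
  have h1 : ∀ x, (((starRingEnd ℂ) (f x) * (starRingEnd ℂ) (phase a x)) • (1 : Cl h))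
      * eKernel hnh a₀ a (x - y) = (starRingEnd ℂ) (phase a y) • paravec hnh
        (-(Complex.I * a₀) * ((fundK n a₀ (x - y) : ℂ) * (starRingEnd ℂ) (f x)))
        (fun j => (partialD (fundK n a₀) j (x - y) : ℂ) * (starRingEnd ℂ) (f x)) := by
    intro x
    have h0 := conj_mul_phase a x
    rw [cl_smul_mul, one_mul, eKernel_eq, phase_sub, smul_smul, paravec_smul, paravec_smul]
    congr 1
    · linear_combination (-(Complex.I * a₀ * (fundK n a₀ (x - y) : ℂ)) * (starRingEnd ℂ) (f x)
        * (starRingEnd ℂ) (phase a y)) * h0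
    · funext j
      linear_combination ((partialD (fundK n a₀) j (x - y) : ℂ) * (starRingEnd ℂ) (f x)
        * (starRingEnd ℂ) (phase a y)) * h0
  have hKy : ∫ x, (fundK n a₀ (x - y) : ℂ) * (starRingEnd ℂ) (f x)
      = (starRingEnd ℂ) (smulConv (fundK n a₀) f y) := by
    rw [smulConv_apply', ← integral_conj]
    refine integral_congr_ae (Eventually.of_forall fun x => ?_)
    simp only [Complex.real_smul, map_mul, Complex.conj_ofReal]
    rw [← fundK_neg, neg_sub]
  -- The minus sign comes from the oddness of ∂_jK; it will cancel the one from e_j² = -1, turning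
  -- the Clifford product into the Hermitian pairing with a field.
  have hDy : ∀ j, ∫ x, (partialD (fundK n a₀) j (x - y) : ℂ) * (starRingEnd ℂ) (f x)
      = -(starRingEnd ℂ) (pderiv j (smulConv (fundK n a₀) f) y) := by
    intro j
    rw [pderiv_smulConv (hp.locallyIntegrable_fundK hn) (hf.of_le (by simp)) hfs,
      hp.smulConv_pderiv hn (hf.of_le (by simp)) hfs, smulConv_apply', ← integral_conj,
      ← integral_neg]
    refine integral_congr_ae (Eventually.of_forall fun x => ?_)
    simp only [Complex.real_smul, map_mul, Complex.conj_ofReal]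
    rw [← neg_sub y x, partialD_fundK_neg]
    push_cast; ring
  simp only [h1]
  rw [integral_smul, integral_paravec hnh (hK.const_mul _) hD, integral_const_mul, hKy]
  simp only [hDy]
  rw [cl_smul_mul, scalarPart_smul, scalarPart_paravec_mul, inner_diracField_left]
  simp only [neg_mul, Finset.sum_neg_distrib, sub_neg_eq_add]

/-- Symmetrising in (j, l) replaces e_j e_l by half its anticommutator, which vanishes off the
diagonal. This is how the Dirac operator squares to the Laplacian. -/
theorem sum_sum_smul_clE_mul {c : Fin n → Fin n → ℂ} (hc : ∀ j l, c j l = c l j) :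
    ∑ j, ∑ l, c j l • (clE hnh j * clE hnh l) = -(∑ j, c j j) • (1 : Cl h) := by
  have h1 : ∑ j, ∑ l, c j l • (clE hnh j * clE hnh l)
      = ∑ j, ∑ l, c j l • (clE hnh l * clE hnh j) := by
    rw [Finset.sum_comm]
    exact Finset.sum_congr rfl fun j _ => Finset.sum_congr rfl fun l _ => by rw [hc]
  have h2 : ∀ j l, clE hnh j * clE hnh l + clE hnh l * clE hnh j
      = if j = l then (-2 : ℂ) • (1 : Cl h) else 0 := by
    intro j l
    rw [clE, clE, clGen_mul_add]
    have e : (-2 : Cl h) = (-2 : ℂ) • (1 : Cl h) := by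
      rw [neg_smul, Algebra.smul_def, mul_one, map_ofNat]
    simp only [Fin.castLE_inj, e]
  have h3 : (2 : ℂ) • ∑ j, ∑ l, c j l • (clE hnh j * clE hnh l)
      = (2 : ℂ) • (-(∑ j, c j j) • (1 : Cl h)) := by
    rw [two_smul]
    nth_rewrite 2 [h1]
    rw [← Finset.sum_add_distrib]
    simp only [← Finset.sum_add_distrib, ← smul_add, h2]
    simp only [smul_ite, smul_zero, Finset.sum_ite_eq, Finset.mem_univ, if_true, smul_smul,
      ← Finset.sum_smul]
    congr 1
    rw [← Finset.sum_mul]; ring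
  exact smul_right_injective _ (two_ne_zero' ℂ) h3

theorem paravec_mul_paravec (c₀ d₀ : ℂ) (c d : Fin n → ℂ) :
    paravec hnh c₀ c * paravec hnh d₀ d
      = paravec hnh (c₀ * d₀) (fun j => c₀ * d j + c j * d₀)
        + ∑ j, ∑ l, (c j * d l) • (clE hnh j * clE hnh l) := by
  simp only [paravec, add_mul, mul_add, Finset.sum_mul, Finset.mul_sum, cl_smul_mul, cl_mul_smul,
    one_mul, mul_one, smul_smul, add_smul, Finset.sum_add_distrib]
  have hs : ∑ l, ∑ j, (d l * c j) • (clE hnh j * clE hnh l)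
      = ∑ j, ∑ l, (c j * d l) • (clE hnh j * clE hnh l) := by
    rw [Finset.sum_comm]
    simp only [mul_comm]
  have h0 : ∀ x, d₀ * c x = c x * d₀ := fun x => mul_comm _ _
  have h1 : ∀ x, d x * c₀ = c₀ * d x := fun x => mul_comm _ _
  rw [hs, mul_comm d₀ c₀]
  simp only [h0, h1]
  abel

theorem pderiv_pderiv_comm {F : Type*} [NormedAddCommGroup F] [NormedSpace ℝ F] {m : Pt n → F}
    (hm : ContDiff ℝ (⊤ : ℕ∞) m) (j l : Fin n) (x : Pt n) :
    pderiv l (pderiv j m) x = pderiv j (pderiv l m) x := by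
  have hd : DifferentiableAt ℝ (fderiv ℝ m) x :=
    ((hm.fderiv_right (m := (⊤ : ℕ∞)) (by simp)).differentiable (by simp)) x
  have h1 : ∀ i i' : Fin n, pderiv i (pderiv i' m) x
      = fderiv ℝ (fderiv ℝ m) x (EuclideanSpace.single i 1) (EuclideanSpace.single i' 1) := by
    intro i i'
    have : pderiv i' m = fun y => fderiv ℝ m y (EuclideanSpace.single i' 1) := rfl
    rw [this, pderiv, fderiv_clm_apply hd (differentiableAt_const _)]
    simp
  rw [h1, h1]
  have hs : IsSymmSndFDerivAt ℝ m x :=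
    hm.contDiffAt.isSymmSndFDerivAt (by
      rw [minSmoothness_of_isRCLikeNormedField]
      exact (show ((2 : ℕ∞) : WithTop ℕ∞) ≤ ((⊤ : ℕ∞) : WithTop ℕ∞) from WithTop.coe_le_coe.2 le_top))
  exact hs _ _

/-- The vector part vanishes because the pointwise derivatives of K are its weak ones. The
coefficients ∫ ∂_lK ∂_jm = -∫ K ∂_l∂_jm are symmetric, so the double Clifford sum collapses to its
trace; with the a₀² term this trace is the fundamental solution identity for -Δ + a₀². -/
theorem IsRadialProfile.integral_paravec_mul (hp : IsRadialProfile n a₀ k q C) (hn : 1 ≤ n)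
    {m : Pt n → ℂ} (hm : ContDiff ℝ (⊤ : ℕ∞) m) (hms : HasCompactSupport m) :
    ∫ z, paravec hnh (Complex.I * a₀ * m z) (fun j => -pderiv j m z)
      * paravec hnh (-(Complex.I * a₀ * (fundK n a₀ z : ℂ)))
        (fun j => (partialD (fundK n a₀) j z : ℂ)) = m 0 • (1 : Cl h) := by
  have hm1 : ContDiff ℝ 1 m := hm.of_le (by simp)
  have hmj : ∀ j, ContDiff ℝ (⊤ : ℕ∞) (pderiv j m) := contDiff_pderiv hm
  have hmjs := hasCompactSupport_pderiv (n := n) hms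
  have i1 : Integrable (fun z => fundK n a₀ z • m z) :=
    (hp.locallyIntegrable_fundK hn).integrable_smul_right_of_hasCompactSupport hm.continuous hms
  have i2 : ∀ j, Integrable (fun z => fundK n a₀ z • pderiv j m z) := fun j =>
    (hp.locallyIntegrable_fundK hn).integrable_smul_right_of_hasCompactSupport (hmj j).continuous
      (hmjs j)
  have i3 : ∀ j, Integrable (fun z => partialD (fundK n a₀) j z • m z) := fun j =>
    (hp.locallyIntegrable_partialD hn j).integrable_smul_right_of_hasCompactSupport hm.continuous hms
  have i4 : ∀ j l, Integrable (fun z => partialD (fundK n a₀) l z • pderiv j m z) := fun j l =>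
    (hp.locallyIntegrable_partialD hn l).integrable_smul_right_of_hasCompactSupport
      (hmj j).continuous (hmjs j)
  set c : Fin n → Fin n → ℂ := fun j l => ∫ z, partialD (fundK n a₀) l z • pderiv j m z with hc
  have hsymm : ∀ j l, c j l = c l j := by
    intro j l
    have e : ∀ j l, c j l = -∫ z, fundK n a₀ z • pderiv l (pderiv j m) z := fun j l => by
      rw [hp.integral_fundK_smul_pderiv hn ((hmj j).of_le (by simp)) (hmjs j) l, neg_neg]
    rw [e, e]
    simp only [pderiv_pderiv_comm hm j l]
  have hpt : ∀ z, paravec hnh (Complex.I * a₀ * m z) (fun j => -pderiv j m z)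
      * paravec hnh (-(Complex.I * a₀ * (fundK n a₀ z : ℂ)))
        (fun j => (partialD (fundK n a₀) j z : ℂ))
      = paravec hnh ((a₀ : ℂ) ^ 2 * (fundK n a₀ z • m z)) (fun j => Complex.I * a₀ *
          (partialD (fundK n a₀) j z • m z + fundK n a₀ z • pderiv j m z))
        + ∑ j, ∑ l, (-(partialD (fundK n a₀) l z • pderiv j m z)) • (clE hnh j * clE hnh l) := by
    intro z
    rw [paravec_mul_paravec]
    simp only [Complex.real_smul]
    congr 1
    · congr 1
      · linear_combination (-(a₀ : ℂ) ^ 2 * m z * (fundK n a₀ z : ℂ)) * Complex.I_sq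
      · funext j; ring
    · refine Finset.sum_congr rfl fun j _ => Finset.sum_congr rfl fun l _ => ?_
      congr 1; ring
  simp only [hpt]
  have j1 : ∀ j, Integrable (fun z => Complex.I * a₀ *
      (partialD (fundK n a₀) j z • m z + fundK n a₀ z • pderiv j m z)) := fun j =>
    ((i3 j).add (i2 j)).const_mul _
  have j0 : Integrable (fun z => (a₀ : ℂ) ^ 2 * (fundK n a₀ z • m z)) := i1.const_mul _
  have j2 : ∀ j l, Integrable (fun z => (-(partialD (fundK n a₀) l z • pderiv j m z)) •
      (clE hnh j * clE hnh l)) := fun j l => (i4 j l).neg.smul_const _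
  have j3 : Integrable (fun z => paravec hnh ((a₀ : ℂ) ^ 2 * (fundK n a₀ z • m z)) (fun j =>
      Complex.I * a₀ * (partialD (fundK n a₀) j z • m z + fundK n a₀ z • pderiv j m z))) :=
    (j0.smul_const _).add (integrable_finsetSum _ fun j _ => (j1 j).smul_const _)
  rw [integral_add j3 (integrable_finsetSum _ fun j _ => integrable_finsetSum _ fun l _ => j2 j l),
    integral_paravec hnh j0 j1,
    integral_finsetSum _ fun j _ => integrable_finsetSum _ fun l _ => j2 j l]
  have e1 : ∀ j, ∫ z, Complex.I * a₀ * (partialD (fundK n a₀) j z • m z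
      + fundK n a₀ z • pderiv j m z) = 0 := fun j => by
    rw [integral_const_mul, integral_add (i3 j) (i2 j), hp.integral_fundK_smul_pderiv hn hm1 hms j]
    simp
  have e2 : ∀ j, ∫ z, ∑ l, (-(partialD (fundK n a₀) l z • pderiv j m z)) •
      (clE hnh j * clE hnh l) = ∑ l, (-c j l) • (clE hnh j * clE hnh l) := fun j => by
    rw [integral_finsetSum _ fun l _ => j2 j l]
    refine Finset.sum_congr rfl fun l _ => ?_
    rw [integral_smul_const, integral_neg]
  have e3 := hp.integral_fundamental hn hm1 hms
  have i5 : Integrable (fun z => (a₀ ^ 2 * fundK n a₀ z) • m z) := by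
    simp only [mul_smul]; exact i1.smul (a₀ ^ 2)
  rw [integral_add (integrable_finsetSum _ fun j _ => i4 j j) i5,
    integral_finsetSum _ fun j _ => i4 j j] at e3
  simp only [e1, e2]
  rw [sum_sum_smul_clE_mul hnh (c := fun j l => -c j l) (fun j l => by rw [hsymm]), ← e3]
  simp only [paravec, zero_smul, Finset.sum_const_zero, add_zero, Finset.sum_neg_distrib, neg_neg,
    add_smul]
  rw [add_comm]
  congr 2
  refine integral_congr_ae (Eventually.of_forall fun z => ?_)
  simp only [Complex.real_smul]; push_cast; ring

/-- `e_{ia}` is a fundamental solution of the disturbed Dirac operator. -/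
theorem IsRadialProfile.integral_dirac_eKernel (hp : IsRadialProfile n a₀ k q C) (hn : 1 ≤ n)
    {φ : Pt n → ℝ} (hφ : ContDiff ℝ (⊤ : ℕ∞) φ) (hφs : HasCompactSupport φ) (y : Pt n) :
    ∫ x, (-(∑ j, ((partialD φ j x : ℝ) : ℂ) • clE hnh j) + (φ x : ℂ) • iParavector hnh a₀ a)
      * eKernel hnh a₀ a (x - y) = (φ y : ℂ) • (1 : Cl h) := by
  rw [← integral_add_right_eq_self _ y]
  -- Multiplying by the plane wave absorbs the vector part of ia: -∂_jφ + i a_j φ becomes -∂_j m up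
  -- to the wave. This reduces the claim to the case without it.
  set m : Pt n → ℂ := fun z => (φ (z + y) : ℂ) * phase a z with hm
  have hφy : ContDiff ℝ (⊤ : ℕ∞) (fun z : Pt n => (φ (z + y) : ℂ)) :=
    Complex.ofRealCLM.contDiff.comp (hφ.comp (contDiff_id.add contDiff_const))
  have hmc : ContDiff ℝ (⊤ : ℕ∞) m := hφy.mul (contDiff_phase a)
  have hφys : HasCompactSupport (fun z : Pt n => (φ (z + y) : ℂ)) :=
    (hφs.comp_homeomorph (Homeomorph.addRight y)).comp_left (g := fun t : ℝ => (t : ℂ)) (by simp)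
  have hms : HasCompactSupport m := hφys.mul_right
  have hpd : ∀ z j, pderiv j m z = ((partialD φ j (z + y) : ℝ) : ℂ) * phase a z
      - Complex.I * (a j : ℂ) * m z := by
    intro z j
    rw [hm, pderiv_mul (hφy.differentiable (by simp) z) ((contDiff_phase a).differentiable (by simp) z),
      pderiv_phase]
    have : pderiv j (fun z : Pt n => (φ (z + y) : ℂ)) z = ((partialD φ j (z + y) : ℝ) : ℂ) := by
      have h1 : HasFDerivAt (fun z : Pt n => φ (z + y)) (fderiv ℝ φ (z + y)) z := by
        have := (hφ.differentiable (by simp) (z + y)).hasFDerivAt.comp z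
          ((hasFDerivAt_id z).add_const y)
        simpa using! this
      have h2 := Complex.ofRealCLM.hasFDerivAt.comp z h1
      rw [pderiv, show (fun z : Pt n => (φ (z + y) : ℂ)) = Complex.ofRealCLM ∘ fun z => φ (z + y)
        from rfl, h2.fderiv]
      rfl
    rw [this]; ring
  have hpt : ∀ z, (-(∑ j, ((partialD φ j (z + y) : ℝ) : ℂ) • clE hnh j)
      + (φ (z + y) : ℂ) • iParavector hnh a₀ a) * eKernel hnh a₀ a (z + y - y)
      = paravec hnh (Complex.I * a₀ * m z) (fun j => -pderiv j m z)
      * paravec hnh (-(Complex.I * a₀ * (fundK n a₀ z : ℂ)))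
        (fun j => (partialD (fundK n a₀) j z : ℂ)) := by
    intro z
    rw [add_sub_cancel_right, eKernel_eq, cl_mul_smul, ← cl_smul_mul]
    congr 1
    simp only [hpd]
    simp only [hm, iParavector, paravec, smul_add, smul_neg, Finset.smul_sum, smul_smul]
    rw [add_left_comm, ← Finset.sum_neg_distrib, ← Finset.sum_add_distrib]
    congr 1
    · congr 1; ring
    · refine Finset.sum_congr rfl fun j _ => ?_
      rw [← neg_smul, ← add_smul]
      congr 1; ring
  simp only [hpt]
  rw [hp.integral_paravec_mul hnh hn hmc hms]
  simp [hm, phase]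

end KernelCalculus

/-! ### Values of functions in the closed span. -/

section ParavectorValued

variable {n h : ℕ} (hnh : n ≤ h) (a₀ : ℝ) (a : Pt n)

/-- The projection onto the paravectors. -/
def paravecProj : Cl h →L[ℂ] Cl h :=
  LinearMap.toContinuousLinearMap
    { toFun := fun c => paravec hnh (c ∅) (fun j => c {Fin.castLE hnh j})
      map_add' := fun u v => by
        simp only [paravec, PiLp.add_apply, add_smul, Finset.sum_add_distrib]; abel
      map_smul' := fun r u => by
        simp only [PiLp.smul_apply, smul_eq_mul, RingHom.id_apply, paravec_smul] }

theorem paravecProj_apply (c : Cl h) :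
    paravecProj hnh c = paravec hnh (c ∅) (fun j => c {Fin.castLE hnh j}) := rfl

theorem paravecProj_diracField (φ : Pt n → ℂ) (x : Pt n) :
    paravecProj hnh (diracField hnh a₀ a φ x) = diracField hnh a₀ a φ x := by
  rw [diracField, map_smul, paravecProj_apply]
  simp only [paravec_apply_empty, paravec_apply_singleton]

/-- Being paravector valued means lying in the kernel of the continuous map `Λ`, a closed subspace
that contains all generating fields. -/
theorem ae_eq_paravec_of_mem_diracSpace {w : L2Full n h} (hw : w ∈ diracSpace hnh a₀ a) :
    ∀ᵐ x, w x = paravec hnh (w x ∅) (fun j => w x {Fin.castLE hnh j}) := by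
  set Λ : L2Full n h →L[ℂ] L2Full n h := (paravecProj hnh).compLpL 2 volume - .id ℂ _ with hΛ
  have hle : diracSpace hnh a₀ a ≤ Λ.ker := by
    refine Submodule.topologicalClosure_minimal _ (Submodule.span_le.2 ?_) Λ.isClosed_ker
    rintro w ⟨φ, hφ, hφs, rfl⟩
    have : (paravecProj hnh).compLpL 2 volume (diracFieldLp hnh a₀ a hφ hφs)
        = diracFieldLp hnh a₀ a hφ hφs := by
      refine Lp.ext ?_
      filter_upwards [(paravecProj hnh).coeFn_compLpL (diracFieldLp hnh a₀ a hφ hφs),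
        diracFieldLp_ae_eq hnh a₀ a hφ hφs] with x h1 h2
      rw [h1, h2, paravecProj_diracField]
    simp [hΛ, this]
  have h1 : (paravecProj hnh).compLpL 2 volume w = w := by
    have := hle hw
    simpa [hΛ, sub_eq_zero] using this
  have h2 := (paravecProj hnh).coeFn_compLpL w
  rw [h1] at h2
  filter_upwards [h2] with x hx
  rw [← paravecProj_apply, ← hx]

end ParavectorValued

/-! ### Test functions and the transposed Dirac operator. -/

section TestFunctions

variable {n h : ℕ} (hnh : n ≤ h) (a₀ : ℝ) (a : Pt n)

theorem integral_mul_pderiv {f g : Pt n → ℂ} (hf : ContDiff ℝ (⊤ : ℕ∞) f)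
    (hfs : HasCompactSupport f) (hg : ContDiff ℝ (⊤ : ℕ∞) g) (j : Fin n) :
    ∫ x, f x * pderiv j g x = -∫ x, pderiv j f x * g x := by
  have hfj := (contDiff_pderiv hf j).continuous
  have hgj := (contDiff_pderiv hg j).continuous
  exact integral_mul_fderiv_eq_neg_fderiv_mul_of_integrable (μ := volume)
    (f := f) (g := g) (v := EuclideanSpace.single j 1)
    ((hfj.mul hg.continuous).integrable_of_hasCompactSupport (hasCompactSupport_pderiv hfs j).mul_right)
    ((hf.continuous.mul hgj).integrable_of_hasCompactSupport hfs.mul_right)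
    ((hf.continuous.mul hg.continuous).integrable_of_hasCompactSupport hfs.mul_right)
    (fun x _ => hf.differentiable (by simp) x) (fun x _ => hg.differentiable (by simp) x)

theorem partialD_eq_zero_of_notMem_tsupport {φ : Pt n → ℝ} {x : Pt n} (hx : x ∉ tsupport φ)
    (j : Fin n) : partialD φ j x = 0 := by
  have h2 : fderiv ℝ φ x = 0 :=
    image_eq_zero_of_notMem_tsupport fun hmem => hx (tsupport_fderiv_subset ℝ hmem)
  simp [partialD, h2]

theorem pderiv_ofReal {φ : Pt n → ℝ} {x : Pt n} (hφ : DifferentiableAt ℝ φ x) (j : Fin n) :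
    pderiv j (fun y => (φ y : ℂ)) x = (partialD φ j x : ℂ) := by
  have h2 := Complex.ofRealCLM.hasFDerivAt.comp x hφ.hasFDerivAt
  rw [pderiv, show (fun z : Pt n => (φ z : ℂ)) = Complex.ofRealCLM ∘ φ from rfl, h2.fderiv]
  rfl

theorem contDiff_ofReal_comp {φ : Pt n → ℝ} (hφ : ContDiff ℝ (⊤ : ℕ∞) φ) :
    ContDiff ℝ (⊤ : ℕ∞) (fun x => (φ x : ℂ)) :=
  Complex.ofRealCLM.contDiff.comp hφ

theorem hasCompactSupport_ofReal_comp {φ : Pt n → ℝ} (hφ : HasCompactSupport φ) :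
    HasCompactSupport (fun x => (φ x : ℂ)) :=
  hφ.comp_left (g := fun t : ℝ => (t : ℂ)) (by simp)

/-- The element `φ c` of `L²` for a test function `φ` and a constant `c`. -/
def smulConstLp {φ : Pt n → ℝ} (hφ : Continuous φ) (hφs : HasCompactSupport φ) (c : Cl h) :
    L2Full n h :=
  ((Complex.continuous_ofReal.comp hφ).smul (continuous_const (y := c))
    |>.memLp_of_hasCompactSupport (hasCompactSupport_ofReal_comp hφs).smul_right).toLp
    (fun x => (φ x : ℂ) • c)

theorem inner_smulConstLp {φ : Pt n → ℝ} (hφ : Continuous φ) (hφs : HasCompactSupport φ) (c : Cl h)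
    {w : L2Full n h} {g : Pt n → Cl h} (hw : w =ᵐ[volume] g) :
    inner ℂ (smulConstLp hφ hφs c) w = ∫ x, (φ x : ℂ) * inner ℂ c (g x) := by
  rw [L2.inner_def]
  refine integral_congr_ae ?_
  have : smulConstLp hφ hφs c =ᵐ[volume] fun x => (φ x : ℂ) • c := MemLp.coeFn_toLp _
  filter_upwards [this, hw] with x h1 h2
  rw [h1, h2, inner_smul_left, Complex.conj_ofReal]

/-- The symbol of the transposed operator `-∑_j ∂_jφ e_j + i φ a`. -/
def diracTest (φ : Pt n → ℝ) (x : Pt n) : Cl h :=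
  -(∑ j, ((partialD φ j x : ℝ) : ℂ) • clE hnh j) + (φ x : ℂ) • iParavector hnh a₀ a

theorem diracTest_mul (φ : Pt n → ℝ) (x : Pt n) (c : Cl h) :
    diracTest hnh a₀ a φ x * c = -(∑ j, ((partialD φ j x : ℝ) : ℂ) • (clE hnh j * c))
      + (φ x : ℂ) • (iParavector hnh a₀ a * c) := by
  rw [diracTest, add_mul, neg_mul, Finset.sum_mul, cl_smul_mul]
  simp only [cl_smul_mul]

theorem diracTest_eq_paravec (φ : Pt n → ℝ) (x : Pt n) :
    diracTest hnh a₀ a φ x = paravec hnh (Complex.I * a₀ * φ x)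
      (fun j => -(partialD φ j x : ℂ) + Complex.I * a j * φ x) := by
  simp only [diracTest, iParavector, paravec, smul_add, Finset.smul_sum, smul_smul, add_smul,
    Finset.sum_add_distrib, neg_smul, Finset.sum_neg_distrib]
  rw [add_left_comm]
  congr 1
  · congr 1; ring
  · congr 1
    refine Finset.sum_congr rfl fun j _ => ?_
    congr 1; ring

theorem diracTest_eq_zero {φ : Pt n → ℝ} {x : Pt n} (hx : x ∉ tsupport φ) :
    diracTest hnh a₀ a φ x = 0 := by
  rw [diracTest_eq_paravec]
  simp [partialD_eq_zero_of_notMem_tsupport hx, image_eq_zero_of_notMem_tsupport hx, paravec]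

theorem continuous_partialD {φ : Pt n → ℝ} (hφ : ContDiff ℝ (⊤ : ℕ∞) φ) (j : Fin n) :
    Continuous (partialD φ j) := by
  rw [partialD_eq_pderiv]; exact continuous_pderiv (hφ.of_le (by simp)) j

theorem continuous_diracTest {φ : Pt n → ℝ} (hφ : ContDiff ℝ (⊤ : ℕ∞) φ) :
    Continuous (diracTest (h := h) hnh a₀ a φ) := by
  have e : diracTest (h := h) hnh a₀ a φ = fun x => paravec hnh (Complex.I * a₀ * φ x)
      (fun j => -(partialD φ j x : ℂ) + Complex.I * a j * φ x) :=
    funext (diracTest_eq_paravec hnh a₀ a φ)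
  have h1 := Complex.continuous_ofReal.comp hφ.continuous
  rw [e]
  exact continuous_paravec hnh (continuous_const.mul h1) fun j =>
    (Complex.continuous_ofReal.comp (continuous_partialD hφ j)).neg.add (continuous_const.mul h1)

theorem hasCompactSupport_diracTest {φ : Pt n → ℝ} (hφ : HasCompactSupport φ) :
    HasCompactSupport (diracTest (h := h) hnh a₀ a φ) :=
  HasCompactSupport.intro hφ fun _ hx => diracTest_eq_zero hnh a₀ a hx

variable {hnh a₀ a} in
theorem isWeakDirac_of_integral_eq {Ω : Set (Pt n)} {u w : Pt n → Cl h} (hu : LocallyIntegrable u)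
    (hw : LocallyIntegrable w)
    (huw : ∀ φ : Pt n → ℝ, ContDiff ℝ (⊤ : ℕ∞) φ → HasCompactSupport φ → tsupport φ ⊆ Ω →
      ∫ x, (φ x : ℂ) • w x = ∫ x, diracTest hnh a₀ a φ x * u x) :
    IsWeakDirac hnh Ω a₀ a u w where
  locallyIntegrable_left := hu.locallyIntegrableOn Ω
  locallyIntegrable_right := hw.locallyIntegrableOn Ω
  integral_eq φ hφ hφs hφΩ := by
    simp only [← diracTest_mul]
    rw [setIntegral_eq_integral_of_forall_compl_eq_zero,
      setIntegral_eq_integral_of_forall_compl_eq_zero, huw φ hφ hφs hφΩ]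
    · intro x hx
      rw [diracTest_eq_zero hnh a₀ a fun hx' => hx (hφΩ hx'), zero_mul]
    · intro x hx
      rw [image_eq_zero_of_notMem_tsupport fun hx' => hx (hφΩ hx')]; simp

theorem scalarPart_integral {f : Pt n → Cl h} (hf : Integrable f) :
    ∫ x, scalarPart (f x) = scalarPart (∫ x, f x) :=
  (EuclideanSpace.proj (𝕜 := ℂ) (∅ : Finset (Fin h))).integral_comp_comm hf

theorem locallyIntegrable_apply {f : Pt n → Cl h} (hf : LocallyIntegrable f) (I : Finset (Fin h)) :
    LocallyIntegrable (fun x => f x I) :=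
  hf.mono ((EuclideanSpace.proj (𝕜 := ℂ) I).continuous.comp_aestronglyMeasurable
    hf.aestronglyMeasurable) (Eventually.of_forall fun x => PiLp.norm_apply_le (f x) I)

theorem locallyIntegrable_projP {f : Pt n → Cl h} (hf : LocallyIntegrable f) :
    LocallyIntegrable (fun x => projP (f x)) := by
  have h1 := locallyIntegrable_apply hf ∅
  have hone : ‖(1 : Cl h)‖ = 1 := by
    have : (1 : Cl h) = EuclideanSpace.single ∅ 1 := rfl
    rw [this]; simp
  refine h1.mono (h1.aestronglyMeasurable.smul_const (1 : Cl h)) (Eventually.of_forall fun x => ?_)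
  rw [projP, norm_smul, hone, mul_one]; rfl

theorem mul_projP (b c : Cl h) : b * projP c = scalarPart c • b := by
  rw [projP, cl_mul_smul, mul_one]

end TestFunctions

/-! ### The projection as D_{ia}𝒫T_{ia} on the whole space. -/

section WeakIdentities

variable {n h : ℕ} (hnh : n ≤ h) {a₀ : ℝ} {k q : ℝ → ℝ} {C : ℝ} (a : Pt n)
  {u : Pt n → Cl h} {r : ℝ} {uL : L2Full n h}

/-- The potential of f is K * f. The projection formula produces the pairing of its field with u;
the transposed kernel and Fubini move the convolution from f to u. -/
theorem IsRadialProfile.inner_starProjection_eq_integral (hp : IsRadialProfile n a₀ k q C)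
    (hn : 1 ≤ n) (hu : Integrable u) (hur : ∀ y, r < ‖y‖ → u y = 0) (huL : uL =ᵐ[volume] u)
    {f : Pt n → ℂ} (hf : ContDiff ℝ (⊤ : ℕ∞) f) (hfs : HasCompactSupport f) {D R : ℝ} (hD : 0 ≤ D)
    (hdecay : ∀ x : Pt n, R ≤ ‖x‖ → ‖smulConv (fundK n a₀) f x‖ ≤ D / ‖x‖ ^ (n - 1))
    (ξ : L2Full n h)
    (hξ : ∀ (φ : Pt n → ℂ) (hφ : ContDiff ℝ (⊤ : ℕ∞) φ) (hφs : HasCompactSupport φ),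
      inner ℂ ξ (diracFieldLp hnh a₀ a hφ hφs) = ∫ x, (starRingEnd ℂ) (f x) * φ x) :
    inner ℂ ξ ((diracSpace hnh a₀ a).starProjection uL)
      = ∫ x, (starRingEnd ℂ) (f x) * (starRingEnd ℂ) (phase a x) *
          scalarPart (∫ y, eKernel hnh a₀ a (x - y) * u y) := by
  have hv : ∀ᵐ x : Pt n, r < ‖x‖ → uL x = 0 := by
    filter_upwards [huL] with x hx hr
    rw [hx, hur x hr]
  rw [inner_starProjection_diracSpace hnh a₀ a hn
    (contDiff_smulConv (hp.locallyIntegrable_fundK hn) hf hfs)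
    (hp.helmholtz_smulConv hn hf hfs) hf.continuous hfs hD hdecay ξ hξ uL hv]
  have hE := hp.locallyIntegrable_eKernel (h := h) hnh a hn
  set A : Pt n → Cl h := fun x =>
    ((starRingEnd ℂ) (f x) * (starRingEnd ℂ) (phase a x)) • (1 : Cl h) with hA
  have hAc : Continuous A :=
    ((contDiff_conj hf).continuous.mul (contDiff_conj (contDiff_phase a)).continuous).smul
      continuous_const
  have hAs : HasCompactSupport A := (hasCompactSupport_conj hfs).mul_right.smul_right
  obtain ⟨h1, h2⟩ := integral_mul_kernel_mul hE hu hur hAc hAs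
  have h3 : ∫ y, inner ℂ (diracField hnh a₀ a (smulConv (fundK n a₀) f) y) (uL y)
      = ∫ y, scalarPart ((∫ x, A x * eKernel hnh a₀ a (x - y)) * u y) := by
    refine integral_congr_ae ?_
    filter_upwards [huL] with y hy
    rw [hy, hp.scalarPart_integral_eKernel hnh a hn hf hfs]
  rw [h3, scalarPart_integral h1, ← h2, ← scalarPart_integral
    (integrable_mul_of_locallyIntegrable hAc hAs (locallyIntegrable_kernel_mul hE hu hur))]
  refine integral_congr_ae (Eventually.of_forall fun x => ?_)
  simp only [hA]
  rw [cl_smul_mul, one_mul, scalarPart_smul]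

theorem IsRadialProfile.integral_mul_starProjection_singleton (hp : IsRadialProfile n a₀ k q C)
    (hn : 1 ≤ n) (hu : Integrable u) (hur : ∀ y, r < ‖y‖ → u y = 0) (huL : uL =ᵐ[volume] u)
    {φ : Pt n → ℝ} (hφ : ContDiff ℝ (⊤ : ℕ∞) φ) (hφs : HasCompactSupport φ) (j : Fin n) :
    ∫ x, (φ x : ℂ) * (diracSpace hnh a₀ a).starProjection uL x {Fin.castLE hnh j}
      = ∫ x, (-(partialD φ j x : ℂ) + Complex.I * a j * φ x) *
          scalarPart (∫ y, eKernel hnh a₀ a (x - y) * u y) := by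
  set Φ : Pt n → ℂ := fun x => (φ x : ℂ) * phase a x with hΦ
  have hΦc : ContDiff ℝ (⊤ : ℕ∞) Φ := (contDiff_ofReal_comp hφ).mul (contDiff_phase a)
  have hΦs : HasCompactSupport Φ := (hasCompactSupport_ofReal_comp hφs).mul_right
  -- The function g is chosen so that f = ∂_j g satisfies ⟨φ e_j, field of ψ⟩ = ∫ φ e^{-i⟨a,x⟩} ∂_jψ
  -- = ∫ f̄ψ.
  set g : Pt n → ℂ := fun x => -(starRingEnd ℂ) (Φ x) with hg
  have hgc : ContDiff ℝ (⊤ : ℕ∞) g := (contDiff_conj hΦc).neg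
  have hgs : HasCompactSupport g := (hasCompactSupport_conj hΦs).neg
  have hgj : ∀ x, pderiv j g x = -(starRingEnd ℂ) (pderiv j Φ x) := fun x => by
    have : g = -fun x => (starRingEnd ℂ) (Φ x) := rfl
    rw [← pderiv_conj, pderiv, this, fderiv_neg]; rfl
  have hΦj : ∀ x, pderiv j Φ x = (partialD φ j x : ℂ) * phase a x
      + φ x * (-Complex.I * (a j : ℂ) * phase a x) := fun x => by
    rw [hΦ, pderiv_mul ((contDiff_ofReal_comp hφ).differentiable (by simp) x)
      ((contDiff_phase a).differentiable (by simp) x), pderiv_phase,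
      pderiv_ofReal (hφ.differentiable (by simp) x)]
    ring
  -- Since K * ∂_j g = ∂_jK * g, the potential inherits the decay of ∂_jK.
  obtain ⟨D, R, hD, -, hdecay⟩ := exists_decay_smulConv hp.nonneg
    (fun x hx => hp.abs_partialD_le j hx) hgc.continuous hgs
  rw [← hp.smulConv_pderiv hn (hgc.of_le (by simp)) hgs j] at hdecay
  have h1 := hp.inner_starProjection_eq_integral hnh a hn hu hur huL (contDiff_pderiv hgc j)
    (hasCompactSupport_pderiv hgs j) hD hdecay (smulConstLp hφ.continuous hφs (clE hnh j)) ?_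
  · rw [inner_smulConstLp hφ.continuous hφs _ (ae_eq_refl _)] at h1
    simp only [inner_clE] at h1
    rw [h1]
    refine integral_congr_ae (Eventually.of_forall fun x => ?_)
    have h2 := phase_mul_conj a x
    simp only [hgj, hΦj, map_neg, Complex.conj_conj]
    linear_combination (-(partialD φ j x : ℂ) + Complex.I * a j * φ x) *
          scalarPart (∫ y, eKernel hnh a₀ a (x - y) * u y) * h2
  · intro ψ hψ hψs
    rw [inner_smulConstLp hφ.continuous hφs _ (diracFieldLp_ae_eq hnh a₀ a hψ hψs)]
    simp only [hgj, map_neg, Complex.conj_conj, neg_mul]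
    rw [integral_neg, ← integral_mul_pderiv hΦc hΦs hψ]
    refine integral_congr_ae (Eventually.of_forall fun x => ?_)
    simp only [inner_clE, diracField, PiLp.smul_apply, paravec_apply_singleton, smul_eq_mul, hΦ]
    ring

theorem IsRadialProfile.integral_mul_starProjection_empty (hp : IsRadialProfile n a₀ k q C)
    (hn : 1 ≤ n) (hu : Integrable u) (hur : ∀ y, r < ‖y‖ → u y = 0) (huL : uL =ᵐ[volume] u)
    {φ : Pt n → ℝ} (hφ : ContDiff ℝ (⊤ : ℕ∞) φ) (hφs : HasCompactSupport φ) :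
    ∫ x, (φ x : ℂ) * (diracSpace hnh a₀ a).starProjection uL x ∅
      = ∫ x, Complex.I * a₀ * φ x *
          scalarPart (∫ y, eKernel hnh a₀ a (x - y) * u y) := by
  set Φ : Pt n → ℂ := fun x => (φ x : ℂ) * phase a x with hΦ
  have hΦc : ContDiff ℝ (⊤ : ℕ∞) Φ := (contDiff_ofReal_comp hφ).mul (contDiff_phase a)
  have hΦs : HasCompactSupport Φ := (hasCompactSupport_ofReal_comp hφs).mul_right
  -- Here ⟨φ, field of ψ⟩ = ∫ i a₀ φ e^{-i⟨a,x⟩} ψ, which forces f = a₀ g with this g. The factor a₀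
  -- is then moved onto the kernel, because a₀K has the required decay also when a₀ = 0.
  set g : Pt n → ℂ := fun x => -Complex.I * (starRingEnd ℂ) (Φ x) with hg
  have hgc : ContDiff ℝ (⊤ : ℕ∞) g := contDiff_const.mul (contDiff_conj hΦc)
  have hgs : HasCompactSupport g := (hasCompactSupport_conj hΦs).mul_left
  set f : Pt n → ℂ := fun x => a₀ • g x with hf
  have hfc : ContDiff ℝ (⊤ : ℕ∞) f := (contDiff_const (c := a₀)).smul hgc
  have hfs : HasCompactSupport f := hgs.smul_left (f := fun _ => a₀)
  obtain ⟨D, R, hD, -, hdecay⟩ := exists_decay_smulConv (κ := fun x => a₀ * fundK n a₀ x) hp.nonneg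
    (fun x hx => hp.abs_mul_fundK_le hx) hgc.continuous hgs
  have e : smulConv (fun x => a₀ * fundK n a₀ x) g = smulConv (fundK n a₀) f := by
    funext x
    rw [smulConv_apply, smulConv_apply]
    refine integral_congr_ae (Eventually.of_forall fun y => ?_)
    simp only [hf, smul_smul, mul_comm]
  rw [e] at hdecay
  have h1 := hp.inner_starProjection_eq_integral hnh a hn hu hur huL hfc hfs hD hdecay
    (smulConstLp hφ.continuous hφs 1) ?_
  · rw [inner_smulConstLp hφ.continuous hφs _ (ae_eq_refl _)] at h1
    simp only [inner_one_cl] at h1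
    rw [h1]
    refine integral_congr_ae (Eventually.of_forall fun x => ?_)
    have h2 := phase_mul_conj a x
    simp only [hf, hg, hΦ, Complex.real_smul, map_mul, map_neg, Complex.conj_conj, Complex.conj_I,
      Complex.conj_ofReal, neg_neg]
    linear_combination (Complex.I * a₀ * φ x) *
          scalarPart (∫ y, eKernel hnh a₀ a (x - y) * u y) * h2
  · intro ψ hψ hψs
    rw [inner_smulConstLp hφ.continuous hφs _ (diracFieldLp_ae_eq hnh a₀ a hψ hψs)]
    refine integral_congr_ae (Eventually.of_forall fun x => ?_)
    simp only [inner_one_cl, diracField, PiLp.smul_apply, paravec_apply_empty, smul_eq_mul, hf, hg, hΦ,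
      Complex.real_smul, map_mul, map_neg, Complex.conj_conj, Complex.conj_I, Complex.conj_ofReal,
      neg_neg]
    ring

variable {a}

theorem locallyIntegrable_coeFn (w : L2Full n h) : LocallyIntegrable w :=
  (Lp.memLp w).locallyIntegrable (by norm_num)

/-- Both integrands are paravector valued, the left one by `ae_eq_paravec_of_mem_diracSpace`, the
right one because 𝒫 leaves a scalar factor. Hence the scalar and e_j coordinates decide. -/
theorem IsRadialProfile.integral_smul_starProjection (hp : IsRadialProfile n a₀ k q C)
    (hn : 1 ≤ n) (hu : Integrable u) (hur : ∀ y, r < ‖y‖ → u y = 0) (huL : uL =ᵐ[volume] u)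
    {φ : Pt n → ℝ} (hφ : ContDiff ℝ (⊤ : ℕ∞) φ) (hφs : HasCompactSupport φ) :
    ∫ x, (φ x : ℂ) • (diracSpace hnh a₀ a).starProjection uL x
      = ∫ x, diracTest hnh a₀ a φ x * projP (∫ y, eKernel hnh a₀ a (x - y) * u y) := by
  set w := (diracSpace hnh a₀ a).starProjection uL with hw
  set s : Pt n → ℂ := fun x => scalarPart (∫ y, eKernel hnh a₀ a (x - y) * u y) with hs
  have hsl : LocallyIntegrable s := locallyIntegrable_apply
    (locallyIntegrable_kernel_mul (hp.locallyIntegrable_eKernel (h := h) hnh a hn) hu hur) ∅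
  have hφc := (contDiff_ofReal_comp hφ).continuous
  have hφcs := hasCompactSupport_ofReal_comp hφs
  have hwI : ∀ I, Integrable (fun x => (φ x : ℂ) * w x I) := fun I =>
    (locallyIntegrable_apply (locallyIntegrable_coeFn w) I).integrable_smul_left_of_hasCompactSupport
      hφc hφcs
  have h1 : ∫ x, (φ x : ℂ) • w x = ∫ x, paravec hnh ((φ x : ℂ) * w x ∅)
      (fun j => (φ x : ℂ) * w x {Fin.castLE hnh j}) := by
    refine integral_congr_ae ?_
    filter_upwards [ae_eq_paravec_of_mem_diracSpace hnh a₀ a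
      (Submodule.starProjection_apply_mem (diracSpace hnh a₀ a) uL)] with x hx
    rw [← paravec_smul, ← hx]
  have hpt : ∀ x, diracTest hnh a₀ a φ x * projP (∫ y, eKernel hnh a₀ a (x - y) * u y)
      = paravec hnh (Complex.I * a₀ * φ x * s x)
        (fun j => (-(partialD φ j x : ℂ) + Complex.I * a j * φ x) * s x) := by
    intro x
    rw [mul_projP, diracTest_eq_paravec, paravec_smul]
    simp only [hs, mul_comm]
  have k0 : Integrable (fun x => Complex.I * a₀ * φ x * s x) :=
    hsl.integrable_smul_left_of_hasCompactSupport (continuous_const.mul hφc) hφcs.mul_left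
  have kj : ∀ j, Integrable (fun x => (-(partialD φ j x : ℂ) + Complex.I * a j * φ x) * s x) :=
    fun j => hsl.integrable_smul_left_of_hasCompactSupport
      ((Complex.continuous_ofReal.comp (continuous_partialD hφ j)).neg.add
        (continuous_const.mul hφc))
      (HasCompactSupport.intro hφs fun x hx => by
        simp [partialD_eq_zero_of_notMem_tsupport hx, image_eq_zero_of_notMem_tsupport hx])
  simp only [hpt]
  rw [h1, integral_paravec hnh (hwI ∅) fun j => hwI _, integral_paravec hnh k0 kj,
    hp.integral_mul_starProjection_empty hnh a hn hu hur huL hφ hφs]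
  simp only [hw, hp.integral_mul_starProjection_singleton hnh a hn hu hur huL hφ hφs, hs]

/-- The orthogonal projection onto `diracSpace` is `D_{ia} 𝒫 T_{ia}` on the whole space. -/
theorem IsRadialProfile.isWeakDirac_projP (hp : IsRadialProfile n a₀ k q C)
    (hn : 1 ≤ n) (hu : Integrable u) (hur : ∀ y, r < ‖y‖ → u y = 0) (huL : uL =ᵐ[volume] u)
    (Ω : Set (Pt n)) :
    IsWeakDirac hnh Ω a₀ a (fun x => projP (∫ y, eKernel hnh a₀ a (x - y) * u y))
      ((diracSpace hnh a₀ a).starProjection uL) :=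
  isWeakDirac_of_integral_eq
    (locallyIntegrable_projP (locallyIntegrable_kernel_mul
      (hp.locallyIntegrable_eKernel (h := h) hnh a hn) hu hur))
    (locallyIntegrable_coeFn _)
    fun _ hφ hφs _ => hp.integral_smul_starProjection hnh hn hu hur huL hφ hφs

/-- Where `u` vanishes, `D_{ia} 𝒬 T_{ia} u = -D_{ia} 𝒫 T_{ia} u`. -/
theorem IsRadialProfile.isWeakDirac_projQ (hp : IsRadialProfile n a₀ k q C)
    (hn : 1 ≤ n) (hu : Integrable u) (hur : ∀ y, r < ‖y‖ → u y = 0) (huL : uL =ᵐ[volume] u)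
    {Ω : Set (Pt n)} (hΩ : ∀ y ∈ Ω, u y = 0) :
    IsWeakDirac hnh Ω a₀ a (fun x => projQ (∫ y, eKernel hnh a₀ a (x - y) * u y))
      (fun x => -(diracSpace hnh a₀ a).starProjection uL x) := by
  have hE := hp.locallyIntegrable_eKernel (h := h) hnh a hn
  have hT := locallyIntegrable_kernel_mul hE hu hur
  refine isWeakDirac_of_integral_eq (hT.sub (locallyIntegrable_projP hT))
    (locallyIntegrable_coeFn _).neg fun φ hφ hφs hφΩ => ?_
  have hA := continuous_diracTest (h := h) hnh a₀ a hφ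
  have hAs := hasCompactSupport_diracTest (h := h) hnh a₀ a hφs
  -- Since e_{ia} is a fundamental solution, Fubini turns this integral into ∫ φu, which vanishes
  -- because φ is supported where u = 0.
  have h0 : ∫ x, diracTest hnh a₀ a φ x * ∫ y, eKernel hnh a₀ a (x - y) * u y = 0 := by
    rw [(integral_mul_kernel_mul hE hu hur hA hAs).2]
    refine integral_eq_zero_of_ae (Eventually.of_forall fun y => ?_)
    simp only [diracTest, hp.integral_dirac_eKernel hnh a hn hφ hφs, Pi.zero_apply]
    by_cases hy : y ∈ Ω
    · rw [hΩ y hy, mul_zero]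
    · rw [image_eq_zero_of_notMem_tsupport fun hy' => hy (hφΩ hy')]; simp
  simp only [projQ, mul_sub, smul_neg]
  rw [integral_neg, integral_sub (integrable_mul_of_locallyIntegrable hA hAs hT)
    (integrable_mul_of_locallyIntegrable hA hAs (locallyIntegrable_projP hT)), h0, zero_sub,
    hp.integral_smul_starProjection hnh hn hu hur huL hφ hφs]

end WeakIdentities

/-! ### The boundary is a null set. -/

section Boundary

variable {n : ℕ}

/-- The translates of the graph along ν are the level sets of one continuous function, so all of
them have the same measure. Only countably many disjoint level sets can have positive measure. -/
theorem volume_setOf_eq_inner_eq_zero {ν : Pt n} (hν : ‖ν‖ = 1)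
    {g : (Submodule.span ℝ {ν})ᗮ → ℝ} (hg : Continuous g) :
    volume {x : Pt n | inner ℝ ν x - g ((Submodule.span ℝ {ν})ᗮ.orthogonalProjectionOnto x) = 0}
      = 0 := by
  set F : Pt n → ℝ := fun x =>
    inner ℝ ν x - g ((Submodule.span ℝ {ν})ᗮ.orthogonalProjectionOnto x) with hF
  have hFc : Continuous F := (continuous_const.inner continuous_id).sub
    (hg.comp (ContinuousLinearMap.continuous _))
  have hshift : ∀ (x : Pt n) (t : ℝ), F (x + t • ν) = F x + t := by
    intro x t
    have h1 : (Submodule.span ℝ {ν})ᗮ.orthogonalProjectionOnto (t • ν) = 0 := by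
      rw [Submodule.orthogonalProjectionOnto_eq_zero_iff]
      exact Submodule.le_orthogonal_orthogonal _
        (Submodule.smul_mem _ _ (Submodule.mem_span_singleton_self ν))
    simp only [hF]
    rw [map_add, h1, add_zero, inner_add_right, inner_smul_right, real_inner_self_eq_norm_sq, hν]
    ring
  have hlevel : ∀ t, volume {x | F x = t} = volume {x | F x = 0} := by
    intro t
    have h1 : {x | F x = t} = (fun x => x + (-t) • ν) ⁻¹' {x | F x = 0} := by
      ext x
      simp only [mem_ofPred_eq, mem_preimage, hshift]
      constructor <;> intro hx <;> linarith
    rw [h1, measure_preimage_add_right]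
  by_contra hne
  have h1 := Measure.countable_meas_level_set_pos (μ := (volume : Measure (Pt n))) hFc.measurable
  have h2 : {t | 0 < volume {x | F x = t}} = univ :=
    eq_univ_of_forall fun t => by rw [mem_ofPred_eq, hlevel]; exact pos_iff_ne_zero.2 hne
  rw [h2] at h1
  exact Cardinal.not_countable_real h1

/-- Within a chart a frontier point lies on the graph: it is a limit of points above it, and it is
not strictly above it because G is open. -/
theorem IsBoundedLipschitzDomain.volume_frontier {G : Set (Pt n)} (hG : IsBoundedLipschitzDomain G) :
    volume (frontier G) = 0 := by
  obtain ⟨N, W, hWo, hcov, hW⟩ := hG.exists_charts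
  have h1 : frontier G ⊆ ⋃ k, frontier G ∩ W k := fun x hx => by
    obtain ⟨k, hk⟩ := mem_iUnion.1 (hcov hx)
    exact mem_iUnion.2 ⟨k, hx, hk⟩
  refine measure_mono_null h1 (measure_iUnion_null fun k => ?_)
  obtain ⟨ν, g, C, hν, hg, hGW⟩ := hW k
  refine measure_mono_null ?_ (volume_setOf_eq_inner_eq_zero hν hg.continuous)
  rintro x ⟨hx, hxW⟩
  rw [hG.isOpen.frontier_eq] at hx
  have hFc : Continuous fun x : Pt n =>
      inner ℝ ν x - g ((Submodule.span ℝ {ν})ᗮ.orthogonalProjectionOnto x) :=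
    (continuous_const.inner continuous_id).sub (hg.continuous.comp (ContinuousLinearMap.continuous _))
  have h2 : x ∈ closure (G ∩ W k) := by
    rw [inter_comm]
    exact (hWo k).inter_closure ⟨hxW, hx.1⟩
  have h3 : x ∈ {x : Pt n | 0 ≤ inner ℝ ν x
      - g ((Submodule.span ℝ {ν})ᗮ.orthogonalProjectionOnto x)} := by
    refine closure_minimal ?_ (isClosed_le continuous_const hFc) h2
    rw [hGW]
    exact fun y hy => sub_nonneg.2 hy.2.le
  have h4 : ¬ g ((Submodule.span ℝ {ν})ᗮ.orthogonalProjectionOnto x) < inner ℝ ν x := fun hlt => by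
    have : x ∈ G ∩ W k := by rw [hGW]; exact ⟨hxW, hlt⟩
    exact hx.2 this.1
  exact le_antisymm (sub_nonpos.2 (not_lt.1 h4)) h3

theorem compl_ae_eq_compl_closure {G : Set (Pt n)} (hG : volume (frontier G) = 0) :
    (Gᶜ : Set (Pt n)) =ᵐ[volume] (closure G)ᶜ :=
  (closure_ae_eq_of_null_frontier hG).symm.compl

end Boundary

/-! ### Restriction to G and extension by zero. -/

section Extension

variable {n h : ℕ} {G : Set (Pt n)}

/-- The restriction `L²(ℝⁿ) → L²(G)`. -/
def restrictL (G : Set (Pt n)) (h : ℕ) : L2Full n h →L[ℂ] L2Cl G h :=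
  LpToLpRestrictCLM (Pt n) (Cl h) ℂ volume 2 G

theorem restrictL_ae_eq (w : L2Full n h) : restrictL G h w =ᵐ[volume.restrict G] w :=
  LpToLpRestrictCLM_coeFn ℂ G w

theorem adjoint_restrictL_ae_eq (hG : MeasurableSet G) (v : L2Cl G h) :
    ContinuousLinearMap.adjoint (restrictL G h) v =ᵐ[volume] G.indicator v := by
  have hm : MemLp (G.indicator v) 2 volume := (memLp_indicator_iff_restrict hG).2 (Lp.memLp v)
  have h1 : ContinuousLinearMap.adjoint (restrictL G h) v = hm.toLp _ := by
    refine ext_inner_right ℂ fun w => ?_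
    rw [ContinuousLinearMap.adjoint_inner_left, L2.inner_def, L2.inner_def,
      ← integral_indicator hG]
    have h2 := (ae_restrict_iff' hG).1 (restrictL_ae_eq (G := G) w)
    refine integral_congr_ae ?_
    filter_upwards [h2, hm.coeFn_toLp] with x hx1 hx2
    rw [hx2]
    by_cases hx : x ∈ G
    · rw [indicator_of_mem hx, indicator_of_mem hx, hx1 hx]
    · rw [indicator_of_notMem hx, indicator_of_notMem hx, inner_zero_left]
  rw [h1]
  exact hm.coeFn_toLp

theorem norm_sq_eq_integral {μ : Measure (Pt n)} (w : Lp (Cl h) 2 μ) :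
    ‖w‖ ^ 2 = ∫ x, ‖w x‖ ^ 2 ∂μ := by
  have h1 : ((‖w‖ ^ 2 : ℝ) : ℂ) = ((∫ x, ‖w x‖ ^ 2 ∂μ : ℝ) : ℂ) := by
    have h2 := inner_self_eq_norm_sq_to_K (𝕜 := ℂ) w
    rw [L2.inner_def] at h2
    rw [← integral_complex_ofReal]
    push_cast
    refine h2.symm.trans (integral_congr_ae (Eventually.of_forall fun x => ?_))
    simp only [inner_self_eq_norm_sq_to_K]
    rfl
  exact_mod_cast h1

theorem isFiniteMeasure_restrict_of_isBounded (hG : Bornology.IsBounded G) :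
    IsFiniteMeasure ((volume : Measure (Pt n)).restrict G) :=
  ⟨by rw [Measure.restrict_apply_univ]; exact hG.measure_lt_top⟩

theorem integrableOn_of_isBounded (hG : Bornology.IsBounded G) (v : L2Cl G h) :
    IntegrableOn v G := by
  have := isFiniteMeasure_restrict_of_isBounded hG
  exact (Lp.memLp v).integrable (by norm_num)

theorem teodorescu_eq_integral_indicator (hnh : n ≤ h) (hG : MeasurableSet G) (a₀ : ℝ) (a : Pt n)
    (v : Pt n → Cl h) (x : Pt n) :
    teodorescu hnh G a₀ a v x = ∫ y, eKernel hnh a₀ a (x - y) * G.indicator v y := by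
  rw [teodorescu, ← integral_indicator hG]
  refine integral_congr_ae (Eventually.of_forall fun y => ?_)
  by_cases hy : y ∈ G
  · simp only [indicator_of_mem hy]
  · simp only [indicator_of_notMem hy, mul_zero]

end Extension

/-! ### Uniqueness of the weak Dirac derivative. -/

section WeakDirac

variable {n h : ℕ} {hnh : n ≤ h} {a₀ : ℝ} {a : Pt n} {Ω : Set (Pt n)} {u w w' : Pt n → Cl h}

theorem IsWeakDirac.congr_right (hw : IsWeakDirac hnh Ω a₀ a u w)
    (hww' : w =ᵐ[volume.restrict Ω] w') : IsWeakDirac hnh Ω a₀ a u w' where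
  locallyIntegrable_left := hw.locallyIntegrable_left
  locallyIntegrable_right x hx := by
    obtain ⟨s, hs, hi⟩ := hw.locallyIntegrable_right x hx
    refine ⟨s ∩ Ω, inter_mem hs self_mem_nhdsWithin, ?_⟩
    exact (hi.mono_set inter_subset_left).congr_fun_ae (ae_restrict_of_ae_restrict_of_subset
      inter_subset_right hww')
  integral_eq φ hφ hφs hφΩ := by
    rw [← hw.integral_eq φ hφ hφs hφΩ]
    refine integral_congr_ae ?_
    filter_upwards [hww'] with x hx
    rw [hx]

theorem IsWeakDirac.ae_eq (hΩ : IsOpen Ω) (hw : IsWeakDirac hnh Ω a₀ a u w)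
    (hw' : IsWeakDirac hnh Ω a₀ a u w') (hi : IntegrableOn w Ω) (hi' : IntegrableOn w' Ω) :
    w =ᵐ[volume.restrict Ω] w' := by
  have h1 := hΩ.ae_eq_zero_of_integral_contDiff_smul_eq_zero (μ := volume.restrict Ω)
    (f := fun x => w x - w' x) ((hi.sub hi').locallyIntegrable.locallyIntegrableOn Ω) ?_
  · filter_upwards [h1, ae_restrict_mem hΩ.measurableSet] with x hx hxΩ
    exact sub_eq_zero.1 (hx hxΩ)
  · intro φ hφ hφs hφΩ
    have e1 := hw.integral_eq φ hφ hφs hφΩ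
    rw [← hw'.integral_eq φ hφ hφs hφΩ] at e1
    simp only [Complex.coe_smul] at e1
    have j1 := hi.locallyIntegrable.integrable_smul_left_of_hasCompactSupport hφ.continuous hφs
    have j2 := hi'.locallyIntegrable.integrable_smul_left_of_hasCompactSupport hφ.continuous hφs
    simp only [smul_sub]
    rw [integral_sub j1 j2, e1, sub_self]

end WeakDirac

/-! ### The operator and its energy identity. -/

section Operator

variable {n h : ℕ} (hnh : n ≤ h) (G : Set (Pt n)) (a₀ : ℝ) (a : Pt n)

/-- The operator `D_{ia} 𝒫 T_{ia}` on `L²(G)`, as a compression of an orthogonal projection. -/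
def dptOp : L2Cl G h →L[ℂ] L2Cl G h :=
  (restrictL G h).comp ((diracSpace hnh a₀ a).starProjection.comp
    (ContinuousLinearMap.adjoint (restrictL G h)))

/-- `D_{ia} 𝒫 T_{ia} v` on the whole space. -/
def dptFull (v : L2Cl G h) : L2Full n h :=
  (diracSpace hnh a₀ a).starProjection (ContinuousLinearMap.adjoint (restrictL G h) v)

theorem dptOp_ae_eq (v : L2Cl G h) :
    dptOp hnh G a₀ a v =ᵐ[volume.restrict G] dptFull hnh G a₀ a v :=
  restrictL_ae_eq _

/-- Moving R across the product gives ⟨ΠR*v, R*v⟩, and Π is an orthogonal projection. -/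
theorem re_inner_dptOp (v : L2Cl G h) :
    (inner ℂ (dptOp hnh G a₀ a v) v).re = ‖dptFull hnh G a₀ a v‖ ^ 2 := by
  have h1 := Submodule.re_inner_starProjection_eq_normSq (diracSpace hnh a₀ a)
    (ContinuousLinearMap.adjoint (restrictL G h) v)
  rw [ContinuousLinearMap.adjoint_inner_right] at h1
  exact h1

variable {hnh G a₀ a}

theorem isParavector_dptOp (v : L2Cl G h) : dptOp hnh G a₀ a v ∈ pvecL2 hnh G := by
  have h1 := ae_eq_paravec_of_mem_diracSpace hnh a₀ a
    (Submodule.starProjection_apply_mem (diracSpace hnh a₀ a)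
      (ContinuousLinearMap.adjoint (restrictL G h) v))
  have h2 : ∀ᵐ x ∂(volume.restrict G), IsParavector n hnh (dptOp hnh G a₀ a v x) := by
    filter_upwards [ae_restrict_of_ae h1, dptOp_ae_eq hnh G a₀ a v] with x hx1 hx2
    rw [hx2]
    exact ⟨_, _, hx1⟩
  exact h2

theorem IsBoundedLipschitzDomain.integrable_indicator (hG : IsBoundedLipschitzDomain G)
    (v : L2Cl G h) : Integrable (G.indicator v) :=
  (integrable_indicator_iff hG.isOpen.measurableSet).2 (integrableOn_of_isBounded hG.isBounded v)

theorem IsBoundedLipschitzDomain.exists_indicator_eq_zero (hG : IsBoundedLipschitzDomain G) :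
    ∃ r : ℝ, ∀ (v : Pt n → Cl h) (y : Pt n), r < ‖y‖ → G.indicator v y = 0 := by
  obtain ⟨r, hr⟩ := hG.isBounded.subset_closedBall (0 : Pt n)
  refine ⟨r, fun v y hy => indicator_of_notMem (fun hyG => ?_) _⟩
  exact absurd (mem_closedBall_zero_iff.1 (hr hyG)) (not_le.2 hy)

theorem IsBoundedLipschitzDomain.ae_integrableOn_eKernel_mul (hG : IsBoundedLipschitzDomain G)
    (hn : 1 ≤ n) (hnh : n ≤ h) (a₀ : ℝ) (a : Pt n) (v : L2Cl G h) :
    ∀ᵐ x : Pt n, IntegrableOn (fun y => eKernel hnh a₀ a (x - y) * v y) G := by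
  obtain ⟨k, q, C, hp⟩ := exists_isRadialProfile hn a₀
  obtain ⟨r, hr⟩ := hG.exists_indicator_eq_zero (h := h)
  filter_upwards [ae_integrable_kernel_mul (hp.locallyIntegrable_eKernel hnh a hn)
    (hG.integrable_indicator v) (hr v)] with x hx
  refine hx.integrableOn.congr_fun (fun y hy => ?_) hG.isOpen.measurableSet
  simp only [indicator_of_mem hy]

theorem IsBoundedLipschitzDomain.isWeakDirac_projP (hG : IsBoundedLipschitzDomain G)
    (hn : 1 ≤ n) (v : L2Cl G h) (Ω : Set (Pt n)) :
    IsWeakDirac hnh Ω a₀ a (fun x => projP (teodorescu hnh G a₀ a v x))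
      (dptFull hnh G a₀ a v) := by
  obtain ⟨k, q, C, hp⟩ := exists_isRadialProfile hn a₀
  obtain ⟨r, hr⟩ := hG.exists_indicator_eq_zero (h := h)
  simp only [teodorescu_eq_integral_indicator hnh hG.isOpen.measurableSet]
  exact hp.isWeakDirac_projP hnh hn (hG.integrable_indicator v) (hr v)
    (adjoint_restrictL_ae_eq hG.isOpen.measurableSet v) Ω

theorem IsBoundedLipschitzDomain.isWeakDirac_projQ (hG : IsBoundedLipschitzDomain G)
    (hn : 1 ≤ n) (v : L2Cl G h) :
    IsWeakDirac hnh (closure G)ᶜ a₀ a (fun x => projQ (teodorescu hnh G a₀ a v x))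
      (fun x => -dptFull hnh G a₀ a v x) := by
  obtain ⟨k, q, C, hp⟩ := exists_isRadialProfile hn a₀
  obtain ⟨r, hr⟩ := hG.exists_indicator_eq_zero (h := h)
  simp only [teodorescu_eq_integral_indicator hnh hG.isOpen.measurableSet]
  exact hp.isWeakDirac_projQ hnh hn (hG.integrable_indicator v) (hr v)
    (adjoint_restrictL_ae_eq hG.isOpen.measurableSet v)
    fun y hy => indicator_of_notMem (fun hyG => hy (subset_closure hyG)) _

theorem IsBoundedLipschitzDomain.isDPT_dptOp (hG : IsBoundedLipschitzDomain G) (hn : 1 ≤ n) :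
    IsDPT hnh G a₀ a (dptOp hnh G a₀ a) := fun v =>
  (hG.isWeakDirac_projP hn v G).congr_right (dptOp_ae_eq hnh G a₀ a v).symm

theorem IsBoundedLipschitzDomain.eq_dptOp (hG : IsBoundedLipschitzDomain G) (hn : 1 ≤ n)
    {B : L2Cl G h →L[ℂ] L2Cl G h} (hB : IsDPT hnh G a₀ a B) : B = dptOp hnh G a₀ a := by
  ext1 v
  exact Lp.ext ((hB v).ae_eq hG.isOpen (hG.isDPT_dptOp hn v)
    (integrableOn_of_isBounded hG.isBounded _) (integrableOn_of_isBounded hG.isBounded _))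

/-- The integral over ℝⁿ is split at G; the null frontier lets the exterior replace the complement.
-/
theorem IsBoundedLipschitzDomain.norm_sq_dptFull (hG : IsBoundedLipschitzDomain G)
    (v : L2Cl G h) : ‖dptFull hnh G a₀ a v‖ ^ 2 = ‖dptOp hnh G a₀ a v‖ ^ 2
      + ∫ x in (closure G)ᶜ, ‖dptFull hnh G a₀ a v x‖ ^ 2 := by
  have hi : Integrable (fun x => ‖dptFull hnh G a₀ a v x‖ ^ 2) :=
    (Lp.memLp (dptFull hnh G a₀ a v)).integrable_norm_pow (by norm_num)
  rw [norm_sq_eq_integral, norm_sq_eq_integral, ← integral_add_compl hG.isOpen.measurableSet hi,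
    setIntegral_congr_set (compl_ae_eq_compl_closure hG.volume_frontier)]
  congr 1
  refine integral_congr_ae ?_
  filter_upwards [dptOp_ae_eq hnh G a₀ a v] with x hx
  rw [hx]

theorem isMonotoneOp_dptOp : IsMonotoneOp (dptOp hnh G a₀ a) := fun u v => by
  rw [← map_sub, re_inner_dptOp]; positivity

/-- The energy identity gives ‖Bv‖² ≤ (Bv, v) ≤ ‖Bv‖ ‖v‖. -/
theorem IsBoundedLipschitzDomain.norm_dptOp_le (hG : IsBoundedLipschitzDomain G) :
    ‖dptOp hnh G a₀ a‖ ≤ 1 := by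
  refine ContinuousLinearMap.opNorm_le_bound _ zero_le_one fun v => ?_
  rw [one_mul]
  have h1 : ‖dptOp hnh G a₀ a v‖ ^ 2 ≤ ‖dptOp hnh G a₀ a v‖ * ‖v‖ := by
    have h2 : 0 ≤ ∫ x in (closure G)ᶜ, ‖dptFull hnh G a₀ a v x‖ ^ 2 :=
      integral_nonneg fun x => by positivity
    have h3 := re_inner_dptOp hnh G a₀ a v
    rw [hG.norm_sq_dptFull] at h3
    have h4 : (inner ℂ (dptOp hnh G a₀ a v) v).re ≤ ‖dptOp hnh G a₀ a v‖ * ‖v‖ :=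
      re_inner_le_norm (𝕜 := ℂ) _ _
    linarith
  rcases (norm_nonneg (dptOp hnh G a₀ a v)).eq_or_lt with h0 | h0
  · rw [← h0]; positivity
  · rw [sq] at h1
    exact le_of_mul_le_mul_left h1 h0

end Operator

/-! ### Adding a monotone operator. -/

section Perturbation

variable {H : Type*} [NormedAddCommGroup H] [InnerProductSpace ℂ H] {A K : H → H}

theorem IsMonotoneOp.add (hA : IsMonotoneOp A) (hK : IsMonotoneOp K) :
    IsMonotoneOp fun u => A u + K u := fun u v => by
  rw [add_sub_add_comm, inner_add_left, Complex.add_re]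
  exact add_nonneg (hA u v) (hK u v)

theorem IsStrictlyMonotoneOp.add (hA : IsStrictlyMonotoneOp A) (hK : IsMonotoneOp K) :
    IsStrictlyMonotoneOp fun u => A u + K u := fun u v huv => by
  rw [add_sub_add_comm, inner_add_left, Complex.add_re]
  exact add_pos_of_pos_of_nonneg (hA u v huv) (hK u v)

theorem IsCoerciveOp.add (hA : IsCoerciveOp A) (hK : ∀ u, 0 ≤ (inner ℂ (K u) u).re) :
    IsCoerciveOp fun u => A u + K u := by
  refine tendsto_atTop_mono (fun u => ?_) hA
  rw [inner_add_left, Complex.add_re]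
  gcongr
  exact le_add_of_nonneg_right (hK u)

theorem IsHemicontinuousOp.add (hA : IsHemicontinuousOp A) (hK : IsHemicontinuousOp K) :
    IsHemicontinuousOp fun u => A u + K u := fun u v w => by
  simp only [inner_add_left, Complex.add_re]
  exact (hA u v w).add (hK u v w)

end Perturbation

end

/-! ### The theorem. -/

theorem theorem2 (n h : ℕ) (hn : 1 ≤ n) (hnh : n ≤ h) (G : Set (Pt n))
    (hG : IsBoundedLipschitzDomain G) (a₀ : ℝ) (a : Pt n) :
    -- the integral `T_{ia} v` converges almost everywhere
    (∀ v : L2Cl G h, ∀ᵐ x : Pt n,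
      MeasureTheory.IntegrableOn (fun y => eKernel hnh a₀ a (x - y) * v y) G) ∧
    -- `D_{ia} 𝒫 T_{ia}` is a well-defined bounded linear operator on `L_2(G)`
    (∃! B : L2Cl G h →L[ℂ] L2Cl G h, IsDPT hnh G a₀ a B) ∧
    ∀ B : L2Cl G h →L[ℂ] L2Cl G h, IsDPT hnh G a₀ a B →
      -- it is monotone, with norm at most one
      IsMonotoneOp B ∧ ‖B‖ ≤ 1 ∧
      -- the energy identity
      (∀ v : L2Cl G h, ∃ wP wQ : Pt n → Cl h,
        MeasureTheory.MemLp wP 2 (MeasureTheory.volume.restrict (closure G)ᶜ) ∧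
        MeasureTheory.MemLp wQ 2 (MeasureTheory.volume.restrict (closure G)ᶜ) ∧
        IsWeakDirac hnh (closure G)ᶜ a₀ a
          (fun x => projP (teodorescu hnh G a₀ a v x)) wP ∧
        IsWeakDirac hnh (closure G)ᶜ a₀ a
          (fun x => projQ (teodorescu hnh G a₀ a v x)) wQ ∧
        (inner ℂ (B v) v).re = ‖B v‖ ^ 2
          + 1 / 2 * ((∫ x in (closure G)ᶜ, ‖wP x‖ ^ 2) + ∫ x in (closure G)ᶜ, ‖wQ x‖ ^ 2)) ∧
      -- it preserves paravector-valued functions, and adding it to an operator `F` on the space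
      -- of these keeps all hypotheses of the Browder-Minty theorem
      ∃ hB : ∀ u ∈ pvecL2 hnh G, B u ∈ pvecL2 hnh G,
        ∀ F : pvecL2 hnh G → pvecL2 hnh G,
          (IsMonotoneOp F → IsMonotoneOp fun u => F u + ⟨B u, hB u u.2⟩) ∧
          (IsStrictlyMonotoneOp F → IsStrictlyMonotoneOp fun u => F u + ⟨B u, hB u u.2⟩) ∧
          (IsCoerciveOp F → IsCoerciveOp fun u => F u + ⟨B u, hB u u.2⟩) ∧
          (IsHemicontinuousOp F → IsHemicontinuousOp fun u => F u + ⟨B u, hB u u.2⟩) := by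
  refine ⟨hG.ae_integrableOn_eKernel_mul hn hnh a₀ a,
    ⟨dptOp hnh G a₀ a, hG.isDPT_dptOp hn, fun B hB => hG.eq_dptOp hn hB⟩, fun B hB => ?_⟩
  rw [hG.eq_dptOp hn hB]
  refine ⟨isMonotoneOp_dptOp, hG.norm_dptOp_le, fun v => ?_, fun u _ => isParavector_dptOp u,
    fun F => ?_⟩
  · have hL := (MeasureTheory.Lp.memLp (dptFull hnh G a₀ a v)).restrict (closure G)ᶜ
    -- The two exterior derivatives differ only by sign, so half the sum of their squared norms is
    -- the exterior energy of the projection.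
    refine ⟨dptFull hnh G a₀ a v, fun x => -dptFull hnh G a₀ a v x, hL, hL.neg,
      hG.isWeakDirac_projP hn v _, hG.isWeakDirac_projQ hn v, ?_⟩
    rw [re_inner_dptOp, hG.norm_sq_dptFull]
    simp only [norm_neg]
    ring
  -- The subspace carries the ambient scalar product, so the properties of B on L²(G) pass to its
  -- restriction.
  · set K : pvecL2 hnh G → pvecL2 hnh G :=
      fun u => ⟨dptOp hnh G a₀ a u, isParavector_dptOp u.1⟩
    have hK : IsMonotoneOp K := fun u v => isMonotoneOp_dptOp u.1 v.1
    have hK0 : ∀ u, 0 ≤ (inner ℂ (K u) u).re := fun u => by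
      have : (inner ℂ (K u) u).re = _ := re_inner_dptOp hnh G a₀ a u.1
      rw [this]; positivity
    have hKc : IsHemicontinuousOp K := fun u v w => by
      have h1 : Continuous fun t : ℝ =>
          (inner ℂ (dptOp hnh G a₀ a (u.1 + (t : ℂ) • v.1)) w.1).re := by fun_prop
      exact h1.continuousOn
    exact ⟨fun hF => hF.add hK, fun hF => hF.add hK, fun hF => hF.add hK0, fun hF => hF.add hKc⟩
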